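/- Let $E$ be a small category and let $CAT$ be the category of small categories and functors. Let $\mathrm{Fib}(E)$ be the category whose objects are the categories fibred over $E$ and whose maps are the cartesian functors over $E$. A *generalized model category* is a category with three classes of maps (weak equivalences $W$, cofibrations $C$, fibrations $F$) such that: there are initial and terminal objects; pushouts of cofibrations and pullbacks of fibrations along arbitrary maps exist; $W$ has the two out of three property; $(C, F\cap W)$ and $(C\cap W, F)$ are weak factorization systems. It is a *model category* if moreover all small limits and colimits exist. An adjoint pair $(F,G)$ between generalized model categories $\mathcal M,\mathcal N$, with $F\colon\mathcal M\to\mathcal N$ the left adjoint, is a *Quillen equivalence* if $F$ preserves cofibrations and trivial cofibrations and if, for every cofibrant $A$ in $\mathcal M$ and fibrant $X$ in $\mathcal N$, a map $FA\to X$ is a weak equivalence if and only if its adjunct $A\to GX$ is. The category $\mathrm{Fib}(E)$ is a generalized model category with weak equivalences the cartesian functors whose underlying functor is an equivalence of categories, cofibrations the cartesian functors that are injective on objects, and fibrations the cartesian functors whose underlying functor is an isofibration. The category $[E^{op},CAT]$ is a model category $[E^{op},CAT]_{inj}$ with the objectwise equivalences as weak equivalences and the objectwise injective-on-objects maps as cofibrations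 (and as fibrations the maps with the right lifting property with respect to the trivial cofibrations), and a model category $[E^{op},CAT]_{proj}$ with the objectwise equivalences as weak equivalences and the objectwise isofibrations as fibrations (and as cofibrations the maps with the left lifting property with respect to the trivial fibrations). Let $\Phi\colon[E^{op},CAT]\to\mathrm{Fib}(E)$ be the Grothendieck construction. Let $\mathcal S\colon\mathrm{Fib}(E)\to[E^{op},CAT]$ be the functor $\mathcal SF(S)=\mathbf{Cart}_E(E_{/S},F)$, the category of cartesian functors from the slice category $E_{/S}$ to $F$ and vertical natural transformations. Let $\mathsf L\colon\mathrm{Fib}(E)\to[E^{op},CAT]$ be the functor for which $\mathsf LF(S)$ is obtained from $E^{/S}\times_E F$, where $E^{/S}$ is the category of objects of $E$ under $S$, by formally inverting the maps that are cartesian over $E^{/S}$. Then: (1) $\mathcal S$ is right adjoint to $\Phi$, and the adjoint pair $(\Phi,\mathcal S)$ is a Quillen equivalence between $[E^{op},CAT]_{inj}$ and $\mathrm{Fib}(E)$. (2) $\mathsf L$ is left adjoint to $\Phi$, and the adjoint pair $(\mathsf L,\Phi)$ is a Quillen equivalence between $\mathrm{Fib}(E)$ and $[E^{op},CAT]_{proj}$.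 -/

import Mathlib

open CategoryTheory CategoryTheory.Limits Opposite

universe u v w

/-! ### Generalized model categories -/

/-- Three classes of maps of a category: weak equivalences, cofibrations and fibrations. -/
structure ModelData (M : Type w) [Category.{v} M] where
  /-- the weak equivalences -/
  weq : MorphismProperty M
  /-- the cofibrations -/
  cof : MorphismProperty M
  /-- the fibrations -/
  fib : MorphismProperty M

namespace ModelData

variable {M : Type w} [Category.{v} M]

/-- The axioms of a generalized model category. -/
structure IsGeneralizedModelCategory (D : ModelData M) : Prop where
  hasInitial : HasInitial M
  hasTerminal : HasTerminal M
  hasPushout : ∀ ⦃X Y Z : M⦄ (i : X ⟶ Y) (g : X ⟶ Z), D.cof i → HasPushout i g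
  hasPullback : ∀ ⦃X Y Z : M⦄ (p : X ⟶ Z) (g : Y ⟶ Z), D.fib p → HasPullback p g
  twoOutOfThree : D.weq.HasTwoOutOfThreeProperty
  cof_trivialFib : MorphismProperty.IsWeakFactorizationSystem D.cof (D.fib ⊓ D.weq)
  trivialCof_fib : MorphismProperty.IsWeakFactorizationSystem (D.cof ⊓ D.weq) D.fib

/-- A model category: a generalized model category with all small limits and colimits. -/
structure IsModelCategory (D : ModelData M) : Prop extends D.IsGeneralizedModelCategory where
  hasLimits : HasLimits M
  hasColimits : HasColimits M

/-- `X` is cofibrant: the map from the initial object to `X` is a cofibration. -/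
def IsCofibrant (D : ModelData M) (X : M) : Prop :=
  ∃ (I : M) (hI : IsInitial I), D.cof (hI.to X)

/-- `X` is fibrant: the map from `X` to the terminal object is a fibration. -/
def IsFibrant (D : ModelData M) (X : M) : Prop :=
  ∃ (T : M) (hT : IsTerminal T), D.fib (hT.from X)

end ModelData

section Quillen

variable {M : Type*} [Category* M] {N : Type*} [Category* N] {F : M ⥤ N} {G : N ⥤ M}

/-- `(F, G)` is a Quillen pair: `F` preserves cofibrations and trivial cofibrations. -/
structure IsQuillenPair (D : ModelData M) (D' : ModelData N) (_adj : F ⊣ G) : Prop where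
  map_cof : ∀ ⦃X Y : M⦄ (f : X ⟶ Y), D.cof f → D'.cof (F.map f)
  map_trivialCof : ∀ ⦃X Y : M⦄ (f : X ⟶ Y),
    (D.cof ⊓ D.weq) f → (D'.cof ⊓ D'.weq) (F.map f)

/-- `(F, G)` is a Quillen equivalence: it is a Quillen pair and, for `A` cofibrant and `X`
fibrant, a map `F A ⟶ X` is a weak equivalence if and only if its adjunct `A ⟶ G X` is. -/
structure IsQuillenEquivalence (D : ModelData M) (D' : ModelData N) (adj : F ⊣ G) : Prop
    extends IsQuillenPair D D' adj where
  weq_iff : ∀ (A : M) (X : N), D.IsCofibrant A → D'.IsFibrant X →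
    ∀ f : F.obj A ⟶ X, D'.weq f ↔ D.weq (adj.homEquiv A X f)

end Quillen

/-- A functor `F` is an isofibration: every isomorphism `F a ≅ b` lifts to an isomorphism with
source `a`. -/
def CategoryTheory.Functor.IsIsofibration {A : Type*} [Category* A] {B : Type*} [Category* B]
    (F : A ⥤ B) : Prop :=
  ∀ (a : A) (b : B) (β : F.obj a ≅ b),
    ∃ (a' : A) (α : a ≅ a') (h : F.obj a' = b), F.map α.hom ≫ eqToHom h = β.hom

/-! ### The category of fibred categories over `E` -/

/-- A category fibred over `E`. -/
structure FibCat (E : Type u) [SmallCategory E] extends BasedCategory.{u, u} E where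
  isFibered : p.IsFibered

namespace FibCat

variable {E : Type u} [SmallCategory E]

/-- A cartesian functor over `E`: a functor over `E` which takes cartesian arrows to cartesian
arrows. -/
structure Hom (F G : FibCat E) extends BasedFunctor F.toBasedCategory G.toBasedCategory where
  map_isCartesian : ∀ ⦃R S : E⦄ (f : R ⟶ S) ⦃a b : F.obj⦄ (φ : a ⟶ b),
    F.p.IsCartesian f φ → G.p.IsCartesian f (toFunctor.map φ)

theorem Hom.ext' {F G : FibCat E} {u₁ u₂ : Hom F G} (h : u₁.toFunctor = u₂.toFunctor) :
    u₁ = u₂ := by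
  obtain ⟨⟨u₁, _⟩, _⟩ := u₁
  obtain ⟨⟨u₂, _⟩, _⟩ := u₂
  obtain rfl : u₁ = u₂ := h
  rfl

/-- `Fib(E)`: categories fibred over `E` and cartesian functors. -/
instance : Category (FibCat E) where
  Hom := Hom
  id F := ⟨BasedFunctor.id F.toBasedCategory, fun _ _ _ _ _ _ h => h⟩
  comp u₁ u₂ := ⟨BasedFunctor.comp u₁.toBasedFunctor u₂.toBasedFunctor,
    fun _ _ f _ _ φ h => u₂.map_isCartesian f _ (u₁.map_isCartesian f φ h)⟩

@[simp]
theorem id_toFunctor (F : FibCat E) : (Hom.toBasedFunctor (𝟙 F)).toFunctor = 𝟭 F.obj := rfl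

@[simp]
theorem comp_toFunctor {F G H : FibCat E} (u₁ : F ⟶ G) (u₂ : G ⟶ H) :
    (Hom.toBasedFunctor (u₁ ≫ u₂)).toFunctor =
      u₁.toBasedFunctor.toFunctor ⋙ u₂.toBasedFunctor.toFunctor := rfl

theorem hom_ext {F G : FibCat E} {u₁ u₂ : F ⟶ G}
    (h : u₁.toBasedFunctor.toFunctor = u₂.toBasedFunctor.toFunctor) : u₁ = u₂ :=
  Hom.ext' h

/-- The category `Cart_E(F, G)` of cartesian functors and vertical natural transformations. -/
instance cartCategory (F G : FibCat E) : Category (F ⟶ G) where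
  Hom u₁ u₂ := BasedNatTrans u₁.toBasedFunctor u₂.toBasedFunctor
  id u₁ := BasedNatTrans.id u₁.toBasedFunctor
  comp α β := BasedNatTrans.comp α β

variable (E) in
/-- The classes of maps on `Fib(E)`: the weak equivalences are the `E`-equivalences, the
cofibrations are the maps that are injective on objects, the fibrations are the isofibrations. -/
def modelData : ModelData (FibCat E) where
  weq _ _ f := f.toBasedFunctor.toFunctor.IsEquivalence
  cof _ _ f := Function.Injective f.toBasedFunctor.toFunctor.obj
  fib _ _ f := f.toBasedFunctor.toFunctor.IsIsofibration

end FibCat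

/-! ### The injective and projective structures on `[Eᵒᵖ, CAT]` -/

section Presheaves

variable (E : Type u) [SmallCategory E]

/-- The objectwise equivalences of categories. -/
def objectwiseEquivalences : MorphismProperty (Eᵒᵖ ⥤ Cat.{u, u}) :=
  fun _ _ η => ∀ S : Eᵒᵖ, (η.app S).toFunctor.IsEquivalence

/-- The maps that are objectwise injective on objects. -/
def objectwiseInjective : MorphismProperty (Eᵒᵖ ⥤ Cat.{u, u}) :=
  fun _ _ η => ∀ S : Eᵒᵖ, Function.Injective (η.app S).toFunctor.obj

/-- The objectwise isofibrations. -/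
def objectwiseIsofibrations : MorphismProperty (Eᵒᵖ ⥤ Cat.{u, u}) :=
  fun _ _ η => ∀ S : Eᵒᵖ, (η.app S).toFunctor.IsIsofibration

/-- The injective structure; the fibrations are the maps with the right lifting property with
respect to the trivial cofibrations. -/
def injectiveModelData : ModelData (Eᵒᵖ ⥤ Cat.{u, u}) where
  weq := objectwiseEquivalences E
  cof := objectwiseInjective E
  fib := (objectwiseInjective E ⊓ objectwiseEquivalences E).rlp

/-- The projective structure; the cofibrations are the maps with the left lifting property with
respect to the trivial fibrations. -/
def projectiveModelData : ModelData (Eᵒᵖ ⥤ Cat.{u, u}) where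
  weq := objectwiseEquivalences E
  cof := (objectwiseIsofibrations E ⊓ objectwiseEquivalences E).llp
  fib := objectwiseIsofibrations E

end Presheaves

/-! ### The Grothendieck construction `Φ` -/

section Grothendieck

variable {E : Type u} [SmallCategory E]

/-- Objects of the Grothendieck construction of `P : Eᵒᵖ ⥤ CAT`. -/
structure Groth (P : Eᵒᵖ ⥤ Cat.{u, u}) : Type u where
  /-- the object of the base -/
  base : E
  /-- the object of the fibre -/
  fiber : P.obj (op base)

namespace Groth

variable {P Q R : Eᵒᵖ ⥤ Cat.{u, u}}

/-- A map `(S, x) ⟶ (T, y)` is a map `f : S ⟶ T` with a map `x ⟶ P(f)(y)`. -/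
structure Hom (x y : Groth P) : Type u where
  /-- the map of the base -/
  base : x.base ⟶ y.base
  /-- the map of the fibre -/
  fiber : x.fiber ⟶ (P.map base.op).toFunctor.obj y.fiber

theorem Hom.ext' {x y : Groth P} {f g : Hom x y} (h : f.base = g.base)
    (h' : f.fiber ≫ eqToHom (by rw [h]) = g.fiber) : f = g := by
  obtain ⟨f, f'⟩ := f
  obtain ⟨g, g'⟩ := g
  obtain rfl : f = g := h
  simp at h'
  rw [h']

theorem map_id_obj (P : Eᵒᵖ ⥤ Cat.{u, u}) {S : E} (x : P.obj (op S)) :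
    x = (P.map (𝟙 S).op).toFunctor.obj x := by
  simp

theorem map_comp_obj (P : Eᵒᵖ ⥤ Cat.{u, u}) {S T U : E} (f : S ⟶ T) (g : T ⟶ U)
    (x : P.obj (op U)) : (P.map f.op).toFunctor.obj ((P.map g.op).toFunctor.obj x) =
      (P.map (f ≫ g).op).toFunctor.obj x := by
  simp

theorem map_id_map (P : Eᵒᵖ ⥤ Cat.{u, u}) {S : Eᵒᵖ} {x y : P.obj S} (φ : x ⟶ y) :
    (P.map (𝟙 S)).toFunctor.map φ =
      eqToHom (by simp) ≫ φ ≫ eqToHom (by simp) := by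
  have h : (P.map (𝟙 S)).toFunctor = 𝟭 _ := by simp
  simpa using Functor.congr_hom h φ

theorem map_comp_map (P : Eᵒᵖ ⥤ Cat.{u, u}) {S T U : Eᵒᵖ} (f : S ⟶ T) (g : T ⟶ U)
    {x y : P.obj S} (φ : x ⟶ y) : (P.map (f ≫ g)).toFunctor.map φ =
      eqToHom (by simp) ≫ (P.map g).toFunctor.map ((P.map f).toFunctor.map φ) ≫
        eqToHom (by simp) := by
  have h : (P.map (f ≫ g)).toFunctor = (P.map f).toFunctor ⋙ (P.map g).toFunctor := by simp
  simpa using Functor.congr_hom h φ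

theorem naturality_map (η : P ⟶ Q) {S T : Eᵒᵖ} (f : S ⟶ T) {x y : P.obj S} (φ : x ⟶ y) :
    (η.app T).toFunctor.map ((P.map f).toFunctor.map φ) =
      eqToHom (congrArg (fun F => F.toFunctor.obj x) (η.naturality f)) ≫
        (Q.map f).toFunctor.map ((η.app S).toFunctor.map φ) ≫
          eqToHom (congrArg (fun F => F.toFunctor.obj y) (η.naturality f)).symm := by
  have h : (P.map f).toFunctor ⋙ (η.app T).toFunctor =
    (η.app S).toFunctor ⋙ (Q.map f).toFunctor := congrArg Cat.Hom.toFunctor (η.naturality f)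
  simpa using Functor.congr_hom h φ

instance : CategoryStruct (Groth P) where
  Hom := Hom
  id x := ⟨𝟙 x.base, eqToHom (map_id_obj P x.fiber)⟩
  comp f g := ⟨f.base ≫ g.base, f.fiber ≫ (P.map f.base.op).toFunctor.map g.fiber ≫
    eqToHom (map_comp_obj P _ _ _)⟩

@[simp] theorem id_base (x : Groth P) : Hom.base (𝟙 x) = 𝟙 x.base := rfl
@[simp] theorem id_fiber (x : Groth P) :
    Hom.fiber (𝟙 x) = eqToHom (map_id_obj P x.fiber) := rfl
@[simp] theorem comp_base {x y z : Groth P} (f : x ⟶ y) (g : y ⟶ z) :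
    Hom.base (f ≫ g) = f.base ≫ g.base := rfl
@[simp] theorem comp_fiber {x y z : Groth P} (f : x ⟶ y) (g : y ⟶ z) :
    Hom.fiber (f ≫ g) = f.fiber ≫ (P.map f.base.op).toFunctor.map g.fiber ≫
      eqToHom (map_comp_obj P _ _ _) := rfl

instance : Category (Groth P) where
  id_comp f := by
    refine Hom.ext' (by simp) ?_
    simp [map_id_map]
  comp_id f := by
    refine Hom.ext' (by simp) ?_
    simp [eqToHom_map]
  assoc f g h := by
    refine Hom.ext' (by simp) ?_
    simp [map_comp_map, eqToHom_map]

/-- The projection to the base. -/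
abbrev proj (P : Eᵒᵖ ⥤ Cat.{u, u}) : Groth P ⥤ E where
  obj x := x.base
  map f := f.base

theorem base_eq_of_isHomLift {x y : Groth P} (f : x.base ⟶ y.base) (φ : x ⟶ y)
    (h : (proj P).IsHomLift f φ) : Hom.base φ = f :=
  (IsHomLift.eq_of_isHomLift (p := proj P) (a := x) (b := y) f φ).symm

theorem isStronglyCartesian_of_isIso {x y : Groth P} (f : x.base ⟶ y.base) (φ : x ⟶ y)
    (hf : Hom.base φ = f) (hφ : IsIso (Hom.fiber φ)) : (proj P).IsStronglyCartesian f φ where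
  toIsHomLift := by subst hf; exact IsHomLift.map (proj P) φ
  universal_property' {z} (g : z.base ⟶ x.base) ψ hψ := by
    subst hf
    have hb : Hom.base ψ = g ≫ Hom.base φ := base_eq_of_isHomLift _ ψ hψ
    let χ : z ⟶ x := Hom.mk g (Hom.fiber ψ ≫ eqToHom (by rw [hb, ← map_comp_obj]) ≫
      (P.map g.op).toFunctor.map (inv (Hom.fiber φ)))
    refine ⟨χ, ⟨IsHomLift.map (proj P) χ, Hom.ext' hb.symm ?_⟩, ?_⟩
    · simp [χ]
    · rintro χ' ⟨h, rfl⟩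
      have hg : Hom.base χ' = g := base_eq_of_isHomLift _ χ' h
      subst hg
      refine Hom.ext' rfl ?_
      simp [χ]

/-- The canonical cartesian map `(S, P(f)(y)) ⟶ (T, y)` over `f : S ⟶ T`. -/
def lift {S : E} (y : Groth P) (f : S ⟶ y.base) :
    (⟨S, (P.map f.op).toFunctor.obj y.fiber⟩ : Groth P) ⟶ y :=
  Hom.mk f (𝟙 _)

theorem lift_isStronglyCartesian {S : E} (y : Groth P) (f : S ⟶ y.base) :
    (proj P).IsStronglyCartesian f (lift y f) :=
  isStronglyCartesian_of_isIso f (lift y f) rfl (by dsimp [lift]; infer_instance)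

theorem proj_isFibered (P : Eᵒᵖ ⥤ Cat.{u, u}) : (proj P).IsFibered :=
  Functor.IsFibered.of_exists_isStronglyCartesian
    fun y _ f => ⟨_, lift y f, lift_isStronglyCartesian y f⟩

/-- The functor between Grothendieck constructions induced by a natural transformation. -/
@[simps]
def map (η : P ⟶ Q) : Groth P ⥤ Groth Q where
  obj x := ⟨x.base, (η.app (op x.base)).toFunctor.obj x.fiber⟩
  map {x y} f := Hom.mk (Hom.base (x := x) (y := y) f) ((η.app (op x.base)).toFunctor.map (Hom.fiber f) ≫
    eqToHom (congrArg (fun F => F.toFunctor.obj y.fiber) (η.naturality (Hom.base f).op)))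
  map_id x := Hom.ext' rfl (by simp [eqToHom_map])
  map_comp f g := Hom.ext' rfl (by simp [eqToHom_map, naturality_map])

theorem map_id_eq (P : Eᵒᵖ ⥤ Cat.{u, u}) : map (𝟙 P) = 𝟭 (Groth P) :=
  CategoryTheory.Functor.hext (fun _ => rfl)
    fun _ y f => heq_of_eq (Hom.ext' rfl (by
      change (Hom.fiber f ≫ eqToHom _) ≫ 𝟙 ((P.map (Hom.base f).op).toFunctor.obj y.fiber) =
        Hom.fiber f
      simp))

theorem map_comp_eq_aux {A B : Type*} [Category* A] [Category* B] (F : A ⥤ B) {x y z : A}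
    (a : x ⟶ y) (h : y = z) {b b' : B} (h₁ : F.obj y = b) (h₂ : b = b') (h₃ : F.obj z = b') :
    (F.map a ≫ eqToHom h₁) ≫ eqToHom h₂ = F.map (a ≫ eqToHom h) ≫ eqToHom h₃ := by
  subst h h₁ h₂
  simp

theorem map_comp_eq (η : P ⟶ Q) (θ : Q ⟶ R) : map (η ≫ θ) = map η ⋙ map θ :=
  CategoryTheory.Functor.hext (fun _ => rfl)
    fun x _ f => heq_of_eq (Hom.ext' rfl (by
      change ((θ.app (op x.base)).toFunctor.map ((η.app (op x.base)).toFunctor.map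
        (Hom.fiber f)) ≫ eqToHom _) ≫ eqToHom _ = (θ.app (op x.base)).toFunctor.map
          ((η.app (op x.base)).toFunctor.map (Hom.fiber f) ≫ eqToHom _) ≫ eqToHom _
      exact map_comp_eq_aux (θ.app (op x.base)).toFunctor
        ((η.app (op x.base)).toFunctor.map (Hom.fiber f)) _ _ _ _))

theorem map_isHomLift (η : P ⟶ Q) {S T : E} (f : S ⟶ T) {x y : Groth P} (φ : x ⟶ y)
    (h : (proj P).IsHomLift f φ) : (proj Q).IsHomLift f ((map η).map φ) := by
  obtain ⟨⟩ := h
  exact IsHomLift.map (proj Q) ((map η).map φ)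

theorem isIso_comp_eqToHom {A : Type*} [Category* A] {x y z : A} (a : x ⟶ y) (ha : IsIso a)
    (h : y = z) : IsIso (a ≫ eqToHom h) := by
  subst h
  simpa using ha

theorem map_map_isCartesian (η : P ⟶ Q) {S T : E} (f : S ⟶ T) {x y : Groth P} (φ : x ⟶ y)
    (hφ : (proj P).IsCartesian f φ) : (proj Q).IsCartesian f ((map η).map φ) := by
  obtain rfl : x.base = S := IsHomLift.domain_eq (proj P) f φ
  obtain rfl : y.base = T := IsHomLift.codomain_eq (proj P) f φ
  have hc : (proj P).IsStronglyCartesian f (lift y f) := lift_isStronglyCartesian y f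
  have he := map_isHomLift η _ _ (Functor.IsCartesian.map_isHomLift (proj P) f (lift y f) φ)
  have hc' : (proj Q).IsStronglyCartesian f ((map η).map (lift y f)) :=
    isStronglyCartesian_of_isIso (x := (map η).obj ⟨x.base, _⟩) (y := (map η).obj y) f _ rfl
      (by
        have h₁ := (η.app (op x.base)).toFunctor.map_id ((P.map f.op).toFunctor.obj y.fiber)
        have h₂ : IsIso ((η.app (op x.base)).toFunctor.map
          (𝟙 ((P.map f.op).toFunctor.obj y.fiber))) := by rw [h₁]; infer_instance
        exact isIso_comp_eqToHom _ h₂ _)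
  have := @Functor.IsCartesian.of_iso_comp _ _ _ _ (proj Q) _ _ _ _ f ((map η).map (lift y f))
    inferInstance _ ((map η).mapIso
      (Functor.IsCartesian.domainUniqueUpToIso (proj P) f (lift y f) φ)) he
  rw [Functor.mapIso_hom, ← Functor.map_comp] at this
  simpa using this

end Groth

variable (E) in
/-- The Grothendieck construction `Φ : [Eᵒᵖ, CAT] ⥤ Fib(E)`. -/
def grothendieckFunctor : (Eᵒᵖ ⥤ Cat.{u, u}) ⥤ FibCat E where
  obj P := { obj := Groth P, p := Groth.proj P, isFibered := Groth.proj_isFibered P }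
  map η :=
    { toFunctor := Groth.map η
      w := rfl
      map_isCartesian := fun _ _ f _ _ φ hφ => Groth.map_map_isCartesian η f φ hφ }
  map_id P := FibCat.hom_ext (Groth.map_id_eq P)
  map_comp η θ := FibCat.hom_ext (Groth.map_comp_eq η θ)

end Grothendieck

/-! ### The right adjoint `𝒮` -/

section RightAdjoint

variable {E : Type u} [SmallCategory E]

theorem over_isStronglyCartesian {B : E} {x y : Over B} (φ : x ⟶ y) {T U : E} (f : T ⟶ U)
    (hφ : (Over.forget B).IsHomLift f φ) : (Over.forget B).IsStronglyCartesian f φ := by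
  obtain ⟨⟩ := hφ
  refine { universal_property' := fun {z} (g : z.left ⟶ x.left) ψ hψ => ?_ }
  have hb : ψ.left = g ≫ φ.left :=
    (@IsHomLift.eq_of_isHomLift _ _ _ _ (Over.forget B) z y _ ψ hψ).symm
  have hw : g ≫ x.hom = z.hom := by
    rw [← Over.w φ, ← Over.w ψ, hb, Category.assoc]
  let χ : z ⟶ x := Over.homMk g hw
  refine ⟨χ, ⟨IsHomLift.map (Over.forget B) χ, ?_⟩, ?_⟩
  · exact Over.OverMorphism.ext hb.symm
  · rintro χ' ⟨h, -⟩
    exact Over.OverMorphism.ext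
      (IsHomLift.eq_of_isHomLift (p := Over.forget B) (a := z) (b := x) g χ').symm

theorem over_isFibered (S : E) : (Over.forget S).IsFibered :=
  Functor.IsFibered.of_exists_isStronglyCartesian fun y T (f : T ⟶ y.left) =>
    let φ : Over.mk (f ≫ y.hom) ⟶ y := Over.homMk f rfl
    ⟨_, φ, over_isStronglyCartesian φ f (IsHomLift.map (Over.forget S) φ)⟩

theorem over_map_isCartesian {S T : E} (f : S ⟶ T) {U V : E} (g : U ⟶ V) {x y : Over S}
    (φ : x ⟶ y) (hφ : (Over.forget S).IsCartesian g φ) :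
    (Over.forget T).IsCartesian g ((Over.map f).map φ) := by
  have : (Over.forget T).IsHomLift g ((Over.map f).map φ) := by
    have := hφ.toIsHomLift
    obtain ⟨⟩ := this
    exact IsHomLift.map (Over.forget T) ((Over.map f).map φ)
  have := over_isStronglyCartesian ((Over.map f).map φ) g this
  infer_instance

/-- The fibred category `E/S` over `E`. -/
abbrev overFib (S : E) : FibCat E where
  obj := Over S
  p := Over.forget S
  isFibered := over_isFibered S

/-- The cartesian functor `E/S ⟶ E/T` given by composition with `f : S ⟶ T`. -/
def overFibMap {S T : E} (f : S ⟶ T) : overFib S ⟶ overFib T :=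
  FibCat.Hom.mk ⟨Over.map f, rfl⟩ fun _ _ g _ _ φ hφ => over_map_isCartesian f g φ hφ

theorem overFibMap_id (S : E) : overFibMap (𝟙 S) = 𝟙 (overFib S) :=
  FibCat.hom_ext (Over.mapId_eq S)

theorem overFibMap_comp {S T U : E} (f : S ⟶ T) (g : T ⟶ U) :
    overFibMap (f ≫ g) = overFibMap f ≫ overFibMap g :=
  FibCat.hom_ext (Over.mapComp_eq f g)

namespace FibCat

/-- Precomposition `Cart_E(G, H) ⥤ Cart_E(F, H)` with `u₁ : F ⟶ G`. -/
def precomp {F G : FibCat E} (u₁ : F ⟶ G) (H : FibCat E) : (G ⟶ H) ⥤ (F ⟶ H) where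
  obj u₂ := u₁ ≫ u₂
  map α := BasedCategory.whiskerLeft u₁.toBasedFunctor α

/-- Postcomposition `Cart_E(F, G) ⥤ Cart_E(F, H)` with `u₂ : G ⟶ H`. -/
def postcomp (F : FibCat E) {G H : FibCat E} (u₂ : G ⟶ H) : (F ⟶ G) ⥤ (F ⟶ H) where
  obj u₁ := u₁ ≫ u₂
  map α := BasedCategory.whiskerRight α u₂.toBasedFunctor
  map_id u₁ := BasedNatTrans.ext _ _ (NatTrans.ext (funext fun x =>
    u₂.toBasedFunctor.toFunctor.map_id (u₁.toBasedFunctor.toFunctor.obj x)))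
  map_comp α β := BasedNatTrans.ext _ _ (NatTrans.ext (funext fun x =>
    u₂.toBasedFunctor.toFunctor.map_comp (α.toNatTrans.app x) (β.toNatTrans.app x)))

theorem precomp_id (F H : FibCat E) : precomp (𝟙 F) H = 𝟭 (F ⟶ H) := rfl

theorem precomp_comp {F G K : FibCat E} (u₁ : F ⟶ G) (u₂ : G ⟶ K) (H : FibCat E) :
    precomp (u₁ ≫ u₂) H = precomp u₂ H ⋙ precomp u₁ H := rfl

end FibCat

/-- The presheaf `𝒮F : S ↦ Cart_E(E/S, F)`. -/
def cartPresheaf (F : FibCat E) : Eᵒᵖ ⥤ Cat.{u, u} where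
  obj S := Cat.of (overFib S.unop ⟶ F)
  map f := (FibCat.precomp (overFibMap f.unop) F).toCatHom
  map_id S := by
    rw [unop_id, overFibMap_id, FibCat.precomp_id]
    rfl
  map_comp f g := by
    rw [unop_comp, overFibMap_comp, FibCat.precomp_comp]
    rfl

variable (E) in
/-- The functor `𝒮 : Fib(E) ⥤ [Eᵒᵖ, CAT]`, `𝒮F(S) = Cart_E(E/S, F)`. -/
def cartFunctor : FibCat E ⥤ (Eᵒᵖ ⥤ Cat.{u, u}) where
  obj F := cartPresheaf F
  map u₁ :=
    { app := fun S => (FibCat.postcomp (overFib S.unop) u₁).toCatHom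
      naturality := fun _ _ _ => rfl }
  map_id _ := rfl
  map_comp _ _ := rfl

end RightAdjoint

/-! ### The left adjoint `L` -/

section LeftAdjoint

variable {E : Type u} [SmallCategory E]

/-- The cartesian maps of `E^{/S} ×_E F ⟶ E^{/S}`, where `E^{/S}` is the category of objects
under `S`. An object of the fibre product is an object `x` of `F` with a map `S ⟶ p(x)`, and a
map is a map of `F` whose image in `E` is compatible with the maps from `S`, so that
the fibre product is the category `StructuredArrow S F.p`; a map in it is cartesian over
`E^{/S}` if and only if the underlying map of `F` is cartesian over `E`. -/
def underCartesian (F : FibCat E) (S : E) : MorphismProperty (StructuredArrow S F.p) :=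
  fun _ _ φ => F.p.IsCartesian (F.p.map φ.right) φ.right

/-- `LF(S)`: the category obtained from `E^{/S} ×_E F` by inverting the cartesian maps. -/
abbrev UnderLoc (F : FibCat E) (S : E) : Type u := (underCartesian F S).Localization

namespace FibCat

theorem hom_obj {F G : FibCat E} (u₁ : F ⟶ G) (x : F.obj) :
    F.p.obj x = G.p.obj (u₁.toBasedFunctor.toFunctor.obj x) :=
  (u₁.toBasedFunctor.w_obj x).symm

theorem hom_map {F G : FibCat E} (u₁ : F ⟶ G) {x y : F.obj} (φ : x ⟶ y) :
    G.p.map (u₁.toBasedFunctor.toFunctor.map φ) =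
      eqToHom (hom_obj u₁ x).symm ≫ F.p.map φ ≫ eqToHom (hom_obj u₁ y) :=
  Functor.congr_hom u₁.toBasedFunctor.w φ

/-- The functor `E^{/S} ×_E F ⥤ E^{/S} ×_E G` induced by `F ⟶ G`. -/
def underMap {F G : FibCat E} (u₁ : F ⟶ G) (S : E) :
    StructuredArrow S F.p ⥤ StructuredArrow S G.p where
  obj x := StructuredArrow.mk (Y := u₁.toBasedFunctor.toFunctor.obj x.right)
    (x.hom ≫ eqToHom (hom_obj u₁ x.right))
  map {x y} φ := StructuredArrow.homMk (u₁.toBasedFunctor.toFunctor.map φ.right) (by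
    have := StructuredArrow.w φ
    simp only [StructuredArrow.mk_hom_eq_self, hom_map, Category.assoc, eqToHom_trans_assoc,
      eqToHom_refl, Category.id_comp, ← this, StructuredArrow.mk_right])
  map_id x := StructuredArrow.ext _ _ (u₁.toBasedFunctor.toFunctor.map_id _)
  map_comp φ ψ := StructuredArrow.ext _ _ (u₁.toBasedFunctor.toFunctor.map_comp _ _)

theorem structuredArrow_functor_ext {C : Type*} [Category* C] {F : FibCat E} {S : E}
    {A B : C ⥤ StructuredArrow S F.p}
    (h : A ⋙ StructuredArrow.proj S F.p = B ⋙ StructuredArrow.proj S F.p)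
    (h' : ∀ x, (A.obj x).hom ≫ F.p.map (eqToHom (Functor.congr_obj h x)) = (B.obj x).hom) :
    A = B :=
  CategoryTheory.Functor.ext
    (fun x => StructuredArrow.obj_ext _ _ (Functor.congr_obj h x) (h' x))
    fun x y φ => StructuredArrow.ext _ _ (by
      rw [StructuredArrow.comp_right, StructuredArrow.comp_right, StructuredArrow.eqToHom_right,
        StructuredArrow.eqToHom_right]
      exact Functor.congr_hom h φ)

theorem comp_map_id {C : Type*} [Category* C] (p : C ⥤ E) {S : E} (x : C) (a : S ⟶ p.obj x) :
    a ≫ p.map (𝟙 x) = a := by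
  simp

theorem comp_eqToHom_eqToHom {S T U V : E} (a : S ⟶ T) (h₁ : T = U) (h₂ : U = V) (h₃ : T = V) :
    a ≫ eqToHom h₃ = (a ≫ eqToHom h₁) ≫ eqToHom h₂ := by
  simp

theorem underMap_id (F : FibCat E) (S : E) : underMap (𝟙 F) S = 𝟭 _ :=
  structuredArrow_functor_ext rfl fun x => by
    change (x.hom ≫ 𝟙 _) ≫ F.p.map (𝟙 _) = x.hom
    exact (comp_map_id F.p _ _).trans (Category.comp_id _)

theorem underMap_comp {F G H : FibCat E} (u₁ : F ⟶ G) (u₂ : G ⟶ H) (S : E) :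
    underMap (u₁ ≫ u₂) S = underMap u₁ S ⋙ underMap u₂ S :=
  structuredArrow_functor_ext rfl fun x => by
    change (x.hom ≫ eqToHom _) ≫ H.p.map (𝟙 _) = (x.hom ≫ eqToHom _) ≫ eqToHom _
    exact (comp_map_id H.p _ _).trans (comp_eqToHom_eqToHom _ _ _ _)

theorem underMap_map {F G : FibCat E} (u₁ : F ⟶ G) {S T : E} (f : S ⟶ T) :
    underMap u₁ T ⋙ StructuredArrow.map f = StructuredArrow.map f ⋙ underMap u₁ S :=
  structuredArrow_functor_ext rfl fun x => by
    change (f ≫ x.hom ≫ eqToHom _) ≫ G.p.map (𝟙 _) = (f ≫ x.hom) ≫ eqToHom _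
    exact (comp_map_id G.p _ _).trans (Category.assoc _ _ _).symm

theorem isCartesian_map_of_isCartesian {F : FibCat E} {S T : E} {f : S ⟶ T} {x y : F.obj}
    {φ : x ⟶ y} (h : F.p.IsCartesian f φ) : F.p.IsCartesian (F.p.map φ) φ := by
  have := h.toIsHomLift
  obtain ⟨⟩ := this
  exact h

theorem underMap_inverts {F G : FibCat E} (u₁ : F ⟶ G) (S : E) :
    (underCartesian F S).IsInvertedBy (underMap u₁ S ⋙ (underCartesian G S).Q) :=
  fun _ _ φ hφ => (underCartesian G S).Q_inverts ((underMap u₁ S).map φ)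
    (isCartesian_map_of_isCartesian (u₁.map_isCartesian _ φ.right hφ))

theorem structuredArrowMap_inverts (F : FibCat E) {S T : E} (f : S ⟶ T) :
    (underCartesian F T).IsInvertedBy (StructuredArrow.map f ⋙ (underCartesian F S).Q) :=
  fun _ _ φ hφ => (underCartesian F S).Q_inverts ((StructuredArrow.map f).map φ) hφ

/-- The functor `LF(S) ⥤ LG(S)` induced by `F ⟶ G`. -/
noncomputable def locMap {F G : FibCat E} (u₁ : F ⟶ G) (S : E) : UnderLoc F S ⥤ UnderLoc G S :=
  Localization.Construction.lift _ (underMap_inverts u₁ S)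

/-- The functor `LF(T) ⥤ LF(S)` induced by `S ⟶ T`. -/
noncomputable def locRes (F : FibCat E) {S T : E} (f : S ⟶ T) : UnderLoc F T ⥤ UnderLoc F S :=
  Localization.Construction.lift _ (structuredArrowMap_inverts F f)

theorem Q_locMap {F G : FibCat E} (u₁ : F ⟶ G) (S : E) :
    (underCartesian F S).Q ⋙ locMap u₁ S = underMap u₁ S ⋙ (underCartesian G S).Q :=
  Localization.Construction.fac _ _

theorem Q_locRes (F : FibCat E) {S T : E} (f : S ⟶ T) :
    (underCartesian F T).Q ⋙ locRes F f = StructuredArrow.map f ⋙ (underCartesian F S).Q :=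
  Localization.Construction.fac _ _

theorem structuredArrowMap_id (F : FibCat E) (S : E) :
    StructuredArrow.map (T := F.p) (𝟙 S) = 𝟭 _ :=
  CategoryTheory.Functor.ext (fun x => StructuredArrow.map_id)
    fun x y φ => StructuredArrow.ext _ _ (by simp)

theorem structuredArrowMap_comp (F : FibCat E) {S T U : E} (f : S ⟶ T) (g : T ⟶ U) :
    StructuredArrow.map (T := F.p) (f ≫ g) = StructuredArrow.map g ⋙ StructuredArrow.map f :=
  CategoryTheory.Functor.ext (fun x => StructuredArrow.map_comp)
    fun x y φ => StructuredArrow.ext _ _ (by simp)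

theorem locMap_id (F : FibCat E) (S : E) : locMap (𝟙 F) S = 𝟭 _ := by
  apply Localization.Construction.uniq
  rw [Q_locMap, underMap_id]
  rfl

theorem locMap_comp {F G H : FibCat E} (u₁ : F ⟶ G) (u₂ : G ⟶ H) (S : E) :
    locMap (u₁ ≫ u₂) S = locMap u₁ S ⋙ locMap u₂ S := by
  apply Localization.Construction.uniq
  rw [Q_locMap, underMap_comp, ← Functor.assoc, Q_locMap, Functor.assoc]
  exact congrArg (fun X => underMap u₁ S ⋙ X) (Q_locMap u₂ S).symm

theorem locRes_id (F : FibCat E) (S : E) : locRes F (𝟙 S) = 𝟭 _ := by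
  apply Localization.Construction.uniq
  rw [Q_locRes, structuredArrowMap_id]
  rfl

theorem locRes_comp (F : FibCat E) {S T U : E} (f : S ⟶ T) (g : T ⟶ U) :
    locRes F (f ≫ g) = locRes F g ⋙ locRes F f := by
  apply Localization.Construction.uniq
  rw [Q_locRes, structuredArrowMap_comp, ← Functor.assoc, Q_locRes, Functor.assoc]
  exact congrArg (fun X => StructuredArrow.map g ⋙ X) (Q_locRes F f).symm

theorem locRes_locMap {F G : FibCat E} (u₁ : F ⟶ G) {S T : E} (f : S ⟶ T) :
    locRes F f ⋙ locMap u₁ S = locMap u₁ T ⋙ locRes G f := by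
  apply Localization.Construction.uniq
  rw [← Functor.assoc, Q_locRes, Functor.assoc, Q_locMap, ← Functor.assoc, ← Functor.assoc,
    Q_locMap, Functor.assoc (underMap u₁ T), Q_locRes, ← Functor.assoc, underMap_map]

end FibCat

/-- The presheaf `LF`. -/
noncomputable def locPresheaf (F : FibCat E) : Eᵒᵖ ⥤ Cat.{u, u} where
  obj S := Cat.of (UnderLoc F S.unop)
  map f := (FibCat.locRes F f.unop).toCatHom
  map_id S := Cat.ext (FibCat.locRes_id F S.unop)
  map_comp f g := Cat.ext (FibCat.locRes_comp F g.unop f.unop)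

variable (E) in
/-- The functor `L : Fib(E) ⥤ [Eᵒᵖ, CAT]`. -/
noncomputable def locFunctor : FibCat E ⥤ (Eᵒᵖ ⥤ Cat.{u, u}) where
  obj F := locPresheaf F
  map u₁ :=
    { app := fun S => (FibCat.locMap u₁ S.unop).toCatHom
      naturality := fun _ _ f => Cat.ext (FibCat.locRes_locMap u₁ f.unop) }
  map_id F := NatTrans.ext (funext fun S => Cat.ext (FibCat.locMap_id F S.unop))
  map_comp u₁ u₂ := NatTrans.ext (funext fun S => Cat.ext (FibCat.locMap_comp u₁ u₂ S.unop))

end LeftAdjoint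

namespace CategoryTheory

section FunctorLemmas

variable {A B X Y : Type*} [Category* A] [Category* B] [Category* X] [Category* Y]

theorem Functor.ext_of_faithful_comp {l l' : B ⥤ X} (p : X ⥤ Y) [p.Faithful]
    (h : ∀ b, l.obj b = l'.obj b) (h' : l ⋙ p = l' ⋙ p) : l = l' :=
  Functor.ext h fun b b' f => p.map_injective (by
    simpa [eqToHom_map] using Functor.congr_hom h' f)

/-- A lift of a functor along a fully faithful functor, with prescribed values on objects. -/
@[simps]
noncomputable def Functor.liftOfObj (p : X ⥤ Y) [p.Full] [p.Faithful] (F : B ⥤ Y) (k : B → X)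
    (h : ∀ b, p.obj (k b) = F.obj b) : B ⥤ X where
  obj := k
  map {b b'} f := p.preimage (eqToHom (h b) ≫ F.map f ≫ eqToHom (h b').symm)
  map_id b := p.map_injective (by simp)
  map_comp f g := p.map_injective (by simp)

theorem Functor.liftOfObj_comp (p : X ⥤ Y) [p.Full] [p.Faithful] (F : B ⥤ Y) (k : B → X)
    (h : ∀ b, p.obj (k b) = F.obj b) : p.liftOfObj F k h ⋙ p = F :=
  Functor.ext h fun _ _ _ => p.map_preimage _

/-- The functor obtained from `K` by changing its values on objects along isomorphisms. -/
@[simps]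
def Functor.transportObj (K : B ⥤ X) (k : B → X) (σ : ∀ b, K.obj b ≅ k b) : B ⥤ X where
  obj := k
  map {b b'} f := (σ b).inv ≫ K.map f ≫ (σ b').hom

theorem Functor.transportObj_map_eq {K : B ⥤ X} {k : B → X} (σ : ∀ b, K.obj b ≅ k b)
    {b b' : B} (f : b ⟶ b') {x x' : X} (h : k b = x) (h' : k b' = x') (s : K.obj b ⟶ x)
    (s' : K.obj b' ⟶ x') (hs : (σ b).hom = s ≫ eqToHom h.symm)
    (hs' : (σ b').hom = s' ≫ eqToHom h'.symm) (g : x ⟶ x') (w : K.map f ≫ s' = s ≫ g) :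
    (K.transportObj k σ).map f = eqToHom h ≫ g ≫ eqToHom h'.symm := by
  subst h h'
  simp only [eqToHom_refl, Category.comp_id] at hs hs'
  simp only [eqToHom_refl, Category.id_comp, Category.comp_id, transportObj_map]
  rw [hs', w, ← hs, Iso.inv_hom_id_assoc]

theorem Functor.isEquivalence_of_iso_id {F : A ⥤ B} (G : B ⥤ A) (e : F ⋙ G ≅ 𝟭 A)
    (e' : G ⋙ F ≅ 𝟭 B) : F.IsEquivalence :=
  (Equivalence.mk F G e.symm e').isEquivalence_functor

theorem Functor.isEquivalence_of_retract {f : A ⥤ B} {g : X ⥤ Y} (i : A ⥤ X) (r : X ⥤ A)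
    (j : B ⥤ Y) (s : Y ⥤ B) (hir : i ⋙ r = 𝟭 A) (hjs : j ⋙ s = 𝟭 B) (hi : i ⋙ g = f ⋙ j)
    (hr : r ⋙ f = g ⋙ s) [g.IsEquivalence] : f.IsEquivalence := by
  have e₁ : f ⋙ j ⋙ g.inv ⋙ r ≅ 𝟭 A :=
    calc f ⋙ j ⋙ g.inv ⋙ r ≅ (f ⋙ j) ⋙ g.inv ⋙ r := (Functor.associator _ _ _).symm
      _ ≅ (i ⋙ g) ⋙ g.inv ⋙ r := eqToIso (by rw [hi])
      _ ≅ i ⋙ (g ⋙ g.inv) ⋙ r := Iso.refl _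
      _ ≅ i ⋙ 𝟭 X ⋙ r := isoWhiskerLeft i (isoWhiskerRight g.asEquivalence.unitIso.symm r)
      _ ≅ i ⋙ r := Iso.refl _
      _ ≅ 𝟭 A := eqToIso hir
  have e₂ : (j ⋙ g.inv ⋙ r) ⋙ f ≅ 𝟭 B :=
    calc (j ⋙ g.inv ⋙ r) ⋙ f ≅ j ⋙ g.inv ⋙ (r ⋙ f) := Iso.refl _
      _ ≅ j ⋙ g.inv ⋙ (g ⋙ s) := eqToIso (by rw [hr])
      _ ≅ j ⋙ (g.inv ⋙ g) ⋙ s := Iso.refl _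
      _ ≅ j ⋙ 𝟭 Y ⋙ s := isoWhiskerLeft j (isoWhiskerRight g.asEquivalence.counitIso s)
      _ ≅ j ⋙ s := Iso.refl _
      _ ≅ 𝟭 B := eqToIso hjs
  exact Functor.isEquivalence_of_iso_id _ e₁ e₂

theorem Functor.isIsofibration_of_surjective {p : X ⥤ Y} [p.Full] [p.Faithful]
    (hp : Function.Surjective p.obj) : p.IsIsofibration := fun a b β => by
  obtain ⟨a', rfl⟩ := hp b
  exact ⟨a', p.preimageIso β, rfl, by simp⟩

theorem Functor.IsIsofibration.surjective {p : X ⥤ Y} (hp : p.IsIsofibration) [p.EssSurj] :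
    Function.Surjective p.obj := fun b => by
  obtain ⟨a', _, h, _⟩ := hp _ _ (p.objObjPreimageIso b)
  exact ⟨a', h⟩

theorem Functor.exists_lift_of_surjective (i : A ⥤ B) (p : X ⥤ Y) (t : A ⥤ X) (b : B ⥤ Y)
    (hi : Function.Injective i.obj) [p.Full] [p.Faithful] (hp : Function.Surjective p.obj)
    (sq : t ⋙ p = i ⋙ b) : ∃ l : B ⥤ X, i ⋙ l = t ∧ l ⋙ p = b := by
  have h : ∀ y, ∃ x, p.obj x = b.obj y ∧ ∀ a, i.obj a = y → x = t.obj a := fun y => by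
    by_cases hy : ∃ a, i.obj a = y
    · obtain ⟨a, rfl⟩ := hy
      exact ⟨t.obj a, Functor.congr_obj sq a, fun a' h => by rw [hi h]⟩
    · obtain ⟨x, hx⟩ := hp (b.obj y)
      exact ⟨x, hx, fun a h => (hy ⟨a, h⟩).elim⟩
  choose k hk hk' using h
  refine ⟨p.liftOfObj b k hk, ?_, p.liftOfObj_comp b k hk⟩
  refine Functor.ext_of_faithful_comp p (fun a => hk' _ a rfl) ?_
  rw [Functor.assoc, p.liftOfObj_comp, sq]

theorem Functor.exists_lift_of_isIsofibration (i : A ⥤ B) (p : X ⥤ Y) (t : A ⥤ X) (b : B ⥤ Y)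
    (hi : Function.Injective i.obj) [i.IsEquivalence] (hp : p.IsIsofibration)
    (sq : t ⋙ p = i ⋙ b) : ∃ l : B ⥤ X, i ⋙ l = t ∧ l ⋙ p = b := by
  let e : B ⥤ A := i.inv
  let ε : ∀ y, i.obj (e.obj y) ≅ y := fun y => i.asEquivalence.counitIso.app y
  have hε : ∀ {y y' : B} (f : y ⟶ y'), i.map (e.map f) ≫ (ε y').hom = (ε y).hom ≫ f :=
    fun f => i.asEquivalence.counitIso.hom.naturality f
  have hs : ∀ a, p.obj (t.obj a) = b.obj (i.obj a) := Functor.congr_obj sq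
  have hsm : ∀ {a a'} (f : a ⟶ a'), p.map (t.map f) = eqToHom (hs a) ≫ b.map (i.map f) ≫
      eqToHom (hs a').symm := fun f => Functor.congr_hom sq f
  have h : ∀ y, ∃ (x : X) (σ : t.obj (e.obj y) ≅ x) (h : p.obj x = b.obj y),
      p.map σ.hom = eqToHom (hs _) ≫ b.map (ε y).hom ≫ eqToHom h.symm ∧
      ∀ a, ∀ ha : i.obj a = y, ∃ hx : x = t.obj a,
        σ.hom = t.map (i.preimage ((ε y).hom ≫ eqToHom ha.symm)) ≫ eqToHom hx.symm := fun y => by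
    by_cases hy : ∃ a, i.obj a = y
    · obtain ⟨a, rfl⟩ := hy
      refine ⟨t.obj a, t.mapIso (i.preimageIso (ε _)), hs a, by simp [hsm], fun a' h => ?_⟩
      obtain rfl := hi h
      exact ⟨rfl, by simp⟩
    · obtain ⟨x, σ, hx, hσ⟩ := hp (t.obj (e.obj y)) (b.obj y) (eqToIso (hs _) ≪≫ b.mapIso (ε y))
      refine ⟨x, σ, hx, ?_, fun a h => (hy ⟨a, h⟩).elim⟩
      rw [← cancel_mono (eqToHom hx), hσ]
      simp
  choose k σ hk hσ hk' using h
  refine ⟨(e ⋙ t).transportObj k σ, ?_, ?_⟩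
  · refine Functor.ext (fun a => (hk' _ a rfl).1) fun a a' f => ?_
    refine Functor.transportObj_map_eq (K := e ⋙ t) σ _ (hk' _ a rfl).1 (hk' _ a' rfl).1 _ _
      (hk' _ a rfl).2 (hk' _ a' rfl).2 _ ?_
    refine (t.map_comp _ _).symm.trans ((congrArg t.map (i.map_injective ?_)).trans
      (t.map_comp _ _))
    rw [i.map_comp, i.map_comp, i.map_preimage, i.map_preimage]
    simp [hε]
  · refine Functor.ext hk fun y y' f => ?_
    change p.map ((σ _).inv ≫ t.map (e.map f) ≫ (σ _).hom) = _
    have h₁ : p.map (σ y).inv = eqToHom (hk y) ≫ b.map (ε y).inv ≫ eqToHom (hs _).symm := by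
      rw [← cancel_epi (p.map (σ y).hom), ← p.map_comp, hσ, Iso.hom_inv_id, p.map_id,
        Category.assoc, Category.assoc, eqToHom_trans_assoc, eqToHom_refl, Category.id_comp,
        ← b.map_comp_assoc, Iso.hom_inv_id, b.map_id, Category.id_comp, eqToHom_trans,
        eqToHom_refl]
    rw [p.map_comp, p.map_comp, hσ, h₁, hsm]
    simp only [Category.assoc, eqToHom_trans_assoc, eqToHom_refl, Category.id_comp]
    rw [← b.map_comp_assoc (i.map (e.map f)), hε, ← b.map_comp_assoc, Iso.inv_hom_id_assoc]
    rfl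

end FunctorLemmas

section PathCategory

variable {A B : Type*} [Category* A] [Category* B]

/-- Objects of the path category of a functor `F`: triples `(x, y, F x ≅ y)`. -/
structure PathObj (F : A ⥤ B) where
  /-- the source -/
  left : A
  /-- the target -/
  right : B
  /-- the isomorphism -/
  iso : F.obj left ≅ right

theorem PathObj.ext' {F : A ⥤ B} {a b : PathObj F} (h : a.left = b.left) (h' : a.right = b.right)
    (w : a.iso.hom ≫ eqToHom h' = eqToHom (by rw [h]) ≫ b.iso.hom) : a = b := by
  obtain ⟨x, y, β⟩ := a
  obtain ⟨x', y', β'⟩ := b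
  obtain rfl : x = x' := h
  obtain rfl : y = y' := h'
  obtain rfl : β = β' := Iso.ext (by simpa using w)
  rfl

/-- The path category of a functor `F`, with the maps of the source of `F`. -/
abbrev PathCat (F : A ⥤ B) := InducedCategory A (PathObj.left (F := F))

namespace PathCat

variable (F : A ⥤ B)

/-- The constant paths. -/
@[simps]
def incl : A ⥤ PathCat F where
  obj x := ⟨x, F.obj x, Iso.refl _⟩
  map f := InducedCategory.homMk f

/-- The source of a path. -/
abbrev fst : PathCat F ⥤ A := inducedFunctor _

/-- The target of a path. -/
@[simps]
def snd : PathCat F ⥤ B where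
  obj x := x.right
  map {x y} f := x.iso.inv ≫ F.map f.hom ≫ y.iso.hom

theorem incl_snd : incl F ⋙ snd F = F :=
  Functor.hext (fun _ => rfl) fun _ _ f => heq_of_eq
    ((Category.id_comp _).trans (Category.comp_id (F.map f)))

theorem incl_injective : Function.Injective (incl F).obj := fun _ _ h => congrArg PathObj.left h

instance : (incl F).IsEquivalence :=
  Functor.isEquivalence_of_iso_id (fst F) (Iso.refl _)
    (NatIso.ofComponents (fun _ => InducedCategory.isoMk (Iso.refl _)) fun f =>
      InducedCategory.hom_ext ((Category.comp_id f.hom).trans (Category.id_comp f.hom).symm))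

instance : (fst F).EssSurj := ⟨fun x => ⟨(incl F).obj x, ⟨Iso.refl _⟩⟩⟩

instance : (fst F).IsEquivalence where

theorem snd_isIsofibration : (snd F).IsIsofibration := fun a b β =>
  ⟨⟨a.left, b, a.iso ≪≫ β⟩, InducedCategory.isoMk (Iso.refl _), rfl, by
    refine (Category.comp_id _).trans ?_
    change a.iso.inv ≫ F.map (𝟙 a.left) ≫ a.iso.hom ≫ (β : a.right ≅ b).hom = _
    rw [F.map_id, Category.id_comp]
    exact a.iso.inv_hom_id_assoc β.hom⟩

variable {F}
variable {A' B' : Type*} [Category* A'] [Category* B'] {F' : A' ⥤ B'}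

/-- The functor between path categories induced by a commutative square. -/
@[simps]
def map (a : A ⥤ A') (b : B ⥤ B') (h : a ⋙ F' = F ⋙ b) : PathCat F ⥤ PathCat F' where
  obj x := ⟨a.obj x.left, b.obj x.right, eqToIso (Functor.congr_obj h x.left) ≪≫ b.mapIso x.iso⟩
  map f := InducedCategory.homMk (a.map f.hom)

theorem map_snd (a : A ⥤ A') (b : B ⥤ B') (h : a ⋙ F' = F ⋙ b) :
    map a b h ⋙ snd F' = snd F ⋙ b :=
  Functor.hext (fun _ => rfl) fun x y f => heq_of_eq (by
    have := Functor.congr_hom h f.hom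
    dsimp at this
    change (b.map x.iso.inv ≫ eqToHom (Functor.congr_obj h _).symm) ≫ F'.map (a.map f.hom) ≫
      eqToHom (Functor.congr_obj h _) ≫ b.map y.iso.hom =
        b.map (x.iso.inv ≫ F.map f.hom ≫ y.iso.hom)
    simp [this])

end PathCat

end PathCategory

theorem Functor.exists_iso_of_retract {A B C : Type*} [Category* A] [Category* B] [Category* C]
    {f : A ⥤ B} {i : A ⥤ C} {l : C ⥤ A} {s : C ⥤ B} (h₁ : i ⋙ l = 𝟭 A) (h₂ : l ⋙ f = s)
    {a : A} {z : C} (γ : i.obj a ≅ z) {b : B} (β : f.obj a ≅ b) (h : f.obj a = s.obj (i.obj a))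
    (hz : s.obj z = b) (hγ : eqToHom h ≫ s.map γ.hom ≫ eqToHom hz = β.hom) :
    ∃ (a' : A) (α : a ≅ a') (h : f.obj a' = b), f.map α.hom ≫ eqToHom h = β.hom := by
  subst h₂
  refine ⟨l.obj z, eqToIso (Functor.congr_obj h₁ a).symm ≪≫ l.mapIso γ, hz, ?_⟩
  rw [← hγ]
  simp [eqToHom_map]

/-! ### The canonical classes of maps of `Cat` -/

namespace Cat

/-- The equivalences of categories. -/
def equivalences : MorphismProperty Cat.{v, u} := fun _ _ f => f.toFunctor.IsEquivalence

/-- The functors that are injective on objects. -/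
def injectives : MorphismProperty Cat.{v, u} := fun _ _ f => Function.Injective f.toFunctor.obj

/-- The isofibrations. -/
def isofibrations : MorphismProperty Cat.{v, u} := fun _ _ f => f.toFunctor.IsIsofibration

instance : equivalences.{v, u}.HasTwoOutOfThreeProperty where
  comp_mem f g hf hg := by
    have : f.toFunctor.IsEquivalence := hf
    have : g.toFunctor.IsEquivalence := hg
    exact inferInstanceAs (f.toFunctor ⋙ g.toFunctor).IsEquivalence
  of_postcomp f g hg h := by
    have : g.toFunctor.IsEquivalence := hg
    have : (f.toFunctor ⋙ g.toFunctor).IsEquivalence := h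
    exact Functor.isEquivalence_of_comp_right f.toFunctor g.toFunctor
  of_precomp f g hf h := by
    have : f.toFunctor.IsEquivalence := hf
    have : (f.toFunctor ⋙ g.toFunctor).IsEquivalence := h
    exact Functor.isEquivalence_of_comp_left f.toFunctor g.toFunctor

instance : equivalences.{v, u}.IsStableUnderRetracts where
  of_retract {X Y Z W f g} h hg := by
    have : g.toFunctor.IsEquivalence := hg
    exact Functor.isEquivalence_of_retract h.left.i.toFunctor h.left.r.toFunctor
      h.right.i.toFunctor h.right.r.toFunctor (congrArg Cat.Hom.toFunctor h.left.retract)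
      (congrArg Cat.Hom.toFunctor h.right.retract) (congrArg Cat.Hom.toFunctor h.i_w)
      (congrArg Cat.Hom.toFunctor h.r_w)

instance : injectives.{v, u}.IsStableUnderRetracts where
  of_retract {X Y Z W f g} h hg := fun x y hxy => by
    have h₁ : ∀ x, h.left.r.toFunctor.obj (h.left.i.toFunctor.obj x) = x :=
      Functor.congr_obj (congrArg Cat.Hom.toFunctor h.left.retract)
    have h₂ : ∀ x, g.toFunctor.obj (h.left.i.toFunctor.obj x) =
        h.right.i.toFunctor.obj (f.toFunctor.obj x) :=
      Functor.congr_obj (congrArg Cat.Hom.toFunctor h.i_w)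
    rw [← h₁ x, ← h₁ y]
    refine congrArg _ (hg ?_)
    rw [h₂, h₂, hxy]

theorem hasLiftingProperty_of_isofibrations {A B X Y : Cat.{v, u}} {i : A ⟶ B} {p : X ⟶ Y}
    (hi : injectives i) (hi' : equivalences i) (hp : isofibrations p) :
    HasLiftingProperty i p where
  sq_hasLift {t b} sq := by
    have : i.toFunctor.IsEquivalence := hi'
    obtain ⟨l, h₁, h₂⟩ := Functor.exists_lift_of_isIsofibration i.toFunctor p.toFunctor
      t.toFunctor b.toFunctor hi hp (congrArg Cat.Hom.toFunctor sq.w)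
    exact ⟨⟨⟨.ofFunctor l, Cat.ext h₁, Cat.ext h₂⟩⟩⟩

theorem isofibrations_eq_rlp :
    isofibrations.{u, u} = (injectives.{u, u} ⊓ equivalences.{u, u}).rlp := by
  apply le_antisymm
  · exact fun _ _ p hp _ _ i hi => hasLiftingProperty_of_isofibrations hi.1 hi.2 hp
  · intro X Y p hp
    let F := p.toFunctor
    let i : X ⟶ Cat.of (PathCat F) := .ofFunctor (PathCat.incl F)
    let q : Cat.of (PathCat F) ⟶ Y := .ofFunctor (PathCat.snd F)
    have := hp i ⟨PathCat.incl_injective F, inferInstanceAs (PathCat.incl F).IsEquivalence⟩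
    have sq : CommSq (𝟙 X) i p q := ⟨Cat.ext (PathCat.incl_snd F).symm⟩
    intro a b β
    have h₁ : PathCat.incl F ⋙ sq.lift.toFunctor = 𝟭 X := congrArg Cat.Hom.toFunctor sq.fac_left
    have h₂ : sq.lift.toFunctor ⋙ F = PathCat.snd F := congrArg Cat.Hom.toFunctor sq.fac_right
    let z : PathCat F := ⟨a, b, β⟩
    let γ : (PathCat.incl F).obj a ≅ z := InducedCategory.isoMk (Iso.refl a)
    refine Functor.exists_iso_of_retract h₁ h₂ γ β rfl rfl ?_
    change 𝟙 (F.obj a) ≫ (𝟙 (F.obj a) ≫ F.map (𝟙 a) ≫ β.hom) ≫ 𝟙 b = β.hom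
    rw [F.map_id, Category.id_comp, Category.id_comp, Category.comp_id]
    exact Category.id_comp β.hom

end Cat

end CategoryTheory

/-! ### Cartesian arrows without equalities of objects -/

namespace CategoryTheory

variable {C D E : Type*} [Category* C] [Category* D] [Category* E]

/-- An arrow `φ` is strongly cartesian over its image. -/
def Functor.IsCart (p : C ⥤ E) {a b : C} (φ : a ⟶ b) : Prop :=
  ∀ ⦃z : C⦄ (ψ : z ⟶ b) (g : p.obj z ⟶ p.obj a), g ≫ p.map φ = p.map ψ →
    ∃! χ : z ⟶ a, p.map χ = g ∧ χ ≫ φ = ψ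

section

variable {p : C ⥤ E}

theorem Functor.isHomLift_iff {a b : C} (f : p.obj a ⟶ p.obj b) (φ : a ⟶ b) :
    p.IsHomLift f φ ↔ p.map φ = f :=
  ⟨fun _ => (IsHomLift.eq_of_isHomLift (p := p) f φ).symm, by
    rintro rfl
    exact CategoryTheory.IsHomLift.map p φ⟩

theorem Functor.IsCart.isStronglyCartesian {a b : C} {φ : a ⟶ b} (h : p.IsCart φ) :
    p.IsStronglyCartesian (p.map φ) φ where
  universal_property' {z} g ψ hψ := by
    have hψ' := (Functor.isHomLift_iff _ _).1 hψ
    simpa only [Functor.isHomLift_iff] using h ψ g hψ'.symm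

theorem Functor.isCart_of_isStronglyCartesian {R S : E} {f : R ⟶ S} {a b : C} {φ : a ⟶ b}
    (h : p.IsStronglyCartesian f φ) : p.IsCart φ := by
  obtain ⟨⟩ := h.toIsHomLift
  intro z ψ g w
  have : p.IsHomLift (g ≫ p.map φ) ψ := (Functor.isHomLift_iff _ _).2 w.symm
  simpa only [Functor.isHomLift_iff] using h.universal_property' g ψ

theorem Functor.isCartesian_iff [p.IsFibered] {R S : E} {f : R ⟶ S} {a b : C} {φ : a ⟶ b} :
    p.IsCartesian f φ ↔ p.IsHomLift f φ ∧ p.IsCart φ := by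
  refine ⟨fun h => ⟨inferInstance, Functor.isCart_of_isStronglyCartesian (f := f) inferInstance⟩,
    fun ⟨h, h'⟩ => ?_⟩
  obtain ⟨⟩ := h
  have := h'.isStronglyCartesian
  infer_instance

theorem Functor.isCartesian_map_iff [p.IsFibered] {a b : C} {φ : a ⟶ b} :
    p.IsCartesian (p.map φ) φ ↔ p.IsCart φ :=
  Functor.isCartesian_iff.trans (and_iff_right (CategoryTheory.IsHomLift.map p φ))

theorem Functor.isFibered_of_exists_isCart (h : ∀ (a : C) (R : E) (f : R ⟶ p.obj a),
    ∃ (b : C) (φ : b ⟶ a) (h : p.obj b = R), p.map φ = eqToHom h ≫ f ∧ p.IsCart φ) :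
    p.IsFibered :=
  Functor.IsFibered.of_exists_isStronglyCartesian fun a R f => by
    obtain ⟨b, φ, rfl, hφ, hφ'⟩ := h a R f
    have := hφ'.isStronglyCartesian
    rw [hφ, eqToHom_refl, Category.id_comp] at this
    exact ⟨b, φ, this⟩

theorem Functor.exists_isCart (p : C ⥤ E) [p.IsFibered] (a : C) {R : E} (f : R ⟶ p.obj a) :
    ∃ (b : C) (φ : b ⟶ a) (h : p.obj b = R), p.map φ = eqToHom h ≫ f ∧ p.IsCart φ := by
  obtain ⟨b, φ, h⟩ := CategoryTheory.IsPreFibered.exists_isCartesian p rfl f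
  exact ⟨b, φ, IsHomLift.domain_eq p f φ, by simpa using IsHomLift.fac' p f φ,
    (Functor.isCartesian_iff.1 h).2⟩

theorem Functor.isCart_of_isIso {a b : C} (φ : a ⟶ b) [IsIso φ] : p.IsCart φ := fun z ψ g w =>
  ⟨ψ ≫ CategoryTheory.inv φ, ⟨by simp [← w], by simp⟩, fun χ h => by simp [← h.2]⟩

theorem Functor.IsCart.comp {a b c : C} {φ : a ⟶ b} {ψ : b ⟶ c} (hφ : p.IsCart φ)
    (hψ : p.IsCart ψ) :
    p.IsCart (φ ≫ ψ) := fun z θ g w => by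
  obtain ⟨χ, ⟨h₁, h₂⟩, h₃⟩ := hψ θ (g ≫ p.map φ) (by simpa using w)
  obtain ⟨χ', ⟨h₁', h₂'⟩, h₃'⟩ := hφ χ g h₁.symm
  refine ⟨χ', ⟨h₁', by rw [← Category.assoc, h₂', h₂]⟩, fun χ'' ⟨h₄, h₅⟩ => h₃' _ ⟨h₄, ?_⟩⟩
  exact h₃ _ ⟨by rw [p.map_comp, h₄], by rw [Category.assoc, h₅]⟩

theorem Functor.IsCart.of_comp {a b c : C} {φ : a ⟶ b} {ψ : b ⟶ c} (hψ : p.IsCart ψ)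
    (h : p.IsCart (φ ≫ ψ)) : p.IsCart φ := fun z θ g w => by
  obtain ⟨χ, ⟨h₁, h₂⟩, h₃⟩ := h (θ ≫ ψ) g (by rw [p.map_comp, p.map_comp, ← w, Category.assoc])
  refine ⟨χ, ⟨h₁, ?_⟩, fun χ' ⟨h₄, h₅⟩ => h₃ _ ⟨h₄, by rw [← h₅, Category.assoc]⟩⟩
  obtain ⟨_, _, h₆⟩ := hψ (θ ≫ ψ) (p.map θ) (p.map_comp _ _).symm
  rw [h₆ θ ⟨rfl, rfl⟩, h₆ (χ ≫ φ) ⟨by rw [p.map_comp, h₁, w], by rw [Category.assoc, h₂]⟩]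

theorem Functor.IsCart.ext {a b z : C} {φ : a ⟶ b} (h : p.IsCart φ) {χ χ' : z ⟶ a}
    (h₁ : p.map χ = p.map χ') (h₂ : χ ≫ φ = χ' ≫ φ) : χ = χ' :=
  (h (χ ≫ φ) (p.map χ) (p.map_comp _ _).symm).unique ⟨rfl, rfl⟩ ⟨h₁.symm, h₂.symm⟩

theorem Functor.IsCart.congr_iso {a b a' b' : C} {φ : a ⟶ b} {φ' : a' ⟶ b'} (e : a ≅ a')
    (e' : b ≅ b')
    (w : φ ≫ e'.hom = e.hom ≫ φ') (h : p.IsCart φ) : p.IsCart φ' := by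
  have : φ' = e.inv ≫ φ ≫ e'.hom := by rw [w, Iso.inv_hom_id_assoc]
  rw [this]
  exact (Functor.isCart_of_isIso _).comp (h.comp (Functor.isCart_of_isIso _))

theorem Functor.IsCart.isIso {a b : C} {φ : a ⟶ b} (h : p.IsCart φ) [IsIso (p.map φ)] :
    IsIso φ := by
  obtain ⟨χ, ⟨h₁, h₂⟩, -⟩ := h (𝟙 b) (CategoryTheory.inv (p.map φ)) (by simp)
  refine ⟨χ, h.ext (by simp [h₁]) (by simp [h₂]), h₂⟩

theorem Functor.IsCart.exists_iso {a a' b : C} {φ : a ⟶ b} {φ' : a' ⟶ b} (h : p.IsCart φ)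
    (h' : p.IsCart φ') (g : p.obj a ≅ p.obj a') (w : g.hom ≫ p.map φ' = p.map φ) :
    ∃ e : a ≅ a', p.map e.hom = g.hom ∧ e.hom ≫ φ' = φ := by
  obtain ⟨χ, ⟨h₁, h₂⟩, -⟩ := h' φ g.hom w
  obtain ⟨χ', ⟨h₁', h₂'⟩, -⟩ := h φ' g.inv (by rw [← w, g.inv_hom_id_assoc])
  exact ⟨⟨χ, χ', h.ext (by simp [h₁, h₁']) (by simp [h₂, h₂']),
    h'.ext (by simp [h₁, h₁']) (by simp [h₂, h₂'])⟩, h₁, h₂⟩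

theorem Functor.isCart_map_of_exists {q : D ⥤ E} {u : C ⥤ D}
    (H : ∀ (a : C) (R : E) (f : R ⟶ p.obj a), ∃ (b : C) (φ : b ⟶ a) (h : p.obj b = R),
      p.map φ = eqToHom h ≫ f ∧ p.IsCart φ ∧ q.IsCart (u.map φ))
    {a b : C} {φ : a ⟶ b} (hφ : p.IsCart φ) : q.IsCart (u.map φ) := by
  obtain ⟨a', φ', h, h₁, h₂, h₃⟩ := H b _ (p.map φ)
  obtain ⟨e, -, he⟩ := hφ.exists_iso h₂ (eqToIso h.symm) (by simp [h₁])
  rw [← he, u.map_comp]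
  exact (Functor.isCart_of_isIso _).comp h₃

end

theorem Functor.isCart_of_map {p : C ⥤ E} {q : D ⥤ E} {u : C ⥤ D} (α : u ⋙ q ≅ p)
    [u.Full] [u.Faithful]
    {a b : C} {φ : a ⟶ b} (h : q.IsCart (u.map φ)) : p.IsCart φ := fun z ψ g w => by
  have hα : ∀ {x y : C} (f : x ⟶ y), p.map f = α.inv.app x ≫ q.map (u.map f) ≫ α.hom.app y :=
    fun f => (NatIso.naturality_1 α f).symm
  rw [hα, hα] at w
  obtain ⟨χ, ⟨h₁, h₂⟩, h₃⟩ := h (u.map ψ) (α.hom.app z ≫ g ≫ α.inv.app a) (by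
    have := α.hom.app z ≫= w =≫ α.inv.app b
    simpa using this)
  refine ⟨u.preimage χ, ⟨by rw [hα, u.map_preimage, h₁]; simp, u.map_injective (by simp [h₂])⟩,
    fun χ' ⟨h₄, h₅⟩ => u.map_injective ?_⟩
  rw [u.map_preimage]
  refine h₃ _ ⟨?_, by rw [← h₅, u.map_comp]⟩
  rw [← h₄, hα]
  simp

theorem Functor.IsCart.map {p : C ⥤ E} {q : D ⥤ E} {u : C ⥤ D} (α : u ⋙ q ≅ p)
    [u.IsEquivalence]
    {a b : C} {φ : a ⟶ b} (h : p.IsCart φ) : q.IsCart (u.map φ) := fun z ψ g w => by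
  have hα : ∀ {x y : C} (f : x ⟶ y), p.map f = α.inv.app x ≫ q.map (u.map f) ≫ α.hom.app y :=
    fun f => (NatIso.naturality_1 α f).symm
  have hα' : ∀ {x y : C} (f : x ⟶ y), q.map (u.map f) = α.hom.app x ≫ p.map f ≫ α.inv.app y :=
    fun f => (NatIso.naturality_2 α f).symm
  let e := u.objObjPreimageIso z
  obtain ⟨χ, ⟨h₁, h₂⟩, h₃⟩ := h (u.preimage (e.hom ≫ ψ))
    (α.inv.app _ ≫ q.map e.hom ≫ g ≫ α.hom.app a) (by
      rw [hα, hα, u.map_preimage, q.map_comp, ← w]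
      simp)
  refine ⟨e.inv ≫ u.map χ, ⟨?_, ?_⟩, fun χ' ⟨h₄, h₅⟩ => ?_⟩
  · rw [q.map_comp, hα', h₁]
    simp
  · rw [Category.assoc, ← u.map_comp, h₂, u.map_preimage, Iso.inv_hom_id_assoc]
  · rw [Iso.eq_inv_comp, ← u.map_preimage (e.hom ≫ χ')]
    refine congrArg _ (h₃ _ ⟨?_, u.map_injective ?_⟩)
    · rw [← h₄, hα, u.map_preimage, q.map_comp, Category.assoc]
    · rw [u.map_comp, u.map_preimage, u.map_preimage, Category.assoc, h₅]

end CategoryTheory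

namespace FibCat

variable {E : Type u} [SmallCategory E]

/-- The functor underlying a cartesian functor. -/
abbrev Hom.functor {F G : FibCat E} (f : F ⟶ G) : F.obj ⥤ G.obj := f.toBasedFunctor.toFunctor

theorem Hom.functor_p {F G : FibCat E} (f : F ⟶ G) : Hom.functor f ⋙ G.p = F.p :=
  f.toBasedFunctor.w

/-- The compatibility of a cartesian functor with the projections. -/
abbrev Hom.iso {F G : FibCat E} (f : F ⟶ G) : Hom.functor f ⋙ G.p ≅ F.p :=
  eqToIso (Hom.functor_p f)

instance (F : FibCat E) : F.p.IsFibered := F.isFibered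

/-- A fibred category, from the existence of cartesian lifts. -/
abbrev ofExists {C : Type u} [SmallCategory C] (p : C ⥤ E) (h : ∀ (a : C) (R : E)
    (f : R ⟶ p.obj a), ∃ (b : C) (φ : b ⟶ a) (h : p.obj b = R),
      p.map φ = eqToHom h ≫ f ∧ p.IsCart φ) : FibCat E where
  obj := C
  p := p
  isFibered := Functor.isFibered_of_exists_isCart h

/-- A cartesian functor, from the preservation of the arrows that are cartesian over their
image. -/
abbrev homMk {F G : FibCat E} (f : F.obj ⥤ G.obj) (w : f ⋙ G.p = F.p)
    (h : ∀ ⦃a b : F.obj⦄ (φ : a ⟶ b), F.p.IsCart φ → G.p.IsCart (f.map φ)) : F ⟶ G :=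
  Hom.mk ⟨f, w⟩ fun R S g a b φ hφ => by
    have h₁ := Functor.isCartesian_iff.1 hφ
    have : F.p.IsHomLift g φ := h₁.1
    refine Functor.isCartesian_iff.2 ⟨?_, h φ h₁.2⟩
    exact BasedFunctor.preserves_isHomLift (⟨f, w⟩ : BasedFunctor F.toBasedCategory _) g φ

theorem Hom.isCart {F G : FibCat E} (f : F ⟶ G) {a b : F.obj} {φ : a ⟶ b} (h : F.p.IsCart φ) :
    G.p.IsCart ((Hom.functor f).map φ) :=
  (Functor.isCartesian_iff.1 (f.map_isCartesian _ φ (Functor.isCartesian_map_iff.2 h))).2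

theorem hom_w {F G : FibCat E} (f : F ⟶ G) {a b : F.obj} (φ : a ⟶ b) :
    G.p.map ((Hom.functor f).map φ) = eqToHom (hom_obj f a).symm ≫ F.p.map φ ≫
      eqToHom (hom_obj f b) := hom_map f φ

/-- Cartesian functors, up to natural isomorphism, preserve cartesian arrows. -/
theorem isCart_map_of_iso {C D : Type*} [Category* C] [Category* D] {q : D ⥤ E}
    {f g : C ⥤ D} (e : f ≅ g) {a b : C} {φ : a ⟶ b} (h : q.IsCart (f.map φ)) :
    q.IsCart (g.map φ) :=
  h.congr_iso (e.app a) (e.app b) (e.hom.naturality φ)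

variable (E) in
/-- The functor which forgets the projection to `E`. -/
@[simps]
def forget : FibCat E ⥤ Cat.{u, u} where
  obj F := Cat.of F.obj
  map f := (Hom.functor f).toCatHom

variable (E) in
theorem modelData_fib : (modelData E).fib = Cat.isofibrations.inverseImage (forget E) := rfl

end FibCat

namespace FibCat

variable {E : Type u} [SmallCategory E]

/-! ### The mapping cylinder -/

section Cylinder

variable {F G : FibCat E} (f : F ⟶ G)

/-- The category underlying the mapping cylinder of `f`: its objects are those of `F` and `G`,
its maps are those of `G`. -/
abbrev CylCat := InducedCategory G.obj (Sum.elim (Hom.functor f).obj id)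

/-- The projection of the mapping cylinder. -/
abbrev cylFunctor : CylCat f ⥤ G.obj := inducedFunctor _

theorem cylFunctor_surjective : Function.Surjective (cylFunctor f).obj := fun y => ⟨.inr y, rfl⟩

instance : (cylFunctor f).EssSurj := ⟨fun y => ⟨.inr y, ⟨Iso.refl _⟩⟩⟩

instance : (cylFunctor f).IsEquivalence where

/-- The mapping cylinder of `f`. -/
abbrev cyl : FibCat E :=
  ofExists (cylFunctor f ⋙ G.p) fun a R r => by
    obtain ⟨b, φ, h, h', hφ⟩ := G.p.exists_isCart ((cylFunctor f).obj a) r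
    exact ⟨.inr b, InducedCategory.homMk φ, h, h',
      Functor.isCart_of_map (u := cylFunctor f) (Iso.refl _) hφ⟩

/-- The projection of the mapping cylinder. -/
abbrev cylSnd : cyl f ⟶ G :=
  homMk (cylFunctor f) rfl fun _ _ _ hφ => hφ.map (Iso.refl _)

/-- The inclusion in the mapping cylinder. -/
abbrev cylIncl : F ⟶ cyl f :=
  homMk
    { obj := fun x => .inl x
      map := fun φ => InducedCategory.homMk ((Hom.functor f).map φ)
      map_id := fun x => InducedCategory.hom_ext ((Hom.functor f).map_id x)
      map_comp := fun φ ψ => InducedCategory.hom_ext ((Hom.functor f).map_comp φ ψ) }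
    (Hom.functor_p f) fun _ _ _ hφ =>
      Functor.isCart_of_map (u := cylFunctor f) (Iso.refl _) (f.isCart hφ)

end Cylinder

/-! ### The path object -/

section Path

variable {F G : FibCat E} (f : F ⟶ G)

/-- The compatibility of the projections of the path object with the projections to `E`. -/
def pathBaseIso (x : PathCat (Hom.functor f)) : F.p.obj x.left ≅ G.p.obj x.right :=
  eqToIso (hom_obj f x.left) ≪≫ G.p.mapIso x.iso

/-- The compatibility of the projections of the path object with the projections to `E`. -/
def pathIso : PathCat.fst (Hom.functor f) ⋙ F.p ≅ PathCat.snd (Hom.functor f) ⋙ G.p :=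
  NatIso.ofComponents (pathBaseIso f) fun {x y} φ => by
    change F.p.map φ.hom ≫ eqToHom (hom_obj f _) ≫ G.p.map y.iso.hom =
      (eqToHom (hom_obj f _) ≫ G.p.map x.iso.hom) ≫
        G.p.map (x.iso.inv ≫ (Hom.functor f).map φ.hom ≫ y.iso.hom)
    rw [G.p.map_comp, G.p.map_comp, hom_w, Category.assoc, ← G.p.map_comp_assoc x.iso.hom,
      Iso.hom_inv_id, G.p.map_id, Category.id_comp, Category.assoc, Category.assoc,
      eqToHom_trans_assoc, eqToHom_refl, Category.id_comp]

/-- The path object of `f`. -/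
abbrev path : FibCat E :=
  ofExists (PathCat.snd (Hom.functor f) ⋙ G.p) fun a R r => by
    change R ⟶ G.p.obj a.right at r
    obtain ⟨b, φ, h, h', hφ⟩ := F.p.exists_isCart a.left (r ≫ (pathBaseIso f a).inv)
    refine ⟨(PathCat.incl (Hom.functor f)).obj b, InducedCategory.homMk φ,
      (hom_obj f b).symm.trans h, ?_, Functor.isCart_of_map (pathIso f) hφ⟩
    have : G.p.map ((Hom.functor f).map φ ≫ a.iso.hom) =
        eqToHom ((hom_obj f b).symm.trans h) ≫ r := by
      have h₁ : (pathBaseIso f a).inv ≫ eqToHom (hom_obj f _) ≫ G.p.map a.iso.hom = 𝟙 _ :=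
        (pathBaseIso f a).inv_hom_id
      rw [G.p.map_comp, hom_w, h', Category.assoc, Category.assoc, Category.assoc, Category.assoc,
        h₁, eqToHom_trans_assoc, Category.comp_id]
    exact (congrArg G.p.map (Category.id_comp _)).trans this

/-- The inclusion in the path object. -/
abbrev pathIncl : F ⟶ path f :=
  have w : PathCat.incl (Hom.functor f) ⋙ PathCat.snd (Hom.functor f) ⋙ G.p = F.p :=
    (congrArg (· ⋙ G.p) (PathCat.incl_snd (Hom.functor f))).trans (Hom.functor_p f)
  homMk (PathCat.incl (Hom.functor f)) w fun _ _ _ hφ =>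
    hφ.map (u := PathCat.incl (Hom.functor f)) (eqToIso w)

/-- The projection of the path object. -/
abbrev pathSnd : path f ⟶ G :=
  homMk (PathCat.snd (Hom.functor f)) rfl fun x y φ hφ => by
    have h₁ : F.p.IsCart ((PathCat.fst (Hom.functor f)).map φ) := hφ.map (pathIso f)
    exact (f.isCart h₁).congr_iso x.iso y.iso (x.iso.hom_inv_id_assoc _).symm

end Path

/-! ### The weak factorization systems -/

theorem hasLiftingProperty_of_trivialFib {A B X Y : FibCat E} (i : A ⟶ B) (p : X ⟶ Y)
    (hi : (modelData E).cof i) (hp : (modelData E).fib p) (hp' : (modelData E).weq p) :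
    HasLiftingProperty i p where
  sq_hasLift {t b} sq := by
    have : (Hom.functor p).IsEquivalence := hp'
    obtain ⟨l, h₁, h₂⟩ := Functor.exists_lift_of_surjective (Hom.functor i) (Hom.functor p)
      (Hom.functor t) (Hom.functor b) hi (Functor.IsIsofibration.surjective hp)
      (congrArg Hom.functor sq.w)
    have w : l ⋙ X.p = B.p := by rw [← p.functor_p, ← Functor.assoc, h₂, b.functor_p]
    refine ⟨⟨⟨homMk l w fun x y φ hφ => ?_, hom_ext h₁, hom_ext h₂⟩⟩⟩
    exact Functor.isCart_of_map (Hom.iso p)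
      (isCart_map_of_iso (eqToIso h₂.symm) (b.isCart hφ))

theorem hasLiftingProperty_of_trivialCof {A B X Y : FibCat E} (i : A ⟶ B) (p : X ⟶ Y)
    (hi : (modelData E).cof i) (hi' : (modelData E).weq i) (hp : (modelData E).fib p) :
    HasLiftingProperty i p where
  sq_hasLift {t b} sq := by
    have : (Hom.functor i).IsEquivalence := hi'
    obtain ⟨l, h₁, h₂⟩ := Functor.exists_lift_of_isIsofibration (Hom.functor i) (Hom.functor p)
      (Hom.functor t) (Hom.functor b) hi hp (congrArg Hom.functor sq.w)
    have w : l ⋙ X.p = B.p := by rw [← p.functor_p, ← Functor.assoc, h₂, b.functor_p]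
    refine ⟨⟨⟨homMk l w fun x y φ hφ => ?_, hom_ext h₁, hom_ext h₂⟩⟩⟩
    let e := (Hom.functor i).objObjPreimageIso
    let φ' := (Hom.functor i).preimage ((e x).hom ≫ φ ≫ (e y).inv)
    have h₃ : (Hom.functor i).map φ' ≫ (e y).hom = (e x).hom ≫ φ := by simp [φ']
    have h₄ : A.p.IsCart φ' := Functor.isCart_of_map (Hom.iso i)
      (hφ.congr_iso (e x).symm (e y).symm (by simp [φ']))
    have h₅ : X.p.IsCart (l.map ((Hom.functor i).map φ')) :=
      isCart_map_of_iso (eqToIso h₁.symm) (t.isCart h₄)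
    exact h₅.congr_iso (l.mapIso (e x)) (l.mapIso (e y)) (by
      simp only [Functor.mapIso_hom, ← l.map_comp, h₃])

instance : (modelData E).weq.HasTwoOutOfThreeProperty :=
  inferInstanceAs (Cat.equivalences.inverseImage (forget E)).HasTwoOutOfThreeProperty

instance : (modelData E).weq.IsStableUnderRetracts :=
  inferInstanceAs (Cat.equivalences.inverseImage (forget E)).IsStableUnderRetracts

instance : (modelData E).cof.IsStableUnderRetracts :=
  inferInstanceAs (Cat.injectives.inverseImage (forget E)).IsStableUnderRetracts

instance : (modelData E).fib.IsStableUnderRetracts := by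
  rw [modelData_fib, Cat.isofibrations_eq_rlp]
  infer_instance

theorem cof_trivialFib : MorphismProperty.IsWeakFactorizationSystem (modelData E).cof
    ((modelData E).fib ⊓ (modelData E).weq) := by
  have : (modelData E).cof.HasFactorization ((modelData E).fib ⊓ (modelData E).weq) :=
    ⟨fun f => ⟨{
      Z := cyl f
      i := cylIncl f
      p := cylSnd f
      fac := rfl
      hi := fun _ _ => Sum.inl.inj
      hp := ⟨Functor.isIsofibration_of_surjective (cylFunctor_surjective f),
        inferInstanceAs (cylFunctor f).IsEquivalence⟩ }⟩⟩
  exact .mk' _ _ fun i p hi hp => hasLiftingProperty_of_trivialFib i p hi hp.1 hp.2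

theorem trivialCof_fib : MorphismProperty.IsWeakFactorizationSystem
    ((modelData E).cof ⊓ (modelData E).weq) (modelData E).fib := by
  have : ((modelData E).cof ⊓ (modelData E).weq).HasFactorization (modelData E).fib :=
    ⟨fun f => ⟨{
      Z := path f
      i := pathIncl f
      p := pathSnd f
      fac := hom_ext (PathCat.incl_snd _)
      hi := ⟨PathCat.incl_injective _, inferInstanceAs (PathCat.incl _).IsEquivalence⟩
      hp := PathCat.snd_isIsofibration _ }⟩⟩
  exact .mk' _ _ fun i p hi hp => hasLiftingProperty_of_trivialCof i p hi.1 hi.2 hp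

end FibCat

/-! ### Strict pullbacks of categories -/

namespace CategoryTheory

section

variable {A B C D : Type*} [Category* A] [Category* B] [Category* C] [Category* D]

/-- Objects of the strict pullback of two functors. -/
structure StrictPullback (F : A ⥤ C) (G : B ⥤ C) where
  /-- the first component -/
  fst : A
  /-- the second component -/
  snd : B
  w : F.obj fst = G.obj snd

namespace StrictPullback

variable {F : A ⥤ C} {G : B ⥤ C}

theorem ext' {x y : StrictPullback F G} (h : x.fst = y.fst) (h' : x.snd = y.snd) : x = y := by
  cases x; cases y; cases h; cases h'; rfl

/-- Maps of the strict pullback of two functors. -/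
@[ext]
structure Hom (x y : StrictPullback F G) where
  /-- the first component -/
  fst : x.fst ⟶ y.fst
  /-- the second component -/
  snd : x.snd ⟶ y.snd
  w : F.map fst ≫ eqToHom y.w = eqToHom x.w ≫ G.map snd := by cat_disch

instance : Category (StrictPullback F G) where
  Hom := Hom
  id x := { fst := 𝟙 _, snd := 𝟙 _ }
  comp f g :=
    { fst := f.fst ≫ g.fst
      snd := f.snd ≫ g.snd
      w := by
        rw [F.map_comp, Category.assoc, g.w, ← Category.assoc, f.w, G.map_comp, Category.assoc] }
  id_comp f := Hom.ext (Category.id_comp _) (Category.id_comp _)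
  comp_id f := Hom.ext (Category.comp_id _) (Category.comp_id _)
  assoc f g h := Hom.ext (Category.assoc _ _ _) (Category.assoc _ _ _)

variable (F G)

/-- The first projection. -/
abbrev fstFunctor : StrictPullback F G ⥤ A where
  obj x := x.fst
  map f := f.fst

/-- The second projection. -/
abbrev sndFunctor : StrictPullback F G ⥤ B where
  obj x := x.snd
  map f := f.snd

variable {F G}

theorem condition : fstFunctor F G ⋙ F = sndFunctor F G ⋙ G :=
  Functor.ext (fun x => x.w) fun x y f => by
    change F.map f.fst = eqToHom x.w ≫ G.map f.snd ≫ eqToHom y.w.symm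
    rw [← Category.assoc, ← f.w]
    simp

/-- The functor to the strict pullback induced by a commutative square. -/
abbrev lift (a : D ⥤ A) (b : D ⥤ B) (h : a ⋙ F = b ⋙ G) : D ⥤ StrictPullback F G where
  obj x := ⟨a.obj x, b.obj x, Functor.congr_obj h x⟩
  map f := Hom.mk (a.map f) (b.map f) (by
    have := Functor.congr_hom h f
    dsimp at this
    simp [this])
  map_id x := Hom.ext (a.map_id x) (b.map_id x)
  map_comp f g := Hom.ext (a.map_comp f g) (b.map_comp f g)

theorem conj_fst {x x' y y' : StrictPullback F G} (h : x = x') (h' : y' = y) (f : x' ⟶ y') :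
    (eqToHom h ≫ f ≫ eqToHom h').fst =
      eqToHom (congrArg fst h) ≫ f.fst ≫ eqToHom (congrArg fst h') := by
  subst h h'
  simp

theorem conj_snd {x x' y y' : StrictPullback F G} (h : x = x') (h' : y' = y) (f : x' ⟶ y') :
    (eqToHom h ≫ f ≫ eqToHom h').snd =
      eqToHom (congrArg snd h) ≫ f.snd ≫ eqToHom (congrArg snd h') := by
  subst h h'
  simp

theorem functor_ext {l l' : D ⥤ StrictPullback F G}
    (h : l ⋙ fstFunctor F G = l' ⋙ fstFunctor F G)
    (h' : l ⋙ sndFunctor F G = l' ⋙ sndFunctor F G) : l = l' :=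
  Functor.ext (fun x => ext' (Functor.congr_obj h x) (Functor.congr_obj h' x)) fun _ _ f =>
    Hom.ext ((Functor.congr_hom h f).trans (conj_fst _ _ _).symm)
      ((Functor.congr_hom h' f).trans (conj_snd _ _ _).symm)

/-- The strict pullback of an equivalence along an isofibration is an equivalence. -/
theorem fstFunctor_isEquivalence (hF : F.IsIsofibration) [G.IsEquivalence] :
    (fstFunctor F G).IsEquivalence where
  faithful := ⟨fun {x y f g} h => Hom.ext h (G.map_injective (by
    rw [← cancel_epi (eqToHom x.w), ← f.w, ← g.w]
    exact congrArg (fun z => F.map z ≫ eqToHom y.w) h))⟩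
  full := ⟨fun {x y} φ => ⟨Hom.mk φ (G.preimage (eqToHom x.w.symm ≫ F.map φ ≫ eqToHom y.w))
    (by simp), rfl⟩⟩
  essSurj := ⟨fun a => by
    obtain ⟨a', α, h, -⟩ := hF a _ (G.objObjPreimageIso (F.obj a)).symm
    exact ⟨⟨a', _, h⟩, ⟨α.symm⟩⟩⟩

end StrictPullback

end

namespace Cat

theorem strictPullback_isPullback {X Y Z : Cat.{u, u}} (f : X ⟶ Z) (g : Y ⟶ Z) :
    IsPullback (P := Cat.of (StrictPullback f.toFunctor g.toFunctor))
      (Cat.Hom.ofFunctor (StrictPullback.fstFunctor f.toFunctor g.toFunctor))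
      (Cat.Hom.ofFunctor (StrictPullback.sndFunctor f.toFunctor g.toFunctor)) f g where
  w := Cat.ext StrictPullback.condition
  isLimit' := ⟨PullbackCone.IsLimit.mk _
    (fun s => Cat.Hom.ofFunctor (StrictPullback.lift s.fst.toFunctor s.snd.toFunctor
      (congrArg Cat.Hom.toFunctor s.condition)))
    (fun _ => rfl) (fun _ => rfl) fun _ _ h₁ h₂ => Cat.ext (StrictPullback.functor_ext
      (congrArg Cat.Hom.toFunctor h₁) (congrArg Cat.Hom.toFunctor h₂))⟩

theorem equivalences_of_isPullback {P X Y Z : Cat.{u, u}} {fst : P ⟶ X} {snd : P ⟶ Y} {f : X ⟶ Z}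
    {g : Y ⟶ Z} (h : IsPullback fst snd f g) (hf : isofibrations f) (hg : equivalences g) :
    equivalences fst := by
  let e := h.isoIsPullback _ _ (strictPullback_isPullback f g)
  have : e.hom.toFunctor.IsEquivalence :=
    Functor.isEquivalence_of_iso_id e.inv.toFunctor
      (eqToIso (congrArg Cat.Hom.toFunctor e.hom_inv_id))
      (eqToIso (congrArg Cat.Hom.toFunctor e.inv_hom_id))
  have hg' : g.toFunctor.IsEquivalence := hg
  have := StrictPullback.fstFunctor_isEquivalence (F := f.toFunctor) (G := g.toFunctor) hf
  have h' : e.hom ≫ Cat.Hom.ofFunctor (StrictPullback.fstFunctor f.toFunctor g.toFunctor) = fst :=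
    h.isoIsPullback_hom_fst _ _ (strictPullback_isPullback f g)
  rw [← h']
  exact equivalences.comp_mem _ _ ‹e.hom.toFunctor.IsEquivalence› this

end Cat

end CategoryTheory

/-! ### Pullbacks of isofibrations of fibred categories -/

namespace FibCat

variable {E : Type u} [SmallCategory E] {X Y Z : FibCat E} (f : X ⟶ Z) (g : Y ⟶ Z)

theorem pullback_p : StrictPullback.fstFunctor (Hom.functor f) (Hom.functor g) ⋙ X.p =
    StrictPullback.sndFunctor (Hom.functor f) (Hom.functor g) ⋙ Y.p := by
  rw [← f.functor_p, ← g.functor_p, ← Functor.assoc, ← Functor.assoc, StrictPullback.condition]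

theorem pullback_base (x : StrictPullback (Hom.functor f) (Hom.functor g)) :
    X.p.obj x.fst = Y.p.obj x.snd := Functor.congr_obj (pullback_p f g) x

theorem pullback_map {x y : StrictPullback (Hom.functor f) (Hom.functor g)} (φ : x ⟶ y) :
    Y.p.map φ.snd = eqToHom (pullback_base f g x).symm ≫ X.p.map φ.fst ≫
      eqToHom (pullback_base f g y) := Functor.congr_hom (pullback_p f g).symm φ

theorem pullback_isCart {x y : StrictPullback (Hom.functor f) (Hom.functor g)} (φ : x ⟶ y)
    (h₁ : X.p.IsCart φ.fst) (h₂ : Y.p.IsCart φ.snd) :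
    (StrictPullback.fstFunctor (Hom.functor f) (Hom.functor g) ⋙ X.p).IsCart φ := by
  intro z ψ r w
  change X.p.obj z.fst ⟶ X.p.obj x.fst at r
  obtain ⟨χ₁, ⟨h₃, h₄⟩, h₅⟩ := h₁ ψ.fst r w
  obtain ⟨χ₂, ⟨h₃', h₄'⟩, h₅'⟩ := h₂ ψ.snd (eqToHom (pullback_base f g z).symm ≫ r ≫
    eqToHom (pullback_base f g x)) (by
      have w' : r ≫ X.p.map φ.fst = X.p.map ψ.fst := w
      rw [pullback_map, pullback_map, ← w']
      simp)
  have hw : (Hom.functor f).map χ₁ ≫ eqToHom x.w = eqToHom z.w ≫ (Hom.functor g).map χ₂ := by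
    refine (g.isCart h₂).ext ?_ ?_
    · rw [Z.p.map_comp, Z.p.map_comp, hom_w, hom_w, h₃, h₃', eqToHom_map, eqToHom_map]
      simp
    · rw [Category.assoc, Category.assoc, ← (Hom.functor g).map_comp, h₄', ← φ.w,
        ← Functor.map_comp_assoc, h₄, ψ.w]
  refine ⟨StrictPullback.Hom.mk χ₁ χ₂ hw, ⟨h₃, StrictPullback.Hom.ext h₄ h₄'⟩,
    fun χ ⟨h₆, h₇⟩ => StrictPullback.Hom.ext (h₅ _ ⟨h₆, congrArg StrictPullback.Hom.fst h₇⟩)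
      (h₅' _ ⟨?_, congrArg StrictPullback.Hom.snd h₇⟩)⟩
  have h₈ : X.p.map χ.fst = r := h₆
  rw [← h₈]
  exact pullback_map f g χ

variable {f}

theorem pullback_exists (hf : (Hom.functor f).IsIsofibration)
    (a : StrictPullback (Hom.functor f) (Hom.functor g)) (R : E) (r : R ⟶ X.p.obj a.fst) :
    ∃ (b : StrictPullback (Hom.functor f) (Hom.functor g)) (φ : b ⟶ a) (h : X.p.obj b.fst = R),
      X.p.map φ.fst = eqToHom h ≫ r ∧ X.p.IsCart φ.fst ∧ Y.p.IsCart φ.snd := by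
  have ha : X.p.obj a.fst = Y.p.obj a.snd := pullback_base f g a
  obtain ⟨b, φ, hb, h₁, h₂⟩ := X.p.exists_isCart a.fst r
  obtain ⟨c, ψ, hc, h₃, h₄⟩ := Y.p.exists_isCart a.snd (r ≫ eqToHom ha)
  have hbc : Z.p.obj ((Hom.functor f).obj b) = Z.p.obj ((Hom.functor g).obj c) := by
    rw [← hom_obj f, ← hom_obj g, hb, hc]
  have h₅ : Z.p.IsCart ((Hom.functor f).map φ ≫ eqToHom a.w) :=
    (f.isCart h₂).comp (Functor.isCart_of_isIso _)
  obtain ⟨κ, h₆, h₇⟩ := h₅.exists_iso (g.isCart h₄) (eqToIso hbc) (by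
    rw [Z.p.map_comp, hom_w, hom_w, h₁, h₃, eqToHom_map]
    simp)
  obtain ⟨b', σ, hb', h₈⟩ := hf b _ κ
  have hR : X.p.obj b' = R := by rw [hom_obj f, hb', ← hom_obj g, hc]
  refine ⟨⟨b', c, hb'⟩, StrictPullback.Hom.mk (σ.inv ≫ φ) ψ ?_, hR, ?_,
    (Functor.isCart_of_isIso _).comp h₂, h₄⟩
  · rw [(Hom.functor f).map_comp, Category.assoc, ← h₇, ← h₈, Category.assoc,
      ← Functor.map_comp_assoc, σ.inv_hom_id, CategoryTheory.Functor.map_id, Category.id_comp]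
  · have : X.p.map σ.hom = eqToHom (hb.trans hR.symm) := by
      have h₉ : Z.p.map ((Hom.functor f).map σ.hom) ≫ eqToHom (by rw [hb']) = eqToHom hbc := by
        rw [← eqToIso.hom hbc, ← h₆, ← h₈, Z.p.map_comp, eqToHom_map]
      rw [hom_w] at h₉
      rw [Category.assoc, Category.assoc, eqToHom_comp_iff, eqToHom_trans, eqToHom_trans,
        comp_eqToHom_iff, eqToHom_trans] at h₉
      exact h₉
    have h₉ : X.p.map σ.inv = eqToHom (hR.trans hb.symm) := by
      rw [← cancel_epi (X.p.map σ.hom), ← X.p.map_comp, σ.hom_inv_id, this]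
      simp
    rw [X.p.map_comp, h₉, h₁, eqToHom_trans_assoc]

variable (hf : (Hom.functor f).IsIsofibration)

/-- The strict pullback of an isofibration of fibred categories. -/
abbrev pullbackFib : FibCat E :=
  ofExists (StrictPullback.fstFunctor (Hom.functor f) (Hom.functor g) ⋙ X.p) fun a R r => by
    obtain ⟨b, φ, h, h₁, h₂, h₃⟩ := pullback_exists g hf a R r
    exact ⟨b, φ, h, h₁, pullback_isCart f g φ h₂ h₃⟩

/-- The first projection of the pullback. -/
abbrev pullbackFst : pullbackFib g hf ⟶ X :=
  homMk (StrictPullback.fstFunctor _ _) rfl fun a b φ hφ =>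
    Functor.isCart_map_of_exists (p := (pullbackFib g hf).p) (fun a R r => by
      obtain ⟨b, φ, h, h₁, h₂, h₃⟩ := pullback_exists g hf a R r
      exact ⟨b, φ, h, h₁, pullback_isCart f g φ h₂ h₃, h₂⟩) hφ

/-- The second projection of the pullback. -/
abbrev pullbackSnd : pullbackFib g hf ⟶ Y :=
  homMk (StrictPullback.sndFunctor _ _) (by
      change _ = _ ⋙ X.p
      rw [← f.functor_p, ← g.functor_p, ← Functor.assoc, ← Functor.assoc,
        StrictPullback.condition]) fun a b φ hφ =>
    Functor.isCart_map_of_exists (p := (pullbackFib g hf).p) (fun a R r => by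
      obtain ⟨b, φ, h, h₁, h₂, h₃⟩ := pullback_exists g hf a R r
      exact ⟨b, φ, h, h₁, pullback_isCart f g φ h₂ h₃, h₃⟩) hφ

theorem pullbackFib_isPullback : IsPullback (pullbackFst g hf) (pullbackSnd g hf) f g where
  w := hom_ext StrictPullback.condition
  isLimit' := ⟨PullbackCone.IsLimit.mk _
    (fun s => homMk (StrictPullback.lift (Hom.functor s.fst) (Hom.functor s.snd)
      (congrArg Hom.functor s.condition)) (Hom.functor_p s.fst) fun _ _ _ hφ =>
        pullback_isCart f g _ (s.fst.isCart hφ) (s.snd.isCart hφ))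
    (fun _ => rfl) (fun _ => rfl) fun _ _ h₁ h₂ => hom_ext (StrictPullback.functor_ext
      (congrArg Hom.functor h₁) (congrArg Hom.functor h₂))⟩

theorem hasPullback_of_fib (hf : (modelData E).fib f) : HasPullback f g :=
  (pullbackFib_isPullback g hf).hasPullback

end FibCat

/-! ### Equivalences of Grothendieck constructions -/

namespace Groth

variable {E : Type u} [SmallCategory E] {P Q : Eᵒᵖ ⥤ Cat.{u, u}}

theorem comp_eqToHom_eqToHom {A : Type*} [Category* A] {x y z : A} (m : x ⟶ y) (h : y = z)
    (h' : z = y) : (m ≫ eqToHom h) ≫ eqToHom h' = m := by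
  subst h
  simp

theorem map_comp_eqToHom {A B : Type*} [Category* A] [Category* B] (F : A ⥤ B) {x y z : A} {b : B}
    (m : x ⟶ y) (h : y = z) (h' : F.obj z = b) (h'' : F.obj y = b) :
    F.map (m ≫ eqToHom h) ≫ eqToHom h' = F.map m ≫ eqToHom h'' := by
  subst h h'
  simp

theorem hom_ext_iff {x y : Groth P} (b : x.base ⟶ y.base)
    (m m' : x.fiber ⟶ (P.map b.op).toFunctor.obj y.fiber) :
    (Hom.mk b m : x ⟶ y) = Hom.mk b m' ↔ m = m' :=
  ⟨fun h => by injection h, fun h => by rw [h]⟩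

variable (P) in
/-- The inclusion of a fibre in the Grothendieck construction. -/
@[simps]
def incl (S : E) : P.obj (op S) ⥤ Groth P where
  obj x := ⟨S, x⟩
  map {x y} m := Hom.mk (𝟙 S) (m ≫ eqToHom (map_id_obj P y))
  map_id x := Hom.ext' rfl (by simp)
  map_comp f g := Hom.ext' (by simp) (by simp [map_id_map])

theorem incl_map_injective {S : E} {x y : P.obj (op S)} {m m' : x ⟶ y}
    (h : (incl P S).map m = (incl P S).map m') : m = m' := by
  have := (hom_ext_iff _ _ _).1 h
  exact (cancel_mono _).1 this

instance (S : E) : (incl P S).Faithful := ⟨incl_map_injective⟩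

theorem exists_incl_map {S : E} {x y : P.obj (op S)} (φ : (incl P S).obj x ⟶ (incl P S).obj y)
    (h : Hom.base φ = 𝟙 S) : ∃ m : x ⟶ y, (incl P S).map m = φ := by
  obtain ⟨b, m⟩ := φ
  obtain rfl : b = 𝟙 S := h
  exact ⟨m ≫ eqToHom (map_id_obj P y).symm, (hom_ext_iff _ _ _).2 (comp_eqToHom_eqToHom _ _ _)⟩

theorem incl_map_comp (η : P ⟶ Q) (S : E) :
    incl P S ⋙ map η = (η.app (op S)).toFunctor ⋙ incl Q S :=
  CategoryTheory.Functor.hext (fun _ => rfl) fun x y m => heq_of_eq (by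
    refine (hom_ext_iff _ _ _).2 ?_
    exact map_comp_eqToHom _ _ _ _ _)

theorem isIso_fiber_of_isIso_incl {S : E} {x y : P.obj (op S)}
    (e : (incl P S).obj x ≅ (incl P S).obj y) (h : Hom.base e.hom = 𝟙 S) :
    ∃ e' : x ≅ y, (incl P S).map e'.hom = e.hom := by
  have h' : Hom.base e.inv = 𝟙 S := by
    have := congrArg Hom.base e.inv_hom_id
    rw [comp_base, h] at this
    exact (Category.comp_id _).symm.trans this
  obtain ⟨m, hm⟩ := exists_incl_map e.hom h
  obtain ⟨m', hm'⟩ := exists_incl_map e.inv h'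
  refine ⟨⟨m, m', ?_, ?_⟩, hm⟩ <;> apply incl_map_injective
  · rw [Functor.map_comp, hm, hm', e.hom_inv_id, CategoryTheory.Functor.map_id]
  · rw [Functor.map_comp, hm, hm', e.inv_hom_id, CategoryTheory.Functor.map_id]

theorem isCart_of_isIso_fiber {x y : Groth P} (φ : x ⟶ y) (h : IsIso (Hom.fiber φ)) :
    (proj P).IsCart φ :=
  Functor.isCart_of_isStronglyCartesian (isStronglyCartesian_of_isIso _ φ rfl h)

theorem isIso_fiber_of_isCart {x y : Groth P} {φ : x ⟶ y} (h : (proj P).IsCart φ) :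
    IsIso (Hom.fiber φ) := by
  have h' : (proj P).IsCart (lift y (Hom.base φ)) :=
    isCart_of_isIso_fiber _ (by dsimp [lift]; infer_instance)
  obtain ⟨e, h₁, h₂⟩ := h.exists_iso h' (Iso.refl x.base) (Category.id_comp _)
  obtain ⟨e', he⟩ := isIso_fiber_of_isIso_incl (x := x.fiber) e h₁
  have H : ∀ (b : x.base ⟶ y.base) (e' : x.fiber ≅ (P.map b.op).toFunctor.obj y.fiber)
      (φ : x ⟶ y), (incl P x.base).map e'.hom ≫ lift y b = φ → IsIso (Hom.fiber φ) := by
    rintro b e' _ rfl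
    have h₃ := (P.map (𝟙 x.base).op).toFunctor.map_id ((P.map b.op).toFunctor.obj y.fiber)
    have h₄ : IsIso ((P.map (𝟙 x.base).op).toFunctor.map
      (𝟙 ((P.map b.op).toFunctor.obj y.fiber))) := by rw [h₃]; infer_instance
    have h₅ := isIso_comp_eqToHom e'.hom inferInstance (map_id_obj P _)
    exact @IsIso.comp_isIso _ _ _ _ _ _ _ h₅ (isIso_comp_eqToHom _ h₄ _)
  exact H _ e' φ ((congrArg (· ≫ lift y (Hom.base φ)) he).trans h₂)

theorem isEquivalence_map {η : P ⟶ Q} (h : objectwiseEquivalences E η) :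
    (map η).IsEquivalence where
  faithful := ⟨fun {x y f g} w => by
    have := h (op x.base)
    obtain ⟨b, m⟩ := f
    obtain ⟨b', m'⟩ := g
    obtain rfl : b = b' := congrArg Hom.base w
    have := (hom_ext_iff _ _ _).1 w
    exact (hom_ext_iff _ _ _).2 ((η.app (op x.base)).toFunctor.map_injective
      ((cancel_mono _).1 this))⟩
  full := ⟨fun {x y} f => by
    have := h (op x.base)
    obtain ⟨b, n⟩ := f
    refine ⟨Hom.mk b ((η.app (op x.base)).toFunctor.preimage (n ≫ eqToHom
      (congrArg (fun F => F.toFunctor.obj y.fiber) (η.naturality b.op)).symm)),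
        (hom_ext_iff _ _ _).2 ?_⟩
    rw [Functor.map_preimage]
    exact comp_eqToHom_eqToHom _ _ _⟩
  essSurj := ⟨fun ⟨S, y⟩ => by
    have := h (op S)
    exact ⟨⟨S, (η.app (op S)).toFunctor.objPreimage y⟩,
      ⟨(incl Q S).mapIso ((η.app (op S)).toFunctor.objObjPreimageIso y)⟩⟩⟩

theorem objectwiseEquivalences_of_isEquivalence {η : P ⟶ Q} [(map η).IsEquivalence] :
    objectwiseEquivalences E η := fun ⟨S⟩ =>
  { faithful := by
      have : ((η.app (op S)).toFunctor ⋙ incl Q S).Faithful := by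
        rw [← incl_map_comp]
        infer_instance
      exact Functor.Faithful.of_comp _ (incl Q S)
    full := ⟨fun {x y} n => by
      obtain ⟨φ, hφ⟩ := (map η).map_surjective (X := (incl P S).obj x) (Y := (incl P S).obj y)
        ((incl Q S).map n)
      obtain ⟨m, rfl⟩ := exists_incl_map φ (congrArg Hom.base hφ)
      refine ⟨m, incl_map_injective ?_⟩
      have := Functor.hcongr_hom (incl_map_comp η S) m
      exact (eq_of_heq this).symm.trans hφ⟩
    essSurj := ⟨fun y => by
      let e := (map η).objObjPreimageIso ((incl Q S).obj y)
      let x := (map η).objPreimage ((incl Q S).obj y)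
      have h : IsIso (Hom.fiber e.inv) := isIso_fiber_of_isCart (Functor.isCart_of_isIso _)
      let b : S ⟶ x.base := Hom.base e.inv
      refine ⟨(P.map b.op).toFunctor.obj x.fiber, ⟨eqToIso ?_ ≪≫ (asIso (Hom.fiber e.inv)).symm⟩⟩
      exact congrArg (fun F => F.toFunctor.obj x.fiber) (η.naturality b.op)⟩ }

theorem isEquivalence_map_iff {η : P ⟶ Q} :
    (map η).IsEquivalence ↔ objectwiseEquivalences E η :=
  ⟨fun _ => objectwiseEquivalences_of_isEquivalence, isEquivalence_map⟩

theorem map_injective {η : P ⟶ Q} (h : objectwiseInjective E η) :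
    Function.Injective (map η).obj := fun ⟨S, x⟩ ⟨S', x'⟩ w => by
  obtain rfl : S = S' := congrArg Groth.base w
  have : (η.app (op S)).toFunctor.obj x = (η.app (op S)).toFunctor.obj x' := by injection w
  rw [h _ this]

end Groth

/-! ### The Grothendieck construction as a left adjoint functor to `CAT` -/

theorem CategoryTheory.NatTrans.eq_conj_eqToHom {C D : Type*} [Category* C] [Category* D]
    {F F' G G' : C ⥤ D} (h : F = F') (h' : G' = G) (α : F ⟶ G) (β : F' ⟶ G')
    (H : ∀ c, α.app c = eqToHom (Functor.congr_obj h c) ≫ β.app c ≫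
      eqToHom (Functor.congr_obj h' c)) : α = eqToHom h ≫ β ≫ eqToHom h' := by
  subst h h'
  ext c
  simpa using H c

theorem CategoryTheory.eqToHom_eq_comp_comp {C : Type*} [Category* C] {a b c d : C} (h : a = d)
    (h₁ : a = b) (h₂ : b = c) (h₃ : c = d) :
    eqToHom h = eqToHom h₁ ≫ eqToHom h₂ ≫ eqToHom h₃ := by
  simp

theorem CategoryTheory.eqToHom_eq_comp_map_comp {C D : Type*} [Category* C] [Category* D]
    (F : C ⥤ D) {a b : C} {x y z : D} (h : x = z) (h₁ : x = F.obj a) (h₂ : a = b)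
    (h₃ : F.obj b = y) (h₄ : y = z) :
    eqToHom h = eqToHom h₁ ≫ (F.map (eqToHom h₂) ≫ eqToHom h₃) ≫ eqToHom h₄ := by
  subst h₂ h₃ h₄
  simp

theorem CategoryTheory.NatTrans.comp_eqToHom_app {C D : Type*} [Category* C] [Category* D]
    {F G H : C ⥤ D} (α : F ⟶ G) (h : G = H) (c : C) :
    (α ≫ eqToHom h).app c = α.app c ≫ eqToHom (Functor.congr_obj h c) := by
  subst h
  simp

theorem CategoryTheory.NatTrans.comp_comp_eqToHom_app {C D : Type*} [Category* C] [Category* D]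
    {F G H K : C ⥤ D} (α : F ⟶ G) (β : G ⟶ H) (h : H = K) (c : C) :
    (α ≫ β ≫ eqToHom h).app c = α.app c ≫ β.app c ≫ eqToHom (Functor.congr_obj h c) := by
  subst h
  simp

namespace Groth

variable {E : Type u} [SmallCategory E] {P Q : Eᵒᵖ ⥤ Cat.{u, u}}

theorem conj_eqToHom {S T : E} {a a' : P.obj (op S)} {b b' : P.obj (op T)} (h : a = a')
    (h' : b' = b) (r : S ⟶ T) (m : a' ⟶ (P.map r.op).toFunctor.obj b') :
    eqToHom (congrArg (Groth.mk S) h) ≫ (Hom.mk r m : (⟨S, a'⟩ : Groth P) ⟶ ⟨T, b'⟩) ≫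
      eqToHom (congrArg (Groth.mk T) h') =
        Hom.mk r (eqToHom h ≫ m ≫ eqToHom (congrArg _ h')) := by
  subst h h'
  simp

theorem conj_incl {S : E} {a a' b b' : P.obj (op S)} (h : a = a') (h' : b' = b) (m : a' ⟶ b') :
    eqToHom (congrArg (Groth.mk S) h) ≫ (incl P S).map m ≫ eqToHom (congrArg (Groth.mk S) h') =
      (incl P S).map (eqToHom h ≫ m ≫ eqToHom h') := by
  subst h h'
  simp only [eqToHom_refl, Category.id_comp, Category.comp_id]
  exact Category.comp_id ((incl P S).map m)

theorem incl_comp_mk {S T : E} {a b : P.obj (op S)} {c : P.obj (op T)} (m : a ⟶ b) (r : S ⟶ T)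
    (n : b ⟶ (P.map r.op).toFunctor.obj c) :
    (incl P S).map m ≫ (Hom.mk r n : (⟨S, b⟩ : Groth P) ⟶ ⟨T, c⟩) = Hom.mk r (m ≫ n) :=
  Hom.ext' (Category.id_comp r) (by
    change ((m ≫ eqToHom (map_id_obj P b)) ≫ (P.map (𝟙 S).op).toFunctor.map n ≫
      eqToHom (map_comp_obj P (𝟙 S) r c)) ≫ eqToHom (by simp) = m ≫ n
    simp [map_id_map])

theorem eqToHom_mk {S : E} {a b : P.obj (op S)} (h : a = b) :
    eqToHom (congrArg (Groth.mk S) h) = (incl P S).map (eqToHom h) := by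
  subst h
  exact ((incl P S).map_id a).symm

theorem map_id_comp_eqToHom {S : Eᵒᵖ} {a b c d : P.obj S} (m : a ⟶ b)
    (h₁ : (P.map (𝟙 S)).toFunctor.obj b = c) (h₂ : c = d)
    (h₃ : (P.map (𝟙 S)).toFunctor.obj a = a) (h₄ : b = d) :
    ((P.map (𝟙 S)).toFunctor.map m ≫ eqToHom h₁) ≫ eqToHom h₂ =
      eqToHom h₃ ≫ m ≫ eqToHom h₄ := by
  subst h₂ h₄
  rw [map_id_map]
  simp

theorem map_obj_of_eq (P : Eᵒᵖ ⥤ Cat.{u, u}) {S T U : E} {k : S ⟶ U} {f : S ⟶ T} {g : T ⟶ U}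
    (w : f ≫ g = k) (x : P.obj (op U)) : (P.map k.op).toFunctor.obj x =
      (P.map f.op).toFunctor.obj ((P.map g.op).toFunctor.obj x) := by
  subst w
  exact (map_comp_obj P f g x).symm

theorem map_map_of_eq (P : Eᵒᵖ ⥤ Cat.{u, u}) {S T U : E} {k : S ⟶ U} {f : S ⟶ T} {g : T ⟶ U}
    (w : f ≫ g = k) {x y : P.obj (op U)} (m : x ⟶ y) : (P.map k.op).toFunctor.map m =
      eqToHom (map_obj_of_eq P w x) ≫
        (P.map f.op).toFunctor.map ((P.map g.op).toFunctor.map m) ≫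
          eqToHom (map_obj_of_eq P w y).symm := by
  subst w
  exact map_comp_map P g.op f.op m

/-- The functor `E/S ⥤ Groth P` given by the restrictions of an object of `P(S)`. -/
@[simps]
def restrObj {S : E} (x : P.obj (op S)) : Over S ⥤ Groth P where
  obj g := ⟨g.left, (P.map g.hom.op).toFunctor.obj x⟩
  map {g g'} h := Hom.mk h.left (eqToHom (map_obj_of_eq P (Over.w h) x))
  map_id g := rfl
  map_comp f g := Hom.ext' rfl (by simp [eqToHom_map])

/-- The functor `P(S) ⥤ Fun(E/S, Groth P)` given by restriction. -/
@[simps]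
def restr (P : Eᵒᵖ ⥤ Cat.{u, u}) (S : E) : P.obj (op S) ⥤ (Over S ⥤ Groth P) where
  obj x := restrObj x
  map {x y} m :=
    { app := fun g => (incl P g.left).map ((P.map g.hom.op).toFunctor.map m)
      naturality := fun g g' h => Hom.ext' ((Category.comp_id _).trans (Category.id_comp _).symm) (by
        change (eqToHom (map_obj_of_eq P (Over.w h) x) ≫ (P.map h.left.op).toFunctor.map
          ((P.map g'.hom.op).toFunctor.map m ≫ eqToHom (map_id_obj P _)) ≫
            eqToHom (map_comp_obj P _ _ _)) ≫ eqToHom (by simp) =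
          ((P.map g.hom.op).toFunctor.map m ≫ eqToHom (map_id_obj P _)) ≫
            (P.map (𝟙 g.left).op).toFunctor.map (eqToHom (map_obj_of_eq P (Over.w h) y)) ≫
              eqToHom (map_comp_obj P _ _ _)
        rw [map_map_of_eq P (Over.w h) m]
        simp [eqToHom_map]) }
  map_id x := by
    ext g
    change (incl P g.left).map ((P.map g.hom.op).toFunctor.map (𝟙 x)) = 𝟙 _
    rw [CategoryTheory.Functor.map_id, CategoryTheory.Functor.map_id]
  map_comp f g := by
    ext h
    change (incl P h.left).map ((P.map h.hom.op).toFunctor.map (f ≫ g)) = _ ≫ _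
    rw [CategoryTheory.Functor.map_comp, CategoryTheory.Functor.map_comp]
    rfl

end Groth

section

variable (E : Type u) [SmallCategory E]

/-- The presheaf of categories `S ↦ Fun(E/S, C)`. -/
@[simps]
def overFunctorPresheaf (C : Type u) [SmallCategory C] : Eᵒᵖ ⥤ Cat.{u, u} where
  obj S := Cat.of (Over S.unop ⥤ C)
  map f := ((Functor.whiskeringLeft _ _ C).obj (Over.map f.unop)).toCatHom
  map_id S := by
    rw [unop_id, Over.mapId_eq]
    rfl
  map_comp f g := by
    rw [unop_comp, Over.mapComp_eq]
    rfl

/-- The functor which takes a category `C` to the presheaf `S ↦ Fun(E/S, C)`. -/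
@[simps]
def overFunctor : Cat.{u, u} ⥤ (Eᵒᵖ ⥤ Cat.{u, u}) where
  obj C := overFunctorPresheaf E C
  map F := { app := fun S => ((Functor.whiskeringRight (Over S.unop) _ _).obj F.toFunctor).toCatHom }

/-- The total category of the Grothendieck construction, as a functor. -/
@[simps]
def totalFunctor : (Eᵒᵖ ⥤ Cat.{u, u}) ⥤ Cat.{u, u} where
  obj P := Cat.of (Groth P)
  map η := (Groth.map η).toCatHom
  map_id P := Cat.ext (Groth.map_id_eq P)
  map_comp η θ := Cat.ext (Groth.map_comp_eq η θ)

variable {E}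

/-- The natural transformation of presheaves of categories given by restriction. -/
def totalUnit (P : Eᵒᵖ ⥤ Cat.{u, u}) : P ⟶ overFunctorPresheaf E (Groth P) where
  app S := Cat.Hom.ofFunctor (Groth.restr P S.unop)
  naturality S T f := Cat.ext (by
    refine CategoryTheory.Functor.ext (fun x => ?_) fun x y m => ?_
    · refine CategoryTheory.Functor.ext (fun g => ?_) fun g g' h => ?_
      · exact congrArg (Groth.mk g.left) (Groth.map_comp_obj P g.hom f.unop x)
      · exact ((Groth.hom_ext_iff _ _ _).2 (eqToHom_eq_comp_comp _ _ _ _)).trans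
          (Groth.conj_eqToHom (Groth.map_comp_obj P g.hom f.unop x)
            (Groth.map_comp_obj P g'.hom f.unop x).symm h.left
            (eqToHom (Groth.map_obj_of_eq P (Over.w ((Over.map f.unop).map h)) x))).symm
    · refine NatTrans.eq_conj_eqToHom _ _ _ _ fun g => ?_
      refine Eq.trans (congrArg (Groth.incl P g.left).map ?_) (Groth.conj_incl
        (Groth.map_comp_obj P g.hom f.unop x) (Groth.map_comp_obj P g.hom f.unop y).symm _).symm
      change _ = eqToHom _ ≫ (P.map (g.hom ≫ f.unop).op).toFunctor.map m ≫ eqToHom _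
      rw [Groth.map_map_of_eq P rfl m]
      simp)

theorem totalUnit_naturality {P Q : Eᵒᵖ ⥤ Cat.{u, u}} (η : P ⟶ Q) :
    η ≫ totalUnit Q = totalUnit P ≫ (overFunctor E).map ((totalFunctor E).map η) := by
  have hη : ∀ {S : E} (g : Over S) (x : P.obj (op S)), (Q.map g.hom.op).toFunctor.obj
      ((η.app _).toFunctor.obj x) = (η.app _).toFunctor.obj ((P.map g.hom.op).toFunctor.obj x) :=
    fun g x => (congrArg (fun F => F.toFunctor.obj x) (η.naturality g.hom.op)).symm
  refine NatTrans.ext (funext fun S => Cat.ext ?_)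
  refine CategoryTheory.Functor.ext (fun x => ?_) fun x y m => ?_
  · refine CategoryTheory.Functor.ext (fun g => ?_) fun g g' h => ?_
    · exact congrArg (Groth.mk g.left) (hη g x)
    · refine ((Groth.hom_ext_iff _ _ _).2 ?_).trans
        (Groth.conj_eqToHom (hη g x) (hη g' x).symm h.left _).symm
      change _ = eqToHom _ ≫ ((η.app _).toFunctor.map
        (eqToHom (Groth.map_obj_of_eq P (Over.w h) x)) ≫ eqToHom _) ≫ eqToHom _
      exact eqToHom_eq_comp_map_comp (η.app (op g.left)).toFunctor _ _ _ _ _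
  · refine NatTrans.eq_conj_eqToHom _ _ _ _ fun g => ?_
    have h₁ := eq_of_heq (Functor.hcongr_hom (Groth.incl_map_comp η g.left)
      ((P.map g.hom.op).toFunctor.map m))
    refine Eq.trans (congrArg (Groth.incl Q g.left).map ?_) ((congrArg (fun z => _ ≫ z ≫ _)
      h₁).trans (Groth.conj_incl (hη g x) (hη g y).symm _)).symm
    change _ = eqToHom _ ≫ (η.app _).toFunctor.map ((P.map g.hom.op).toFunctor.map m) ≫ eqToHom _
    rw [Groth.naturality_map]
    simp

section Counit

variable (C : Type u) [SmallCategory C]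

/-- The functor on a slice category which is the fibre component of an object. -/
abbrev Groth.fiberFunctor {C : Type u} [SmallCategory C] (x : Groth (overFunctorPresheaf E C)) :
    Over x.base ⥤ C := x.fiber

/-- The natural transformation which is the fibre component of a map. -/
abbrev Groth.fiberNatTrans {C : Type u} [SmallCategory C] {x y : Groth (overFunctorPresheaf E C)}
    (f : x ⟶ y) : x.fiberFunctor ⟶ Over.map (Groth.Hom.base f) ⋙ y.fiberFunctor := Groth.Hom.fiber f

/-- The map from `f` to the identity of its target. -/
abbrev overToId {S T : E} (f : S ⟶ T) :
    (Over.map f).obj (Over.mk (𝟙 S)) ⟶ Over.mk (𝟙 T) := Over.homMk f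

theorem over_map_homMk {S T U : E} (u : Over U ⥤ C) (f : S ⟶ T) (g : T ⟶ U)
    (h : (Over.map (f ≫ g)).obj (Over.mk (𝟙 S)) = (Over.map g).obj ((Over.map f).obj (Over.mk (𝟙 S))))
    : eqToHom (congrArg u.obj h.symm) ≫
      u.map (Over.homMk (f ≫ g) : (Over.map (f ≫ g)).obj (Over.mk (𝟙 S)) ⟶ Over.mk (𝟙 U)) =
      u.map ((Over.map g).map (overToId f)) ≫
        u.map (overToId g) := by
  rw [← eqToHom_map u h.symm, ← u.map_comp, ← u.map_comp]
  congr 1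
  ext
  simp [Over.eqToHom_left]

theorem eqToHom_app_comp_map_homMk {S : E} {u : Over S ⥤ C} (h : u = Over.map (𝟙 S) ⋙ u) :
    (eqToHom h).app (Over.mk (𝟙 S)) ≫
      u.map (overToId (𝟙 S)) = 𝟙 _ := by
  have h' : Over.mk (𝟙 S) = (Over.map (𝟙 S)).obj (Over.mk (𝟙 S)) := by
    rw [Over.mapId_eq]
    rfl
  rw [eqToHom_app, ← eqToHom_map u h', ← u.map_comp, ← u.map_id]
  congr 1
  ext
  simp [Over.eqToHom_left]

/-- Evaluation at the identities. -/
@[simps]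
def totalCounit : Groth (overFunctorPresheaf E C) ⥤ C where
  obj x := x.fiberFunctor.obj (Over.mk (𝟙 x.base))
  map {x y} f := (Groth.fiberNatTrans f).app (Over.mk (𝟙 x.base)) ≫
    y.fiberFunctor.map (overToId (Groth.Hom.base f))
  map_id x := eqToHom_app_comp_map_homMk C (Groth.map_id_obj (overFunctorPresheaf E C) x.fiber)
  map_comp {x y z} f g := by
    have h₁ := (Groth.fiberNatTrans g).naturality (overToId (Groth.Hom.base f))
    have h₀ : (Over.map (Groth.Hom.base f ≫ Groth.Hom.base g)).obj (Over.mk (𝟙 x.base)) =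
        (Over.map (Groth.Hom.base g)).obj ((Over.map (Groth.Hom.base f)).obj (Over.mk (𝟙 x.base))) := by
      rw [Over.mapComp_eq]
      rfl
    have h₂ := over_map_homMk C z.fiberFunctor (Groth.Hom.base f) (Groth.Hom.base g) h₀
    have h₃ : (Groth.fiberNatTrans (f ≫ g)).app (Over.mk (𝟙 x.base)) =
      (Groth.fiberNatTrans f).app (Over.mk (𝟙 x.base)) ≫
        (Groth.fiberNatTrans g).app ((Over.map (Groth.Hom.base f)).obj (Over.mk (𝟙 x.base))) ≫
          eqToHom (congrArg z.fiberFunctor.obj h₀.symm) := by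
      exact NatTrans.comp_comp_eqToHom_app (Groth.fiberNatTrans f)
        (Functor.whiskerLeft (Over.map (Groth.Hom.base f)) (Groth.fiberNatTrans g)) _ _
    rw [h₃, Category.assoc, Category.assoc]
    refine (congrArg (fun t => _ ≫ _ ≫ t) h₂).trans ?_
    rw [Category.assoc]
    refine congrArg (fun t => _ ≫ t) ?_
    rw [← Category.assoc, ← Category.assoc]
    exact congrArg (fun t => t ≫ _) h₁.symm

end Counit

theorem totalCounit_naturality {C D : Type u} [SmallCategory C] [SmallCategory D] (F : C ⥤ D) :
    Groth.map ((overFunctor E).map F.toCatHom) ⋙ totalCounit D = totalCounit C ⋙ F :=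
  CategoryTheory.Functor.hext (fun _ => rfl) fun x y f => heq_of_eq (by
    refine (congrArg (fun t => t ≫ F.map (y.fiberFunctor.map (overToId (Groth.Hom.base f))))
      ((NatTrans.comp_eqToHom_app (Functor.whiskerRight (Groth.fiberNatTrans f) F) rfl
        (Over.mk (𝟙 x.base))).trans (Category.comp_id _))).trans ?_
    exact (F.map_comp _ _).symm)

theorem CategoryTheory.NatTrans.app_eq_eqToHom {A B : Type*} [Category* A] [Category* B]
    {F G : A ⥤ B} (m : F ⟶ G) {a b : A} (h : a = b) : m.app a =
      eqToHom (congrArg F.obj h) ≫ m.app b ≫ eqToHom (congrArg G.obj h.symm) := by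
  subst h
  simp

theorem totalFunctor_left_triangle (P : Eᵒᵖ ⥤ Cat.{u, u}) :
    Groth.map (totalUnit P) ⋙ totalCounit (Groth P) = 𝟭 _ :=
  CategoryTheory.Functor.ext (fun x => congrArg (Groth.mk x.base) (Groth.map_id_obj P x.fiber).symm)
    fun x y f => by
      refine Eq.trans ?_ (Groth.conj_eqToHom (Groth.map_id_obj P x.fiber).symm
        (Groth.map_id_obj P y.fiber) (Groth.Hom.base f) (Groth.Hom.fiber f)).symm
      have h₁ := NatTrans.comp_eqToHom_app ((Groth.restr P x.base).map (Groth.Hom.fiber f))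
        (congrArg (fun F => F.toFunctor.obj y.fiber)
          ((totalUnit P).naturality (Groth.Hom.base f).op)) (Over.mk (𝟙 x.base))
      have h₂ := Groth.eqToHom_mk (Groth.map_comp_obj P (𝟙 x.base) (Groth.Hom.base f) y.fiber)
      refine (congrArg (fun t => t ≫ (Groth.restrObj y.fiber).map (overToId (Groth.Hom.base f)))
        (h₁.trans (congrArg (fun t => _ ≫ t) h₂))).trans ?_
      refine (congrArg (fun t => t ≫ _) ((Groth.incl P x.base).map_comp _ _).symm).trans ?_
      exact (Groth.incl_comp_mk _ _ _).trans
        ((Groth.hom_ext_iff _ _ _).2 (Groth.map_id_comp_eqToHom (P := P) (Groth.Hom.fiber f) _ _ _ _))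

theorem over_mk_id_comp {S : E} (g : Over S) : Over.mk (𝟙 g.left ≫ g.hom) = g := by
  rw [Category.id_comp]
  rfl

theorem eqToHom_comp_map_overToId (C : Type u) [SmallCategory C] {S : E} (u : Over S ⥤ C)
    {g g' : Over S} (h : g ⟶ g') (e : u.obj (Over.mk (𝟙 g.left ≫ g.hom)) =
      u.obj ((Over.map g'.hom).obj ((Over.map h.left).obj (Over.mk (𝟙 g.left)))))
    (e₁ : u.obj (Over.mk (𝟙 g.left ≫ g.hom)) = u.obj g)
    (e₂ : u.obj g' = u.obj (Over.mk (𝟙 g'.left ≫ g'.hom))) :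
    eqToHom e ≫ u.map ((Over.map g'.hom).map (overToId h.left)) =
      eqToHom e₁ ≫ u.map h ≫ eqToHom e₂ := by
  have h₀ : Over.mk (𝟙 g.left ≫ g.hom) =
      (Over.map g'.hom).obj ((Over.map h.left).obj (Over.mk (𝟙 g.left))) := by
    change Over.mk _ = Over.mk _
    simp
  have h₃ : eqToHom e = u.map (eqToHom h₀) := (eqToHom_map u h₀).symm
  have h₁ : eqToHom e₁ = u.map (eqToHom (over_mk_id_comp g)) := (eqToHom_map u _).symm
  have h₂ : eqToHom e₂ = u.map (eqToHom (over_mk_id_comp g').symm) := (eqToHom_map u _).symm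
  rw [h₁, h₂, h₃]
  refine (u.map_comp _ _).symm.trans (Eq.trans (congrArg u.map ?_)
    ((u.map_comp _ _).trans (congrArg (fun t => _ ≫ t) (u.map_comp _ _))))
  ext
  simp [Over.eqToHom_left]

theorem totalFunctor_right_triangle (C : Type u) [SmallCategory C] :
    totalUnit (overFunctorPresheaf E C) ≫ (overFunctor E).map (totalCounit C).toCatHom = 𝟙 _ := by
  refine NatTrans.ext (funext fun S => Cat.ext ?_)
  have hobj : ∀ u : Over S.unop ⥤ C, Groth.restrObj (P := overFunctorPresheaf E C) u ⋙
      totalCounit C = u := fun u =>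
    CategoryTheory.Functor.ext (fun g => congrArg u.obj (over_mk_id_comp g)) fun g g' h => by
      refine (congrArg (fun t => t ≫ u.map ((Over.map g'.hom).map (overToId h.left)))
        (eqToHom_app (Groth.map_obj_of_eq (overFunctorPresheaf E C) (Over.w h) u)
          (Over.mk (𝟙 g.left)))).trans ?_
      exact eqToHom_comp_map_overToId C u h _ _ _
  refine CategoryTheory.Functor.ext hobj fun (u v : Over S.unop ⥤ C) (m : u ⟶ v) => ?_
  refine NatTrans.eq_conj_eqToHom (hobj u) (hobj v).symm _ _ fun g => ?_
  have h₁ := NatTrans.comp_app (Functor.whiskerLeft (Over.map g.hom) m)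
    (eqToHom (Groth.map_id_obj (overFunctorPresheaf E C) (Over.map g.hom ⋙ v))) (Over.mk (𝟙 g.left))
  have h₂ := eqToHom_app_comp_map_homMk C
    (Groth.map_id_obj (overFunctorPresheaf E C) (S := g.left) (Over.map g.hom ⋙ v))
  refine (congrArg (fun t => t ≫ v.map ((Over.map g.hom).map (overToId (𝟙 g.left)))) h₁).trans ?_
  refine (Category.assoc _ _ _).trans ((congrArg (fun t => _ ≫ t) h₂).trans
    ((Category.comp_id _).trans ?_))
  exact NatTrans.app_eq_eqToHom m (over_mk_id_comp g)

variable (E) in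
/-- The Grothendieck construction, as a functor to `CAT`, is left adjoint to the functor
which takes `C` to `S ↦ Fun(E/S, C)`. -/
def totalAdjunction : totalFunctor E ⊣ overFunctor E where
  unit :=
    { app := totalUnit
      naturality := fun _ _ η => totalUnit_naturality η }
  counit :=
    { app := fun C => Cat.Hom.ofFunctor (totalCounit C)
      naturality := fun _ _ F => Cat.ext (totalCounit_naturality F.toFunctor) }
  left_triangle_components P := Cat.ext (totalFunctor_left_triangle P)
  right_triangle_components C := totalFunctor_right_triangle C

end

/-! ### The adjunction between `Φ` and `𝒮` -/

theorem Groth.map_comp_comp {E : Type u} [SmallCategory E] {P Q R : Eᵒᵖ ⥤ Cat.{u, u}} (η : P ⟶ Q)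
    (θ : Q ⟶ R) {C : Type*} [Category* C] (X : Groth R ⥤ C) :
    Groth.map η ⋙ Groth.map θ ⋙ X = Groth.map (η ≫ θ) ⋙ X := by
  rw [Groth.map_comp_eq]
  rfl

theorem CategoryTheory.isIso_eqToHom {C : Type*} [Category* C] {x y : C} (h : x = y) :
    IsIso (eqToHom h) := inferInstance

namespace FibCat

variable {E : Type u} [SmallCategory E]

/-- The natural transformation underlying a vertical natural transformation. -/
abbrev natTrans {F G : FibCat E} {u₁ u₂ : F ⟶ G} (α : u₁ ⟶ u₂) :
    Hom.functor u₁ ⟶ Hom.functor u₂ := BasedNatTrans.toNatTrans α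

theorem map_natTrans_app {F G : FibCat E} {u₁ u₂ : F ⟶ G} (α : u₁ ⟶ u₂) (x : F.obj) :
    G.p.map ((natTrans α).app x) = eqToHom ((hom_obj u₁ x).symm.trans (hom_obj u₂ x)) := by
  have h : G.p.IsHomLift (𝟙 (F.p.obj x)) ((natTrans α).app x) := BasedNatTrans.isHomLift' α x
  simpa using IsHomLift.fac' G.p (𝟙 (F.p.obj x)) ((natTrans α).app x)

/-- A vertical natural transformation. -/
def verticalMk {F G : FibCat E} {u₁ u₂ : F ⟶ G} (α : Hom.functor u₁ ⟶ Hom.functor u₂)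
    (h : ∀ x, G.p.map (α.app x) = eqToHom ((hom_obj u₁ x).symm.trans (hom_obj u₂ x))) :
    u₁ ⟶ u₂ :=
  BasedNatTrans.mk α fun x => by
    have hx : F.p.obj x = G.p.obj ((Hom.functor u₁).obj x) := hom_obj u₁ x
    refine IsHomLift.of_fac' (p := G.p) _ _ hx.symm (hom_obj u₂ x).symm ?_
    refine (h x).trans ?_
    simp

variable (E) in
/-- The underlying functors of the objects of `𝒮F`. -/
def cartForget (F : FibCat E) : cartPresheaf F ⟶ overFunctorPresheaf E F.obj where
  app S := Cat.Hom.ofFunctor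
    { obj := fun u₁ : overFib S.unop ⟶ F => Hom.functor u₁
      map := fun {u₁ u₂ : overFib S.unop ⟶ F} (α : u₁ ⟶ u₂) => natTrans α }

theorem cartForget_faithful (F : FibCat E) (S : Eᵒᵖ) :
    ((cartForget E F).app S).toFunctor.Faithful :=
  ⟨fun h => BasedNatTrans.ext _ _ h⟩

theorem cartForget_injective (F : FibCat E) (S : Eᵒᵖ) :
    Function.Injective ((cartForget E F).app S).toFunctor.obj :=
  fun _ _ h => hom_ext h

theorem cartForget_cancel {F : FibCat E} {P : Eᵒᵖ ⥤ Cat.{u, u}} {η θ : P ⟶ cartPresheaf F}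
    (h : η ≫ cartForget E F = θ ≫ cartForget E F) : η = θ := by
  refine NatTrans.ext (funext fun S => Cat.ext ?_)
  have h₁ : (η.app S).toFunctor ⋙ ((cartForget E F).app S).toFunctor =
      (θ.app S).toFunctor ⋙ ((cartForget E F).app S).toFunctor :=
    congrArg (fun ζ : P ⟶ overFunctorPresheaf E F.obj => (ζ.app S).toFunctor) h
  have := cartForget_faithful F S
  exact Functor.ext_of_faithful_comp _
    (fun x => cartForget_injective F S (Functor.congr_obj h₁ x)) h₁

theorem over_isCart {S : E} {x y : Over S} (φ : x ⟶ y) : (Over.forget S).IsCart φ :=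
  Functor.isCart_of_isStronglyCartesian
    (over_isStronglyCartesian φ φ.left (CategoryTheory.IsHomLift.map (Over.forget S) φ))

/-- The cartesian functor given by the restrictions of an object of a fibre. -/
abbrev restrCart {P : Eᵒᵖ ⥤ Cat.{u, u}} {S : E} (x : P.obj (op S)) :
    overFib S ⟶ (grothendieckFunctor E).obj P :=
  homMk (Groth.restrObj x) rfl fun a b φ _ => Groth.isCart_of_isIso_fiber _ (by
    exact isIso_eqToHom (Groth.map_obj_of_eq P (Over.w φ) x))

/-- The unit of the adjunction between `Φ` and `𝒮`. -/
def cartUnit (P : Eᵒᵖ ⥤ Cat.{u, u}) :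
    P ⟶ cartPresheaf ((grothendieckFunctor E).obj P) where
  app S := Cat.Hom.ofFunctor
    { obj := fun x => restrCart x
      map := fun {x y} m => verticalMk ((Groth.restr P S.unop).map m) fun g => rfl
      map_id := fun x => BasedNatTrans.ext _ _ ((Groth.restr P S.unop).map_id x)
      map_comp := fun f g => BasedNatTrans.ext _ _ ((Groth.restr P S.unop).map_comp f g) }
  naturality S T f := Cat.ext (by
    have h₁ := congrArg Cat.Hom.toFunctor ((totalUnit P).naturality f)
    have := cartForget_faithful ((grothendieckFunctor E).obj P) T
    exact Functor.ext_of_faithful_comp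
      ((cartForget E ((grothendieckFunctor E).obj P)).app T).toFunctor
      (fun x => hom_ext (Functor.congr_obj h₁ x)) h₁)

theorem cartForget_naturality {F G : FibCat E} (f : F ⟶ G) :
    (cartFunctor E).map f ≫ cartForget E G =
      cartForget E F ≫ (overFunctor E).map ((forget E).map f) := rfl

theorem counit_map {F : FibCat E} {x y : Groth (cartPresheaf F)} (f : x ⟶ y) :
    (Groth.map (cartForget E F) ⋙ totalCounit F.obj).map f =
      (natTrans (u₁ := x.fiber) (u₂ := overFibMap (Groth.Hom.base f) ≫ y.fiber)
        (Groth.Hom.fiber f)).app (Over.mk (𝟙 x.base)) ≫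
          (Hom.functor y.fiber).map (overToId (Groth.Hom.base f)) := by
  refine congrArg (fun t => t ≫ (Hom.functor y.fiber).map (overToId (Groth.Hom.base f))) ?_
  exact (NatTrans.comp_eqToHom_app (natTrans (u₁ := x.fiber)
    (u₂ := overFibMap (Groth.Hom.base f) ≫ y.fiber) (Groth.Hom.fiber f)) rfl _).trans
      (Category.comp_id _)

theorem isIso_natTrans_app {F G : FibCat E} {u₁ u₂ : F ⟶ G} (α : u₁ ⟶ u₂) (h : IsIso α)
    (x : F.obj) : IsIso ((natTrans α).app x) := by
  refine ⟨(natTrans (CategoryTheory.inv α)).app x, ?_, ?_⟩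
  · exact congrArg (fun β => (natTrans β).app x) (IsIso.hom_inv_id α)
  · exact congrArg (fun β => (natTrans β).app x) (IsIso.inv_hom_id α)

theorem map_comp_map_overToId {F : FibCat E} {S T : E} (u₁ : overFib T ⟶ F) (r : S ⟶ T) {z : F.obj}
    (a : z ⟶ (Hom.functor u₁).obj ((Over.map r).obj (Over.mk (𝟙 S)))) (hz : F.p.obj z = S)
    (ha : F.p.map a = eqToHom (hz.trans (hom_obj u₁ ((Over.map r).obj (Over.mk (𝟙 S)))))) :
    F.p.map (a ≫ (Hom.functor u₁).map (overToId r)) =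
      eqToHom hz ≫ r ≫ eqToHom (hom_obj u₁ (Over.mk (𝟙 T))) := by
  rw [F.p.map_comp, ha, hom_w]
  refine (eqToHom_trans_assoc _ _ _).trans ?_
  rfl

theorem counit_comp_p (F : FibCat E) :
    (Groth.map (cartForget E F) ⋙ totalCounit F.obj) ⋙ F.p = Groth.proj (cartPresheaf F) :=
  CategoryTheory.Functor.ext (fun x => (hom_obj x.fiber (Over.mk (𝟙 x.base))).symm)
    fun x y f => by
      refine (congrArg F.p.map (counit_map f)).trans ?_
      exact map_comp_map_overToId y.fiber (Groth.Hom.base f) _ _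
        (map_natTrans_app (u₁ := x.fiber) (u₂ := overFibMap (Groth.Hom.base f) ≫ y.fiber)
          (Groth.Hom.fiber f) (Over.mk (𝟙 x.base)))

/-- The counit of the adjunction between `Φ` and `𝒮`. -/
def cartCounit (F : FibCat E) : (grothendieckFunctor E).obj (cartPresheaf F) ⟶ F :=
  homMk (Groth.map (cartForget E F) ⋙ totalCounit F.obj) (counit_comp_p F) fun x y φ hφ => by
    have h := Groth.isIso_fiber_of_isCart hφ
    have := isIso_natTrans_app (u₁ := x.fiber) (u₂ := overFibMap (Groth.Hom.base φ) ≫ y.fiber)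
        (Groth.Hom.fiber φ) h (Over.mk (𝟙 x.base))
    have h₁ := (@Functor.isCart_of_isIso _ _ _ _ F.p _ _ _ this).comp
      (Hom.isCart y.fiber (over_isCart (overToId (Groth.Hom.base φ))))
    exact (congrArg F.p.IsCart (counit_map φ)).mpr h₁

variable (E) in
/-- `Φ` is left adjoint to `𝒮`. -/
def cartAdjunction : grothendieckFunctor E ⊣ cartFunctor E where
  unit :=
    { app := cartUnit
      naturality := fun P Q η => cartForget_cancel (totalUnit_naturality η) }
  counit :=
    { app := cartCounit
      naturality := fun F G f => hom_ext (by
        refine (Groth.map_comp_comp ((cartFunctor E).map f) (cartForget E G) (totalCounit G.obj)).trans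
          ?_
        refine (Groth.map_comp_comp (cartForget E F) ((overFunctor E).map ((forget E).map f))
          (totalCounit G.obj)).symm.trans ?_
        exact congrArg (fun X => Groth.map (cartForget E F) ⋙ X)
          (totalCounit_naturality (Hom.functor f))) }
  left_triangle_components P := hom_ext (by
    exact (Groth.map_comp_comp (cartUnit P) (cartForget E _) (totalCounit (Groth P))).trans
      (totalFunctor_left_triangle P))
  right_triangle_components F := cartForget_cancel (by
    have h₁ := congrArg (fun t => cartUnit (cartPresheaf F) ≫ t) (cartForget_naturality (cartCounit F))
    have h₂ := congrArg (fun t => t ≫ (overFunctor E).map (totalCounit F.obj).toCatHom)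
      (totalUnit_naturality (cartForget E F))
    have h₃ := congrArg (fun t => cartForget E F ≫ t) (totalFunctor_right_triangle (E := E) F.obj)
    exact (h₁.trans h₂.symm).trans (h₃.trans ((Category.comp_id _).trans (Category.id_comp _).symm)))

end FibCat

/-! ### The adjunction between `Φ` and `𝒮` is a Quillen equivalence -/

namespace FibCat

variable {E : Type u} [SmallCategory E]

/-- The map to the terminal object of a slice category. -/
abbrev overTo {S : E} (g : Over S) : g ⟶ Over.mk (𝟙 S) := Over.homMk g.hom

theorem natTrans_app_comp {F : FibCat E} {S T : E} {u₁ : overFib S ⟶ F} {u₂ : overFib T ⟶ F}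
    {r : S ⟶ T} (α : u₁ ⟶ overFibMap r ≫ u₂) (g : Over S) :
    (natTrans α).app g ≫ (Hom.functor u₂).map (overTo ((Over.map r).obj g)) =
      (Hom.functor u₁).map (overTo g) ≫ (natTrans α).app (Over.mk (𝟙 S)) ≫
        (Hom.functor u₂).map (overToId r) := by
  have h := (natTrans α).naturality (overTo g)
  refine Eq.trans ?_ ((congrArg (fun t => t ≫ (Hom.functor u₂).map (overToId r)) h).symm.trans
    (Category.assoc _ _ _))
  refine Eq.trans (congrArg (fun t => (natTrans α).app g ≫ t) ?_) (Category.assoc _ _ _).symm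
  refine Eq.trans (congrArg (Hom.functor u₂).map ?_) ((Hom.functor u₂).map_comp _ _)
  ext
  change g.hom ≫ r = g.hom ≫ r
  rfl

theorem natTrans_ext' {F : FibCat E} {S T : E} {u₁ : overFib S ⟶ F} {u₂ : overFib T ⟶ F}
    {r : S ⟶ T} (α α' : u₁ ⟶ overFibMap r ≫ u₂)
    (h : (natTrans α).app (Over.mk (𝟙 S)) ≫ (Hom.functor u₂).map (overToId r) =
      (natTrans α').app (Over.mk (𝟙 S)) ≫ (Hom.functor u₂).map (overToId r)) : α = α' := by
  refine BasedNatTrans.ext _ _ (NatTrans.ext (funext fun g => ?_))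
  refine (Hom.isCart u₂ (over_isCart (overTo ((Over.map r).obj g)))).ext
    ((map_natTrans_app α g).trans (map_natTrans_app α' g).symm) ?_
  refine (natTrans_app_comp α g).trans (Eq.trans ?_ (natTrans_app_comp α' g).symm)
  rw [h]

theorem eq_of_conj_eqToHom {C : Type*} [Category* C] {a b c d : C} (h : a = b) (h' : c = d)
    {f g : b ⟶ c} (w : eqToHom h ≫ f ≫ eqToHom h' = eqToHom h ≫ g ≫ eqToHom h') : f = g := by
  subst h h'
  simpa using w

theorem conj_conj_eqToHom {C : Type*} [Category* C] {a b c d : C} (h : a = b) (h' : b = a)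
    (h₁ : c = d) (h₂ : d = c) (f : a ⟶ c) :
    eqToHom h ≫ (eqToHom h' ≫ f ≫ eqToHom h₁) ≫ eqToHom h₂ = f := by
  subst h h₁
  simp

theorem exists_natTrans {F : FibCat E} {S T : E} {u₁ : overFib S ⟶ F} {u₂ : overFib T ⟶ F}
    (r : S ⟶ T) (m : (Hom.functor u₁).obj (Over.mk (𝟙 S)) ⟶ (Hom.functor u₂).obj (Over.mk (𝟙 T)))
    (hm : F.p.map m = eqToHom (hom_obj u₁ (Over.mk (𝟙 S))).symm ≫ r ≫
      eqToHom (hom_obj u₂ (Over.mk (𝟙 T)))) :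
    ∃ α : u₁ ⟶ overFibMap r ≫ u₂,
      (natTrans α).app (Over.mk (𝟙 S)) ≫ (Hom.functor u₂).map (overToId r) = m := by
  have hc : ∀ g : Over S, F.p.IsCart ((Hom.functor u₂).map (overTo ((Over.map r).obj g))) :=
    fun g => Hom.isCart u₂ (over_isCart _)
  have h : ∀ g : Over S, ∃ χ : (Hom.functor u₁).obj g ⟶
      (Hom.functor u₂).obj ((Over.map r).obj g),
      F.p.map χ = eqToHom ((hom_obj u₁ g).symm.trans (hom_obj u₂ ((Over.map r).obj g))) ∧
      χ ≫ (Hom.functor u₂).map (overTo ((Over.map r).obj g)) =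
        (Hom.functor u₁).map (overTo g) ≫ m := fun g => by
    refine (hc g _ _ ?_).exists
    rw [F.p.map_comp, hm, hom_w, hom_w]
    simp only [← Category.assoc, eqToHom_trans]
    simp only [Category.assoc, eqToHom_trans_assoc, eqToHom_refl, Category.id_comp]
    exact congrArg (fun t => eqToHom _ ≫ t) (Category.assoc g.hom r _)
  choose χ hχ hχ' using h
  have nat : ∀ (g g' : Over S) (k : g ⟶ g'), (Hom.functor u₁).map k ≫ χ g' =
      χ g ≫ (Hom.functor u₂).map ((Over.map r).map k) := fun g g' k => (hc g').ext
    (by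
      rw [F.p.map_comp, F.p.map_comp, hχ, hχ, hom_w, hom_w]
      simp only [Category.assoc, eqToHom_trans]
      refine Eq.trans ?_ (eqToHom_trans_assoc _ _ _).symm
      rfl)
    (by
      rw [Category.assoc, Category.assoc, hχ', ← Category.assoc, ← (Hom.functor u₁).map_comp,
        ← (Hom.functor u₂).map_comp]
      refine Eq.trans ?_ ((hχ' g).symm.trans (congrArg (fun t => χ g ≫ (Hom.functor u₂).map t) ?_))
      · congr 2
        ext
        simp
      · ext
        simp)
  refine ⟨verticalMk (u₂ := overFibMap r ≫ u₂)
    { app := χ, naturality := fun g g' k => nat g g' k } hχ, ?_⟩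
  · have h₁ := hχ' (Over.mk (𝟙 S))
    have h₂ : overTo (Over.mk (𝟙 S)) = 𝟙 (Over.mk (𝟙 S)) := by
      ext
      simp
    have h₃ : overTo ((Over.map r).obj (Over.mk (𝟙 S))) = overToId r := by
      ext
      simp
    rw [h₂, h₃, (Hom.functor u₁).map_id] at h₁
    exact h₁.trans (Category.id_comp m)

theorem exists_overFib_hom {F : FibCat E} (x : F.obj) : ∃ u₁ : overFib (F.p.obj x) ⟶ F,
    Nonempty ((Hom.functor u₁).obj (Over.mk (𝟙 (F.p.obj x))) ≅ x) := by
  have h := fun g : Over (F.p.obj x) => F.p.exists_isCart x g.hom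
  choose y φ hy hφ hc using h
  have h : ∀ (g g' : Over (F.p.obj x)) (k : g ⟶ g'), ∃ χ : y g ⟶ y g',
      F.p.map χ = eqToHom (hy g) ≫ k.left ≫ eqToHom (hy g').symm ∧ χ ≫ φ g' = φ g := fun g g' k => by
    refine (hc _ _ _ ?_).exists
    rw [hφ, hφ]
    simp
  choose χ hχ hχ' using h
  let A : Over (F.p.obj x) ⥤ F.obj :=
    { obj := y
      map := fun k => χ _ _ k
      map_id := fun g => (hc g).ext (by simp [hχ]) (by simp [hχ'])
      map_comp := fun a b => (hc _).ext (by simp [hχ]) (by simp [hχ']) }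
  refine ⟨homMk A (CategoryTheory.Functor.ext hy fun g g' k => hχ _ _ k) fun g g' k _ => ?_, ⟨?_⟩⟩
  · refine (hc g').of_comp ?_
    change F.p.IsCart (χ _ _ k ≫ φ g')
    rw [hχ']
    exact hc g
  · have h₁ := hφ (Over.mk (𝟙 (F.p.obj x)))
    have : IsIso (F.p.map (φ (Over.mk (𝟙 (F.p.obj x))))) := by
      rw [h₁]
      change IsIso (eqToHom _ ≫ 𝟙 _)
      infer_instance
    have := (hc (Over.mk (𝟙 (F.p.obj x)))).isIso
    exact asIso (φ (Over.mk (𝟙 (F.p.obj x))))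

theorem cartCounit_isEquivalence (F : FibCat E) : (Hom.functor (cartCounit F)).IsEquivalence where
  faithful := ⟨fun {x y f g} h => by
    obtain ⟨r, α⟩ := f
    obtain ⟨r', α'⟩ := g
    have h₁ := (hom_w (cartCounit F) _).symm.trans ((congrArg F.p.map h).trans
      (hom_w (cartCounit F) _))
    obtain rfl : r = r' := eq_of_conj_eqToHom _ _ h₁
    refine (Groth.hom_ext_iff _ _ _).2 (natTrans_ext' (u₁ := x.fiber) (u₂ := y.fiber) α α' ?_)
    exact (counit_map _).symm.trans (h.trans (counit_map _))⟩
  full := ⟨fun {x y} m => by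
    let m' : (Hom.functor x.fiber).obj (Over.mk (𝟙 x.base)) ⟶
      (Hom.functor y.fiber).obj (Over.mk (𝟙 y.base)) := m
    obtain ⟨α, hα⟩ := exists_natTrans (u₁ := x.fiber) (u₂ := y.fiber)
      (eqToHom (hom_obj x.fiber (Over.mk (𝟙 x.base))) ≫ F.p.map m' ≫
        eqToHom (hom_obj y.fiber (Over.mk (𝟙 y.base))).symm) m' (conj_conj_eqToHom _ _ _ _ _).symm
    exact ⟨Groth.Hom.mk _ α, (counit_map _).trans hα⟩⟩
  essSurj := ⟨fun x => by
    obtain ⟨u₁, ⟨e⟩⟩ := exists_overFib_hom x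
    exact ⟨⟨F.p.obj x, u₁⟩, ⟨e⟩⟩⟩

theorem weq_of_isIso {F G : FibCat E} (f : F ⟶ G) [IsIso f] : (modelData E).weq f :=
  have h : (modelData E).weq (𝟙 F) := inferInstanceAs (𝟭 F.obj).IsEquivalence
  ((modelData E).weq.arrow_mk_iso_iff (Arrow.isoMk (Iso.refl F) (asIso f))).1 h

theorem weq_counit (adj : grothendieckFunctor E ⊣ cartFunctor E) (F : FibCat E) :
    (modelData E).weq (adj.counit.app F) := by
  rw [← Adjunction.rightAdjointUniq_hom_app_counit adj (cartAdjunction E)]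
  exact (modelData E).weq.comp_mem _ _ (weq_of_isIso _) (cartCounit_isEquivalence F)

theorem weq_iff_of_adj (adj : grothendieckFunctor E ⊣ cartFunctor E) {P : Eᵒᵖ ⥤ Cat.{u, u}}
    {F : FibCat E} (f : (grothendieckFunctor E).obj P ⟶ F) :
    (modelData E).weq f ↔ objectwiseEquivalences E (adj.homEquiv P F f) := by
  have h := adj.homEquiv_counit (g := adj.homEquiv P F f)
  rw [Equiv.symm_apply_apply] at h
  refine (iff_of_eq (congrArg (fun t => (modelData E).weq t) h)).trans ?_
  refine Iff.trans ⟨fun h => ?_, fun h => ?_⟩ Groth.isEquivalence_map_iff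
  · exact (modelData E).weq.of_postcomp _ _ (weq_counit adj F) h
  · exact (modelData E).weq.comp_mem _ _ h (weq_counit adj F)

theorem isQuillenEquivalence_cart (adj : grothendieckFunctor E ⊣ cartFunctor E) :
    IsQuillenEquivalence (injectiveModelData E) (modelData E) adj where
  map_cof _ _ _ h := Groth.map_injective h
  map_trivialCof _ _ _ h := ⟨Groth.map_injective h.1, Groth.isEquivalence_map h.2⟩
  weq_iff _ _ _ _ f := weq_iff_of_adj adj f

end FibCat

/-! ### The adjunction between `L` and `Φ` -/

namespace FibCat

variable {E : Type u} [SmallCategory E]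

theorem locRes_map {F : FibCat E} {S T : E} (f : S ⟶ T) {z w : StructuredArrow T F.p} (m : z ⟶ w) :
    (locRes F f).map ((underCartesian F T).Q.map m) =
      (underCartesian F S).Q.map ((StructuredArrow.map f).map m) :=
  eq_of_heq (CategoryTheory.Functor.hcongr_hom (Q_locRes F f) m)

theorem locMap_map {F G : FibCat E} (u₁ : F ⟶ G) {S : E} {z w : StructuredArrow S F.p} (m : z ⟶ w) :
    (locMap u₁ S).map ((underCartesian F S).Q.map m) =
      (underCartesian G S).Q.map ((underMap u₁ S).map m) :=
  eq_of_heq (CategoryTheory.Functor.hcongr_hom (Q_locMap u₁ S) m)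

/-- The object of `Groth (locPresheaf F)` given by an object under `S`. -/
abbrev locObj {F : FibCat E} {S : E} (z : StructuredArrow S F.p) : Groth (locPresheaf F) :=
  ⟨S, (underCartesian F S).Q.obj z⟩

/-- A map of `Groth (locPresheaf F)`. -/
abbrev locHom {F : FibCat E} {S T : E} (z : StructuredArrow S F.p) (w : StructuredArrow T F.p)
    (r : S ⟶ T) (m : z.right ⟶ w.right) (h : z.hom ≫ F.p.map m = r ≫ w.hom) :
    locObj z ⟶ locObj w :=
  Groth.Hom.mk r ((underCartesian F S).Q.map
    (StructuredArrow.homMk m h : z ⟶ (StructuredArrow.map r).obj w))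

theorem right_comp_eqToHom {F : FibCat E} {S : E} {z : StructuredArrow S F.p} {y : F.obj}
    {a a' : S ⟶ F.p.obj y} (m : z ⟶ StructuredArrow.mk a) (e : a = a')
    (h : StructuredArrow.mk a = StructuredArrow.mk a') : (m ≫ eqToHom h).right = m.right := by
  subst e
  simp

theorem right_comp_comp_eqToHom {F : FibCat E} {S : E} {z w : StructuredArrow S F.p} {y : F.obj}
    {a a' : S ⟶ F.p.obj y} (n : z ⟶ w) (m : w ⟶ StructuredArrow.mk a) (e : a = a')
    (h : StructuredArrow.mk a = StructuredArrow.mk a') :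
    (n ≫ m ≫ eqToHom h).right = n.right ≫ m.right := by
  subst e
  simp

theorem Q_conj {F : FibCat E} {S : E} {x y : F.obj} {a a' : S ⟶ F.p.obj x}
    {b b' b'' : S ⟶ F.p.obj y} (m' : StructuredArrow.mk a' ⟶ StructuredArrow.mk b')
    (m : StructuredArrow.mk a ⟶ StructuredArrow.mk b) (ea : a = a') (eb : b' = b'') (eb' : b'' = b)
    (hm : m'.right = m.right)
    (h₁ : (underCartesian F S).Q.obj (StructuredArrow.mk b') =
      (underCartesian F S).Q.obj (StructuredArrow.mk b''))
    (h₂ : (underCartesian F S).Q.obj (StructuredArrow.mk a') =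
      (underCartesian F S).Q.obj (StructuredArrow.mk a))
    (h₃ : (underCartesian F S).Q.obj (StructuredArrow.mk b) =
      (underCartesian F S).Q.obj (StructuredArrow.mk b'')) :
    (underCartesian F S).Q.map m' ≫ eqToHom h₁ =
      eqToHom h₂ ≫ (underCartesian F S).Q.map m ≫ eqToHom h₃ := by
  subst ea eb eb'
  obtain rfl : m' = m := StructuredArrow.ext _ _ hm
  simp

theorem locHom_id {F : FibCat E} {S : E} (z : StructuredArrow S F.p) :
    locHom z z (𝟙 S) (𝟙 _) (by simp) = 𝟙 (locObj z) := by
  refine (Groth.hom_ext_iff _ _ _).2 ?_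
  have h : z = (StructuredArrow.map (𝟙 S)).obj z := StructuredArrow.map_id.symm
  refine Eq.trans (congrArg (underCartesian F S).Q.map ?_) (eqToHom_map (underCartesian F S).Q h)
  ext
  simp

theorem locHom_comp {F : FibCat E} {S T U : E} (z : StructuredArrow S F.p)
    (w : StructuredArrow T F.p) (y : StructuredArrow U F.p) (r : S ⟶ T) (m : z.right ⟶ w.right)
    (h : z.hom ≫ F.p.map m = r ≫ w.hom) (r' : T ⟶ U) (m' : w.right ⟶ y.right)
    (h' : w.hom ≫ F.p.map m' = r' ≫ y.hom) :
    locHom z w r m h ≫ locHom w y r' m' h' =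
      locHom z y (r ≫ r') (m ≫ m') (by simp [reassoc_of% h, h']) := by
  refine (Groth.hom_ext_iff _ _ _).2 ?_
  have e : (StructuredArrow.map r).obj ((StructuredArrow.map r').obj y) =
    (StructuredArrow.map (r ≫ r')).obj y := StructuredArrow.map_comp.symm
  refine (congrArg (fun t => (underCartesian F S).Q.map _ ≫ t ≫
    eqToHom (congrArg (underCartesian F S).Q.obj e)) (locRes_map r _)).trans ?_
  rw [← eqToHom_map (underCartesian F S).Q e]
  refine Eq.trans (congrArg (fun t => _ ≫ t) ((underCartesian F S).Q.map_comp _ _).symm)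
    (((underCartesian F S).Q.map_comp _ _).symm.trans (congrArg (underCartesian F S).Q.map ?_))
  ext
  exact right_comp_comp_eqToHom _ _ (Category.assoc _ _ _).symm e

theorem locHom_congr {F : FibCat E} {S T : E} {z : StructuredArrow S F.p}
    {w : StructuredArrow T F.p} {r r' : S ⟶ T} {m m' : z.right ⟶ w.right}
    (hr : r = r') (hm : m = m') (h : z.hom ≫ F.p.map m = r ≫ w.hom)
    (h' : z.hom ≫ F.p.map m' = r' ≫ w.hom) : locHom z w r m h = locHom z w r' m' h' := by
  subst hr hm
  rfl

theorem locObj_eq {F : FibCat E} {S T : E} {x : F.obj} {a : S ⟶ F.p.obj x} {a' : T ⟶ F.p.obj x}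
    (h : S = T) (e : a = eqToHom h ≫ a') :
    locObj (StructuredArrow.mk a) = locObj (StructuredArrow.mk a') := by
  subst h
  simp [e]

theorem conj_locHom {F : FibCat E} {S S' T T' : E} {x y : F.obj} {a : S ⟶ F.p.obj x}
    {a' : S' ⟶ F.p.obj x} {b : T ⟶ F.p.obj y} {b' : T' ⟶ F.p.obj y} (hS : S = S') (hT : T' = T)
    (ea : a = eqToHom hS ≫ a') (eb : b' = eqToHom hT ≫ b) {r : S ⟶ T} {r' : S' ⟶ T'} {m : x ⟶ y}
    (hr : r = eqToHom hS ≫ r' ≫ eqToHom hT) (h : a ≫ F.p.map m = r ≫ b)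
    (h' : a' ≫ F.p.map m = r' ≫ b') :
    locHom (StructuredArrow.mk a) (StructuredArrow.mk b) r m h =
      eqToHom (locObj_eq hS ea) ≫
        locHom (StructuredArrow.mk a') (StructuredArrow.mk b') r' m h' ≫
          eqToHom (locObj_eq hT eb) := by
  subst hS hT
  obtain rfl : a = a' := by simpa using ea
  obtain rfl : b' = b := by simpa using eb
  obtain rfl : r = r' := by simpa using hr
  exact ((Category.id_comp _).trans (Category.comp_id _)).symm

/-- The functor underlying the unit of the adjunction between `L` and `Φ`. -/
noncomputable def locUnitFunctor (F : FibCat E) : F.obj ⥤ Groth (locPresheaf F) where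
  obj x := locObj (StructuredArrow.mk (𝟙 (F.p.obj x)))
  map {x y} φ := locHom (StructuredArrow.mk (𝟙 (F.p.obj x))) (StructuredArrow.mk (𝟙 (F.p.obj y)))
    (F.p.map φ) φ (by simp)
  map_id x := (locHom_congr (F.p.map_id x) rfl _ _).trans (locHom_id _)
  map_comp φ ψ := (locHom_congr (F.p.map_comp φ ψ) rfl _ (by simp)).trans
    (locHom_comp (StructuredArrow.mk (𝟙 _)) (StructuredArrow.mk (𝟙 _)) (StructuredArrow.mk (𝟙 _))
      (F.p.map φ) φ (by simp) (F.p.map ψ) ψ (by simp)).symm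

/-- The unit of the adjunction between `L` and `Φ`. -/
noncomputable def locUnit (F : FibCat E) : F ⟶ (grothendieckFunctor E).obj (locPresheaf F) :=
  homMk (locUnitFunctor F) rfl fun x y φ h => Groth.isCart_of_isIso_fiber _
    ((underCartesian F _).Q_inverts
      (StructuredArrow.homMk φ (by simp) : StructuredArrow.mk (𝟙 (F.p.obj x)) ⟶
        (StructuredArrow.map (F.p.map φ)).obj (StructuredArrow.mk (𝟙 (F.p.obj y))))
      (Functor.isCartesian_map_iff.2 h))

theorem map_locHom {F G : FibCat E} (u₁ : F ⟶ G) {S T : E} (z : StructuredArrow S F.p)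
    (w : StructuredArrow T F.p) (r : S ⟶ T) (m : z.right ⟶ w.right)
    (h : z.hom ≫ F.p.map m = r ≫ w.hom) :
    (Groth.map ((locFunctor E).map u₁)).map (locHom z w r m h) =
      locHom ((underMap u₁ S).obj z) ((underMap u₁ T).obj w) r ((Hom.functor u₁).map m) (by
        have := ((underMap u₁ S).map (StructuredArrow.homMk m h : z ⟶ (StructuredArrow.map r).obj w)).w
        simpa [underMap] using this) := by
  refine (Groth.hom_ext_iff _ _ _).2 ?_
  have e : (underMap u₁ S).obj ((StructuredArrow.map r).obj w) =
    (StructuredArrow.map r).obj ((underMap u₁ T).obj w) :=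
    (Functor.congr_obj (underMap_map u₁ r) w).symm
  refine (congrArg (fun t => t ≫ eqToHom (congrArg (underCartesian G S).Q.obj e))
    (locMap_map u₁ _)).trans ?_
  rw [← eqToHom_map (underCartesian G S).Q e]
  refine ((underCartesian G S).Q.map_comp _ _).symm.trans (congrArg (underCartesian G S).Q.map ?_)
  ext
  exact right_comp_eqToHom _ (Category.assoc _ _ _) e

theorem conj_congr {C : Type*} [Category* C] {a b c d : C} {f g : b ⟶ c} (h : f = g) (k : a ⟶ b)
    (l : c ⟶ d) : k ≫ f ≫ l = k ≫ g ≫ l := by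
  rw [h]

theorem locUnit_naturality {F G : FibCat E} (u₁ : F ⟶ G) :
    u₁ ≫ locUnit G = locUnit F ≫ (grothendieckFunctor E).map ((locFunctor E).map u₁) := by
  refine hom_ext ?_
  have h₁ : ∀ x, 𝟙 (G.p.obj ((Hom.functor u₁).obj x)) =
      eqToHom (hom_obj u₁ x).symm ≫ 𝟙 (F.p.obj x) ≫ eqToHom (hom_obj u₁ x) := by simp
  have h₂ : ∀ x, 𝟙 (F.p.obj x) ≫ eqToHom (hom_obj u₁ x) =
      eqToHom (hom_obj u₁ x) ≫ 𝟙 (G.p.obj ((Hom.functor u₁).obj x)) := by simp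
  exact CategoryTheory.Functor.ext
    (fun x => locObj_eq (hom_obj u₁ x).symm (h₁ x))
    fun x y φ => (conj_locHom (hom_obj u₁ x).symm (hom_obj u₁ y) (h₁ x) (h₂ y) (hom_w u₁ φ)
      (by simp) (by rw [hom_w]; simp)).trans
        (conj_congr (map_locHom u₁ (StructuredArrow.mk (𝟙 (F.p.obj x)))
          (StructuredArrow.mk (𝟙 (F.p.obj y))) (F.p.map φ) φ (by simp)).symm _ _)

end FibCat

namespace Groth

variable {E : Type u} [SmallCategory E] {P Q : Eᵒᵖ ⥤ Cat.{u, u}}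

theorem map_eqToHom_comp_eqToHom {A B : Type*} [Category* A] [Category* B] (F : A ⥤ B) {x y : A}
    (h : x = y) (h' : F.obj y = F.obj x) : F.map (eqToHom h) ≫ eqToHom h' = 𝟙 _ := by
  subst h
  simp

theorem pull_comp {S T U V : E} {a : S ⟶ T} {r : T ⟶ U} {a' : S ⟶ U} {r' : U ⟶ V} {a'' : S ⟶ V}
    (w : a ≫ r = a') (w' : a' ≫ r' = a'') {x : P.obj (op T)} {y : P.obj (op U)} {z : P.obj (op V)}
    (m : x ⟶ (P.map r.op).toFunctor.obj y) (n : y ⟶ (P.map r'.op).toFunctor.obj z)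
    (h₀ : (P.map a.op).toFunctor.obj ((P.map (r ≫ r').op).toFunctor.obj z) =
      (P.map a''.op).toFunctor.obj z)
    (h₁ : (P.map a.op).toFunctor.obj ((P.map r.op).toFunctor.obj y) =
      (P.map a'.op).toFunctor.obj y)
    (h₂ : (P.map a'.op).toFunctor.obj ((P.map r'.op).toFunctor.obj z) =
      (P.map a''.op).toFunctor.obj z) :
    (P.map a.op).toFunctor.map (m ≫ (P.map r.op).toFunctor.map n ≫
      eqToHom (map_comp_obj P r r' z)) ≫ eqToHom h₀ =
        ((P.map a.op).toFunctor.map m ≫ eqToHom h₁) ≫ (P.map a'.op).toFunctor.map n ≫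
          eqToHom h₂ := by
  subst w w'
  rw [map_map_of_eq P rfl]
  simp [eqToHom_map]

theorem map_pull_aux {S T U V : E} (f : S ⟶ T) (a : T ⟶ U) {x : P.obj (op U)} {r : U ⟶ V}
    {a' : T ⟶ V} {y : P.obj (op V)} (m : x ⟶ (P.map r.op).toFunctor.obj y)
    (h₁ : (P.map (f ≫ a).op).toFunctor.obj ((P.map r.op).toFunctor.obj y) =
      (P.map (f ≫ a').op).toFunctor.obj y)
    (h₂ : (P.map (f ≫ a).op).toFunctor.obj x =
      (P.map f.op).toFunctor.obj ((P.map a.op).toFunctor.obj x))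
    (h₃ : (P.map a.op).toFunctor.obj ((P.map r.op).toFunctor.obj y) =
      (P.map a'.op).toFunctor.obj y)
    (h₄ : (P.map f.op).toFunctor.obj ((P.map a'.op).toFunctor.obj y) =
      (P.map (f ≫ a').op).toFunctor.obj y) :
    (P.map (f ≫ a).op).toFunctor.map m ≫ eqToHom h₁ =
      eqToHom h₂ ≫ (P.map f.op).toFunctor.map ((P.map a.op).toFunctor.map m ≫ eqToHom h₃) ≫
        eqToHom h₄ := by
  rw [map_map_of_eq P rfl]
  simp [eqToHom_map]

theorem underMap_pull_obj (η : P ⟶ Q) {S T : E} {a a₀ : S ⟶ T} (h : a₀ = a) (x : P.obj (op T)) :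
    (Q.map a₀.op).toFunctor.obj ((η.app (op T)).toFunctor.obj x) =
      (η.app (op S)).toFunctor.obj ((P.map a.op).toFunctor.obj x) := by
  subst h
  exact (congrArg (fun F => F.toFunctor.obj x) (η.naturality a₀.op)).symm

theorem underMap_pull_aux (η : P ⟶ Q) {S T U : E} {a a₀ : S ⟶ T} (h : a₀ = a) {r : T ⟶ U}
    {x : P.obj (op T)} {y : P.obj (op U)} (m : x ⟶ (P.map r.op).toFunctor.obj y)
    {q : Q.obj (op S)} {z : P.obj (op S)}
    (h₀ : (η.app (op T)).toFunctor.obj ((P.map r.op).toFunctor.obj y) =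
      (Q.map r.op).toFunctor.obj ((η.app (op U)).toFunctor.obj y))
    (h₁ : (Q.map a₀.op).toFunctor.obj ((Q.map r.op).toFunctor.obj
      ((η.app (op U)).toFunctor.obj y)) = q)
    (h₂ : (Q.map a₀.op).toFunctor.obj ((η.app (op T)).toFunctor.obj x) =
      (η.app (op S)).toFunctor.obj ((P.map a.op).toFunctor.obj x))
    (h₃ : (P.map a.op).toFunctor.obj ((P.map r.op).toFunctor.obj y) = z)
    (h₄ : (η.app (op S)).toFunctor.obj z = q) :
    (Q.map a₀.op).toFunctor.map ((η.app (op T)).toFunctor.map m ≫ eqToHom h₀) ≫ eqToHom h₁ =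
      eqToHom h₂ ≫ (η.app (op S)).toFunctor.map ((P.map a.op).toFunctor.map m ≫ eqToHom h₃) ≫
        eqToHom h₄ := by
  subst h h₁ h₃
  simp [eqToHom_map, naturality_map]

variable (P) in
/-- The functor which takes `(x, a : S ⟶ T)`, with `x` in `P(T)`, to the restriction of `x`
along `a`. -/
@[simps]
def pull (S : E) : StructuredArrow S (proj P) ⥤ P.obj (op S) where
  obj z := (P.map (Quiver.Hom.op (V := E) (X := S) (Y := z.right.base) z.hom)).toFunctor.obj
    z.right.fiber
  map {z w} m := (P.map (Quiver.Hom.op (V := E) (X := S) (Y := z.right.base) z.hom)).toFunctor.map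
    (Hom.fiber m.right) ≫ eqToHom (map_obj_of_eq P (StructuredArrow.w m) w.right.fiber).symm
  map_id z := map_eqToHom_comp_eqToHom _ (map_id_obj P z.right.fiber) _
  map_comp f g := pull_comp (StructuredArrow.w f) (StructuredArrow.w g) _ _ _ _ _

theorem pull_inverts (P : Eᵒᵖ ⥤ Cat.{u, u}) (S : E) :
    (underCartesian ((grothendieckFunctor E).obj P) S).IsInvertedBy (pull P S) :=
  fun z w m h => by
    have := isIso_fiber_of_isCart ((Functor.isCartesian_map_iff
      (p := ((grothendieckFunctor E).obj P).p)).1 h)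
    exact isIso_comp_eqToHom _ (Functor.map_isIso _ _) _

theorem map_pull {S T : E} (f : S ⟶ T) :
    StructuredArrow.map f ⋙ pull P S = pull P T ⋙ (P.map f.op).toFunctor :=
  CategoryTheory.Functor.ext (fun z => (map_comp_obj P f z.hom z.right.fiber).symm)
    fun z _ m => map_pull_aux f z.hom (Hom.fiber m.right) _ _ _ _

theorem underMap_pull (η : P ⟶ Q) (S : E) :
    FibCat.underMap ((grothendieckFunctor E).map η) S ⋙ pull Q S =
      pull P S ⋙ (η.app (op S)).toFunctor :=
  CategoryTheory.Functor.ext (fun z => underMap_pull_obj η (Category.comp_id z.hom) z.right.fiber)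
    fun z _ m => underMap_pull_aux η (Category.comp_id z.hom) (Hom.fiber m.right) _ _ _ _ _

variable (P) in
/-- The extension of `pull P S` to the localization. -/
noncomputable def pullLift (S : E) : UnderLoc ((grothendieckFunctor E).obj P) S ⥤ P.obj (op S) :=
  Localization.Construction.lift (pull P S) (pull_inverts P S)

variable (P) in
theorem Q_pullLift (S : E) : (underCartesian ((grothendieckFunctor E).obj P) S).Q ⋙ pullLift P S =
    pull P S :=
  Localization.Construction.fac _ (pull_inverts P S)

theorem locRes_pullLift {S T : E} (f : S ⟶ T) :
    FibCat.locRes ((grothendieckFunctor E).obj P) f ⋙ pullLift P S =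
      pullLift P T ⋙ (P.map f.op).toFunctor := by
  apply Localization.Construction.uniq
  rw [← Functor.assoc, ← Functor.assoc, Q_pullLift, FibCat.Q_locRes]
  exact (congrArg (fun X => StructuredArrow.map f ⋙ X) (Q_pullLift P S)).trans (map_pull f)

theorem locMap_pullLift (η : P ⟶ Q) (S : E) :
    FibCat.locMap ((grothendieckFunctor E).map η) S ⋙ pullLift Q S =
      pullLift P S ⋙ (η.app (op S)).toFunctor := by
  apply Localization.Construction.uniq
  rw [← Functor.assoc, ← Functor.assoc, Q_pullLift, FibCat.Q_locMap]
  exact (congrArg (fun X => FibCat.underMap ((grothendieckFunctor E).map η) S ⋙ X)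
    (Q_pullLift Q S)).trans (underMap_pull η S)

variable (P) in
/-- The counit of the adjunction between `L` and `Φ`. -/
noncomputable def locCounit : locPresheaf ((grothendieckFunctor E).obj P) ⟶ P where
  app S := Cat.Hom.ofFunctor (pullLift P S.unop)
  naturality _ _ f := Cat.ext (locRes_pullLift f.unop)

theorem pullLift_map {S : E} {z w : StructuredArrow S (proj P)} (m : z ⟶ w) :
    (pullLift P S).map ((underCartesian ((grothendieckFunctor E).obj P) S).Q.map m) =
      (pull P S).map m :=
  eq_of_heq (CategoryTheory.Functor.hcongr_hom (Q_pullLift P S) m)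

theorem underMap_locUnit_pull (F : FibCat E) (S : E) :
    FibCat.underMap (FibCat.locUnit F) S ⋙ pull (locPresheaf F) S = (underCartesian F S).Q :=
  CategoryTheory.Functor.ext (fun z => congrArg (underCartesian F S).Q.obj (by
      change StructuredArrow.mk ((z.hom ≫ 𝟙 _) ≫ 𝟙 _) = z
      rw [Category.comp_id, Category.comp_id]
      exact (StructuredArrow.eq_mk z).symm))
    fun z w m => by
      have e : ∀ z : StructuredArrow S F.p, (z.hom ≫ 𝟙 _) ≫ 𝟙 _ = z.hom := fun z => by simp
      refine (congrArg (fun t => t ≫ eqToHom _) (FibCat.locRes_map (z.hom ≫ 𝟙 _) _)).trans ?_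
      exact FibCat.Q_conj (a := z.hom) (b := w.hom) (a' := (z.hom ≫ 𝟙 _) ≫ 𝟙 _)
        (b' := (z.hom ≫ 𝟙 _) ≫ F.p.map m.right ≫ 𝟙 _) (b'' := (w.hom ≫ 𝟙 _) ≫ 𝟙 _)
        ((StructuredArrow.map (z.hom ≫ 𝟙 _)).map (StructuredArrow.homMk m.right (by simp) :
          StructuredArrow.mk (𝟙 (F.p.obj z.right)) ⟶ (StructuredArrow.map (F.p.map m.right)).obj
            (StructuredArrow.mk (𝟙 (F.p.obj w.right)))))
        m (e z).symm (by simp) (e w) rfl _ _ _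

theorem locUnit_locCounit :
    FibCat.locUnitFunctor ((grothendieckFunctor E).obj P) ⋙ map (locCounit P) = 𝟭 _ :=
  CategoryTheory.Functor.ext (fun x => congrArg (Groth.mk x.base) (map_id_obj P x.fiber).symm)
    fun x y f => by
      refine Eq.trans ((hom_ext_iff _ _ _).2 ?_) (conj_eqToHom (map_id_obj P x.fiber).symm
        (map_id_obj P y.fiber) (Hom.base f) (Hom.fiber f)).symm
      refine (congrArg (fun t => t ≫ eqToHom _) (pullLift_map _)).trans ?_
      exact map_id_comp_eqToHom (P := P) (Hom.fiber f) _ _ _ _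

end Groth

namespace FibCat

variable {E : Type u} [SmallCategory E]

variable (E) in
/-- `L` is left adjoint to `Φ`. -/
noncomputable def locAdjunction : locFunctor E ⊣ grothendieckFunctor E where
  unit :=
    { app := locUnit
      naturality := fun _ _ u₁ => locUnit_naturality u₁ }
  counit :=
    { app := Groth.locCounit
      naturality := fun P Q η =>
        NatTrans.ext (funext fun S => Cat.ext (Groth.locMap_pullLift η S.unop)) }
  left_triangle_components F := NatTrans.ext (funext fun S => Cat.ext (by
    change locMap (locUnit F) S.unop ⋙ Groth.pullLift (locPresheaf F) S.unop = 𝟭 _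
    apply Localization.Construction.uniq
    rw [← Functor.assoc, Q_locMap]
    exact (congrArg (fun X => underMap (locUnit F) S.unop ⋙ X)
      (Groth.Q_pullLift (locPresheaf F) S.unop)).trans (Groth.underMap_locUnit_pull F S.unop)))
  right_triangle_components P := hom_ext Groth.locUnit_locCounit

end FibCat

/-! ### The adjunction between `L` and `Φ` is a Quillen equivalence -/

namespace CategoryTheory.Localization.Construction

variable {C : Type*} [Category* C] {W : MorphismProperty C} {z : C}

theorem exists_map_Q (h : ∀ ⦃x y : C⦄ (s : x ⟶ y), W s → ∀ g : z ⟶ y, ∃ g', g' ≫ s = g) {w : C}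
    (f : W.Q.obj z ⟶ W.Q.obj w) : ∃ g : z ⟶ w, W.Q.map g = f := by
  let P : MorphismProperty W.Localization := fun X Y f =>
    ∀ g : z ⟶ X.as.obj, ∃ g' : z ⟶ Y.as.obj, W.Q.map g ≫ f = W.Q.map g'
  have : P.IsStableUnderComposition := ⟨fun f f' hf hf' g => by
    obtain ⟨g', hg'⟩ := hf g
    obtain ⟨g'', hg''⟩ := hf' g'
    refine ⟨g'', (Category.assoc _ _ _).symm.trans ?_⟩
    exact (congrArg (fun t => t ≫ f') hg').trans hg''⟩
  have hP : P = ⊤ := by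
    refine morphismProperty_eq_top P (fun x y f g => ⟨g ≫ f, (W.Q.map_comp _ _).symm⟩)
      fun x y s hs g => ?_
    obtain ⟨g', rfl⟩ := h s hs g
    refine ⟨g', ?_⟩
    refine (congrArg (fun t => t ≫ wInv s hs) (W.Q.map_comp g' s)).trans ?_
    exact (Category.assoc _ _ _).trans ((congrArg (fun t => W.Q.map g' ≫ t)
      (wIso s hs).hom_inv_id).trans (Category.comp_id _))
  have hf : P f := by
    rw [hP]
    trivial
  obtain ⟨g, hg⟩ := hf (𝟙 z)
  refine ⟨g, hg.symm.trans ?_⟩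
  exact (congrArg (fun t => t ≫ f) (W.Q.map_id z)).trans (Category.id_comp f)

theorem map_Q_injective (h : ∀ ⦃x y : C⦄ (s : x ⟶ y), W s → ∀ g : z ⟶ y, ∃! g', g' ≫ s = g)
    {w : C} {f g : z ⟶ w} (hfg : W.Q.map f = W.Q.map g) : f = g := by
  have hH : W.IsInvertedBy (coyoneda.obj (op z)) := fun x y s hs => by
    refine (isIso_iff_bijective _).2 ⟨fun a b hab => (h s hs _).unique hab rfl, fun b => ?_⟩
    exact (h s hs b).exists
  have h₁ := fac (coyoneda.obj (op z)) hH
  have h₂ := CategoryTheory.Functor.hcongr_hom h₁ f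
  have h₃ := CategoryTheory.Functor.hcongr_hom h₁ g
  have h₄ : (coyoneda.obj (op z)).map f = (coyoneda.obj (op z)).map g := by
    refine eq_of_heq (h₂.symm.trans (HEq.trans (heq_of_eq ?_) h₃))
    exact congrArg (lift (coyoneda.obj (op z)) hH).map hfg
  have h₅ := ConcreteCategory.congr_hom h₄ (𝟙 z)
  simpa using h₅

end CategoryTheory.Localization.Construction

namespace FibCat

variable {E : Type u} [SmallCategory E]

theorem existsUnique_comp_eq {F : FibCat E} (x : F.obj) ⦃z w : StructuredArrow (F.p.obj x) F.p⦄
    (s : z ⟶ w) (hs : underCartesian F _ s) (g : StructuredArrow.mk (𝟙 (F.p.obj x)) ⟶ w) :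
    ∃! g', g' ≫ s = g := by
  have h := Functor.isCartesian_map_iff.1 hs
  obtain ⟨χ, ⟨h₁, h₂⟩, h₃⟩ := h g.right z.hom (by
    have h₄ := StructuredArrow.w s
    have h₅ := StructuredArrow.w g
    rw [h₄, ← h₅]
    exact Category.id_comp _)
  refine ⟨StructuredArrow.homMk χ (by simp [h₁]), by ext; exact h₂, fun χ' hχ' => ?_⟩
  ext
  refine h₃ _ ⟨?_, congrArg (fun t => t.right) hχ'⟩
  simpa using StructuredArrow.w χ'

theorem locUnit_isEquivalence (F : FibCat E) : (Hom.functor (locUnit F)).IsEquivalence where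
  faithful := ⟨fun {x y φ ψ} h => by
    have h₁ : F.p.map φ = F.p.map ψ := congrArg Groth.Hom.base h
    have h₂ : locHom (StructuredArrow.mk (𝟙 (F.p.obj x))) (StructuredArrow.mk (𝟙 (F.p.obj y)))
      (F.p.map φ) φ (by simp) = locHom (StructuredArrow.mk (𝟙 (F.p.obj x)))
        (StructuredArrow.mk (𝟙 (F.p.obj y))) (F.p.map φ) ψ (by simp [h₁]) :=
      h.trans (locHom_congr h₁.symm rfl _ _)
    have h₃ := (Groth.hom_ext_iff _ _ _).1 h₂
    exact congrArg (fun t => t.right)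
      (Localization.Construction.map_Q_injective (existsUnique_comp_eq x) h₃)⟩
  full := ⟨fun {x y} f => by
    obtain ⟨r, m⟩ := f
    obtain ⟨k, rfl⟩ := Localization.Construction.exists_map_Q
      (w := (StructuredArrow.map r).obj (StructuredArrow.mk (𝟙 (F.p.obj y))))
      (fun _ _ s hs g => (existsUnique_comp_eq x s hs g).exists) m
    have hk : F.p.map k.right = r :=
      ((Category.id_comp _).symm.trans (StructuredArrow.w k)).trans (Category.comp_id r)
    exact ⟨k.right, locHom_congr hk rfl
      ((Category.id_comp _).trans (Category.comp_id _).symm) (StructuredArrow.w k)⟩⟩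
  essSurj := ⟨fun ⟨S, Z⟩ => by
    obtain ⟨z, rfl⟩ := (Localization.Construction.objEquiv _).surjective Z
    obtain ⟨b, φ, h, hφ, hc⟩ := F.p.exists_isCart z.right z.hom
    let f := locHom (StructuredArrow.mk (𝟙 (F.p.obj b))) z (eqToHom h) φ (by simp [hφ])
    have h₁ : (Groth.proj (locPresheaf F)).IsCart f := Groth.isCart_of_isIso_fiber _
      ((underCartesian F _).Q_inverts (StructuredArrow.homMk φ (by simp [hφ]) :
        StructuredArrow.mk (𝟙 (F.p.obj b)) ⟶ (StructuredArrow.map (eqToHom h)).obj z)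
          (Functor.isCartesian_map_iff.2 hc))
    have : IsIso ((Groth.proj (locPresheaf F)).map f) := isIso_eqToHom h
    have := h₁.isIso
    exact ⟨b, ⟨@asIso _ _ _ _ f this⟩⟩⟩

theorem weq_unit (adj : locFunctor E ⊣ grothendieckFunctor E) (F : FibCat E) :
    (modelData E).weq (adj.unit.app F) := by
  rw [← Adjunction.unit_leftAdjointUniq_hom_app (locAdjunction E) adj]
  exact (modelData E).weq.comp_mem _ _ (locUnit_isEquivalence F) (weq_of_isIso _)

theorem weq_iff_of_locFunctor_adj (adj : locFunctor E ⊣ grothendieckFunctor E)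
    {P : Eᵒᵖ ⥤ Cat.{u, u}} {F : FibCat E} (f : (locFunctor E).obj F ⟶ P) :
    objectwiseEquivalences E f ↔ (modelData E).weq (adj.homEquiv F P f) := by
  rw [adj.homEquiv_unit]
  refine Groth.isEquivalence_map_iff.symm.trans ⟨fun h => ?_, fun h => ?_⟩
  · exact (modelData E).weq.comp_mem _ _ (weq_unit adj F) h
  · exact (modelData E).weq.of_precomp _ _ (weq_unit adj F) h

theorem isQuillenEquivalence_loc (adj : locFunctor E ⊣ grothendieckFunctor E) :
    IsQuillenEquivalence (modelData E) (projectiveModelData E) adj := by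
  have hcof : ∀ ⦃F G : FibCat E⦄ (f : F ⟶ G), (modelData E).cof f →
      (projectiveModelData E).cof ((locFunctor E).map f) := fun F G f hf P Q q hq => by
    rw [adj.hasLiftingProperty_iff]
    refine hasLiftingProperty_of_trivialFib f _ hf ?_ (Groth.isEquivalence_map hq.2)
    have := Groth.isEquivalence_map hq.2
    refine Functor.isIsofibration_of_surjective (p := Groth.map q) fun ⟨S, y⟩ => ?_
    have := hq.2 (op S)
    obtain ⟨x, rfl⟩ := (hq.1 (op S)).surjective y
    exact ⟨⟨S, x⟩, rfl⟩
  refine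
    { map_cof := hcof
      map_trivialCof := fun F G f hf => ⟨hcof f hf.1, ?_⟩
      weq_iff := fun _ _ _ _ f => weq_iff_of_locFunctor_adj adj f }
  refine Groth.isEquivalence_map_iff.1 ?_
  change (modelData E).weq ((grothendieckFunctor E).map ((locFunctor E).map f))
  have h := adj.unit.naturality f
  refine (modelData E).weq.of_precomp _ _ (weq_unit adj F) ?_
  exact (congrArg (fun t => (modelData E).weq t) h).mp
    ((modelData E).weq.comp_mem _ _ hf.2 (weq_unit adj G))

end FibCat

/-! ### Pushouts along functors that are injective on objects -/

namespace CategoryTheory.Cat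

theorem injectives_inf_equivalences_wfs : MorphismProperty.IsWeakFactorizationSystem
    (injectives.{u, u} ⊓ equivalences.{u, u}) isofibrations.{u, u} := by
  have : (injectives.{u, u} ⊓ equivalences.{u, u}).HasFactorization isofibrations :=
    ⟨fun {X Y} f => ⟨{
      Z := Cat.of (PathCat f.toFunctor)
      i := .ofFunctor (PathCat.incl f.toFunctor)
      p := .ofFunctor (PathCat.snd f.toFunctor)
      fac := Cat.ext (PathCat.incl_snd f.toFunctor)
      hi := ⟨PathCat.incl_injective _, inferInstanceAs (PathCat.incl _).IsEquivalence⟩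
      hp := PathCat.snd_isIsofibration _ }⟩⟩
  have : isofibrations.{u, u}.IsStableUnderRetracts := by
    rw [isofibrations_eq_rlp]
    infer_instance
  exact .mk' _ _ fun i p hi hp => hasLiftingProperty_of_isofibrations hi.1 hi.2 hp

instance : (injectives.{u, u} ⊓ equivalences.{u, u}).IsStableUnderCobaseChange := by
  have := injectives_inf_equivalences_wfs
  rw [← MorphismProperty.llp_eq_of_wfs (injectives.{u, u} ⊓ equivalences.{u, u}) isofibrations]
  infer_instance

theorem exists_of_isPushout {Z X Y P : Cat.{u, u}} {f : Z ⟶ X} {g : Z ⟶ Y} {a : X ⟶ P}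
    {b : Y ⟶ P} (h : IsPushout f g a b) (x : P) :
    (∃ y, a.toFunctor.obj y = x) ∨ ∃ y, b.toFunctor.obj y = x := by
  let S : ObjectProperty P := fun x => (∃ y, a.toFunctor.obj y = x) ∨ ∃ y, b.toFunctor.obj y = x
  let a' : X ⟶ Cat.of S.FullSubcategory :=
    Cat.Hom.ofFunctor (S.lift a.toFunctor fun y => Or.inl ⟨y, rfl⟩)
  let b' : Y ⟶ Cat.of S.FullSubcategory :=
    Cat.Hom.ofFunctor (S.lift b.toFunctor fun y => Or.inr ⟨y, rfl⟩)
  let ι : Cat.of S.FullSubcategory ⟶ P := Cat.Hom.ofFunctor S.ι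
  have : ι.toFunctor.Faithful := inferInstanceAs S.ι.Faithful
  have w : f ≫ a' = g ≫ b' := Cat.ext (Functor.ext_of_faithful_comp ι.toFunctor
    (fun z => ObjectProperty.FullSubcategory.ext (Functor.congr_obj (congrArg Cat.Hom.toFunctor h.w) z))
      (congrArg Cat.Hom.toFunctor h.w))
  have h₁ : h.desc a' b' w ≫ ι = 𝟙 P := h.hom_ext
    (by rw [h.inl_desc_assoc]; rfl) (by rw [h.inr_desc_assoc]; rfl)
  have h₂ := Functor.congr_obj (congrArg Cat.Hom.toFunctor h₁) x
  have h₃ := ((h.desc a' b' w).toFunctor.obj x).property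
  exact (congrArg S h₂).mp h₃

/-- A comparison map between pushouts is an equivalence. -/
theorem equivalences_of_isPushout {G F H P G' F' H' P' : Cat.{u, u}} {i : G ⟶ F} {g : G ⟶ H}
    {a : F ⟶ P} {b : H ⟶ P} {i' : G' ⟶ F'} {g' : G' ⟶ H'} {a' : F' ⟶ P'} {b' : H' ⟶ P'}
    (h : IsPushout i g a b) (h' : IsPushout i' g' a' b') {ηG : G ⟶ G'} {ηF : F ⟶ F'} {ηH : H ⟶ H'}
    (hG : (injectives ⊓ equivalences) ηG) (hF : (injectives ⊓ equivalences) ηF)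
    (hH : (injectives ⊓ equivalences) ηH) (wi : i ≫ ηF = ηG ≫ i') (wg : g ≫ ηH = ηG ≫ g')
    (hinj : ∀ ⦃F₁ : Cat.{u, u}⦄ (f₁ : F ⟶ F₁) (g₁ : G' ⟶ F₁) (t : F₁ ⟶ F'),
      IsPushout i ηG f₁ g₁ → f₁ ≫ t = ηF → g₁ ≫ t = i' → injectives t)
    {w : P ⟶ P'} (wa : a ≫ w = ηF ≫ a') (wb : b ≫ w = ηH ≫ b') : equivalences w := by
  obtain ⟨R, kP, kH, sR⟩ : ∃ (R : Cat.{u, u}) (kP : P ⟶ R) (kH : H' ⟶ R), IsPushout b ηH kP kH :=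
    ⟨_, _, _, .of_hasPushout _ _⟩
  obtain ⟨F₁, f₁, g₁, sF₁⟩ : ∃ (F₁ : Cat.{u, u}) (f₁ : F ⟶ F₁) (g₁ : G' ⟶ F₁),
    IsPushout i ηG f₁ g₁ := ⟨_, _, _, .of_hasPushout _ _⟩
  have hkP := MorphismProperty.of_isPushout sR hH
  have hf₁ := MorphismProperty.of_isPushout sF₁ hG
  have s₁ := h.paste_vert sR
  rw [wg] at s₁
  obtain ⟨s, hs, hs'⟩ := sF₁.exists_desc (a ≫ kP) (g' ≫ kH) (by rw [s₁.w, Category.assoc])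
  rw [← hs] at s₁
  have s₂ := s₁.of_top hs' sF₁
  obtain ⟨t, ht, ht'⟩ := sF₁.exists_desc ηF i' wi
  have h₁ : equivalences t := by
    refine equivalences.of_precomp f₁ t hf₁.2 ?_
    rw [ht]
    exact hF.2
  have h₂ := hinj f₁ g₁ t sF₁ ht ht'
  obtain ⟨r, hr, hr'⟩ := s₂.exists_desc (t ≫ a') b' (by rw [← Category.assoc, ht', h'.w])
  rw [← ht', ← hr'] at h'
  have s₃ := h'.of_left hr.symm s₂
  have hr₁ := MorphismProperty.of_isPushout s₃.flip (P := injectives ⊓ equivalences) ⟨h₂, h₁⟩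
  have hw : w = kP ≫ r := h.hom_ext
    (by rw [wa, ← Category.assoc, ← hs, Category.assoc, hr, ← Category.assoc, ht])
    (by rw [wb, ← Category.assoc, sR.w, Category.assoc, hr'])
  rw [hw]
  exact equivalences.comp_mem _ _ hkP.2 hr₁.2

end CategoryTheory.Cat

/-! ### Pushouts of fibred categories -/

namespace FibCat

variable {E : Type u} [SmallCategory E]

theorem exists_isCart_of_comp {F : FibCat E} {C : Type u} [SmallCategory C] {p : C ⥤ E}
    {a : F.obj ⥤ C} (w : a ⋙ p = F.p) (y : F.obj) {R : E} (f : R ⟶ p.obj (a.obj y)) :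
    ∃ (z : F.obj) (φ : z ⟶ y) (h : p.obj (a.obj z) = R),
      p.map (a.map φ) = eqToHom h ≫ f ∧ F.p.IsCart φ := by
  obtain ⟨z, φ, h, hφ, hc⟩ := F.p.exists_isCart y (f ≫ eqToHom (Functor.congr_obj w y))
  refine ⟨z, φ, (Functor.congr_obj w z).trans h, ?_, hc⟩
  have h₁ := Functor.congr_hom w φ
  rw [hφ] at h₁
  simpa using h₁

section

variable {F G H K : FibCat E} {i : G ⟶ F} {g : G ⟶ H} {P : Cat.{u, u}}
  {a : (forget E).obj F ⟶ P} {b : (forget E).obj H ⟶ P} {w : P ⟶ (forget E).obj K}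

theorem comp_p_of_comparison {k : F ⟶ K} (wa : a ≫ w = (forget E).map k) :
    a.toFunctor ⋙ w.toFunctor ⋙ K.p = F.p :=
  (congrArg (fun X : (forget E).obj F ⟶ (forget E).obj K => X.toFunctor ⋙ K.p) wa).trans
    (Hom.functor_p k)

theorem isCart_of_comparison (hw : Cat.equivalences w) {k : F ⟶ K}
    (wa : a ≫ w = (forget E).map k) {x y : F.obj} {φ : x ⟶ y} (h : F.p.IsCart φ) :
    (w.toFunctor ⋙ K.p).IsCart (a.toFunctor.map φ) := by
  let w' : P ⥤ K.obj := w.toFunctor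
  have : w'.IsEquivalence := hw
  refine Functor.isCart_of_map (q := K.p) (u := w') (Iso.refl _) ?_
  have e : Hom.functor k = a.toFunctor ⋙ w.toFunctor := congrArg Cat.Hom.toFunctor wa.symm
  exact isCart_map_of_iso (eqToIso e) (Hom.isCart k h)

theorem hasPushout_of_comparison (sP : IsPushout ((forget E).map i) ((forget E).map g) a b)
    (hw : Cat.equivalences w) {kF : F ⟶ K} {kH : H ⟶ K} (wa : a ≫ w = (forget E).map kF)
    (wb : b ≫ w = (forget E).map kH) : HasPushout i g := by
  have ha := comp_p_of_comparison wa
  have hb := comp_p_of_comparison wb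
  let P' : FibCat E := ofExists (C := P) (w.toFunctor ⋙ K.p) fun x R f => by
    obtain ⟨y, rfl⟩ | ⟨y, rfl⟩ := Cat.exists_of_isPushout sP x
    · obtain ⟨z, φ, h, hφ, hc⟩ := exists_isCart_of_comp ha y f
      exact ⟨_, a.toFunctor.map φ, h, hφ, isCart_of_comparison hw wa hc⟩
    · obtain ⟨z, φ, h, hφ, hc⟩ := exists_isCart_of_comp hb y f
      exact ⟨_, b.toFunctor.map φ, h, hφ, isCart_of_comparison hw wb hc⟩
  let a' : F ⟶ P' := homMk a.toFunctor ha fun _ _ _ h => isCart_of_comparison hw wa h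
  let b' : H ⟶ P' := homMk b.toFunctor hb fun _ _ _ h => isCart_of_comparison hw wb h
  have hex : ∀ ⦃X : FibCat E⦄ (c : F ⟶ X) (d : H ⟶ X), i ≫ c = g ≫ d →
      ∃ l : P' ⟶ X, a' ≫ l = c ∧ b' ≫ l = d := fun X c d hcd => by
    obtain ⟨l, hl, hl'⟩ := sP.exists_desc ((forget E).map c) ((forget E).map d)
      (by rw [← Functor.map_comp, hcd, Functor.map_comp])
    have hl₁ : a.toFunctor ⋙ l.toFunctor = Hom.functor c := congrArg Cat.Hom.toFunctor hl
    have hl₂ : b.toFunctor ⋙ l.toFunctor = Hom.functor d := congrArg Cat.Hom.toFunctor hl'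
    let q (X : FibCat E) : (forget E).obj X ⟶ Cat.of E := Cat.Hom.ofFunctor X.p
    have hp : l ≫ q X = w ≫ q K := by
      refine sP.hom_ext (Cat.ext ?_) (Cat.ext ?_)
      · exact ((congrArg (fun t => t ⋙ X.p) hl₁).trans (Hom.functor_p c)).trans ha.symm
      · exact ((congrArg (fun t => t ⋙ X.p) hl₂).trans (Hom.functor_p d)).trans hb.symm
    refine ⟨homMk l.toFunctor (congrArg Cat.Hom.toFunctor hp) fun x y φ hφ => ?_,
      hom_ext hl₁, hom_ext hl₂⟩
    refine Functor.isCart_map_of_exists (p := w.toFunctor ⋙ K.p) (u := l.toFunctor)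
      (fun x R f => ?_) hφ
    obtain ⟨y, rfl⟩ | ⟨y, rfl⟩ := Cat.exists_of_isPushout sP x
    · obtain ⟨z, φ, h, hφ, hc⟩ := exists_isCart_of_comp ha y f
      exact ⟨_, a.toFunctor.map φ, h, hφ, isCart_of_comparison hw wa hc,
        isCart_map_of_iso (eqToIso hl₁.symm) (Hom.isCart c hc)⟩
    · obtain ⟨z, φ, h, hφ, hc⟩ := exists_isCart_of_comp hb y f
      exact ⟨_, b.toFunctor.map φ, h, hφ, isCart_of_comparison hw wb hc,
        isCart_map_of_iso (eqToIso hl₂.symm) (Hom.isCart d hc)⟩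
  have hw' : i ≫ a' = g ≫ b' := hom_ext (congrArg Cat.Hom.toFunctor sP.w)
  choose l hl hl' using hex
  have : IsPushout i g a' b' := ⟨⟨hw'⟩, ⟨PushoutCocone.IsColimit.mk hw'
    (fun s => l s.inl s.inr s.condition) (fun s => hl _ _ _) (fun s => hl' _ _ _)
    fun s m h₁ h₂ => hom_ext (congrArg Cat.Hom.toFunctor
      (?_ : (forget E).map m = (forget E).map (l s.inl s.inr s.condition)))⟩⟩
  · exact this.hasPushout
  · exact sP.hom_ext (congrArg (forget E).map (h₁.trans (hl _ _ _).symm))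
      (congrArg (forget E).map (h₂.trans (hl' _ _ _).symm))

end

/-- The object of `F` underlying an object of `Groth (locPresheaf F)`. -/
def locRight {F : FibCat E} (x : Groth (locPresheaf F)) : F.obj :=
  ((Localization.Construction.objEquiv (underCartesian F x.base)).symm x.fiber).right

theorem locUnit_injective (F : FibCat E) : Function.Injective (Hom.functor (locUnit F)).obj :=
  fun x y h => by
    have h₁ : locRight ((Hom.functor (locUnit F)).obj x) =
      locRight ((Hom.functor (locUnit F)).obj y) := congrArg locRight h
    exact h₁

theorem underMap_injective {F G : FibCat E} {u₁ : F ⟶ G} (h : (modelData E).cof u₁) (S : E) :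
    Function.Injective (underMap u₁ S).obj := fun z z' hz => by
  obtain ⟨x, a, rfl⟩ := z.mk_surjective
  obtain ⟨x', a', rfl⟩ := z'.mk_surjective
  obtain rfl : x = x' := h (congrArg (fun t => t.right) hz)
  have h₁ : (a ≫ eqToHom (hom_obj u₁ x)) = (a' ≫ eqToHom (hom_obj u₁ x)) := by
    injection hz with _ _ h₁
  rw [cancel_mono] at h₁
  rw [h₁]

theorem map_locFunctor_injective {F G : FibCat E} {u₁ : F ⟶ G} (h : (modelData E).cof u₁) :
    Function.Injective (Groth.map ((locFunctor E).map u₁)).obj :=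
  Groth.map_injective fun S Z Z' hZ => by
    obtain ⟨z, rfl⟩ := (Localization.Construction.objEquiv _).surjective Z
    obtain ⟨z', rfl⟩ := (Localization.Construction.objEquiv _).surjective Z'
    have h₁ : (underMap u₁ S.unop).obj z = (underMap u₁ S.unop).obj z' :=
      (Localization.Construction.objEquiv (underCartesian G S.unop)).injective hZ
    rw [underMap_injective h _ h₁]

theorem hasPushout_of_cof {F G H : FibCat E} (i : G ⟶ F) (g : G ⟶ H) (hi : (modelData E).cof i) :
    HasPushout i g := by
  have := (totalAdjunction E).leftAdjoint_preservesColimits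
  have sQ := (IsPushout.of_hasPushout ((locFunctor E).map i) ((locFunctor E).map g)).map
    (totalFunctor E)
  let η (F : FibCat E) : (forget E).obj F ⟶ (totalFunctor E).obj ((locFunctor E).obj F) :=
    (forget E).map (locUnit F)
  have hη : ∀ F, (Cat.injectives ⊓ Cat.equivalences) (η F) := fun F =>
    ⟨locUnit_injective F, locUnit_isEquivalence F⟩
  have nat : ∀ {F G : FibCat E} (u₁ : F ⟶ G), (forget E).map u₁ ≫ η G =
      η F ≫ (totalFunctor E).map ((locFunctor E).map u₁) := fun u₁ =>
    congrArg (forget E).map (locUnit_naturality u₁)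
  have sP := IsPushout.of_hasPushout ((forget E).map i) ((forget E).map g)
  obtain ⟨w, wa, wb⟩ := sP.exists_desc (η F ≫ (totalFunctor E).map (pushout.inl _ _))
    (η H ≫ (totalFunctor E).map (pushout.inr _ _)) (by
      rw [← Category.assoc, ← Category.assoc, nat, nat, Category.assoc, Category.assoc, sQ.w])
  refine hasPushout_of_comparison (K := (grothendieckFunctor E).obj
    (pushout ((locFunctor E).map i) ((locFunctor E).map g))) sP
    (Cat.equivalences_of_isPushout sP sQ (hη G) (hη F) (hη H) (nat i) (nat g) ?_ wa wb)
    (kF := locUnit F ≫ (grothendieckFunctor E).map (pushout.inl _ _))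
    (kH := locUnit H ≫ (grothendieckFunctor E).map (pushout.inr _ _)) wa wb
  intro F₁ f₁ g₁ t sF₁ h₁ h₂ x y hxy
  have e₁ : ∀ a, t.toFunctor.obj (f₁.toFunctor.obj a) = (Hom.functor (locUnit F)).obj a :=
    Functor.congr_obj (congrArg Cat.Hom.toFunctor h₁)
  have e₂ : ∀ c, t.toFunctor.obj (g₁.toFunctor.obj c) =
      (Groth.map ((locFunctor E).map i)).obj c :=
    Functor.congr_obj (congrArg Cat.Hom.toFunctor h₂)
  have e₃ : ∀ z, f₁.toFunctor.obj ((Hom.functor i).obj z) =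
      g₁.toFunctor.obj ((Hom.functor (locUnit G)).obj z) :=
    Functor.congr_obj (congrArg Cat.Hom.toFunctor sF₁.w)
  have e₄ : ∀ z, (Hom.functor (locUnit F)).obj ((Hom.functor i).obj z) =
      (Groth.map ((locFunctor E).map i)).obj ((Hom.functor (locUnit G)).obj z) :=
    Functor.congr_obj (congrArg Cat.Hom.toFunctor (nat i))
  have key : ∀ a c, (Hom.functor (locUnit F)).obj a = (Groth.map ((locFunctor E).map i)).obj c →
      f₁.toFunctor.obj a = g₁.toFunctor.obj c := fun a c hac => by
    have h₃ : a = (Hom.functor i).obj (locRight c) := congrArg locRight hac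
    rw [h₃, e₃]
    refine congrArg _ (map_locFunctor_injective hi ?_)
    rw [← e₄, ← h₃, hac]
  obtain ⟨a, rfl⟩ | ⟨c, rfl⟩ := Cat.exists_of_isPushout sF₁ x <;>
    obtain ⟨a', rfl⟩ | ⟨c', rfl⟩ := Cat.exists_of_isPushout sF₁ y
  · exact congrArg _ (locUnit_injective F ((e₁ a).symm.trans (hxy.trans (e₁ a'))))
  · exact key a c' ((e₁ a).symm.trans (hxy.trans (e₂ c')))
  · exact (key a' c ((e₁ a').symm.trans (hxy.symm.trans (e₂ c)))).symm
  · exact congrArg _ (map_locFunctor_injective hi ((e₂ c).symm.trans (hxy.trans (e₂ c'))))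

theorem isGeneralizedModelCategory : (modelData E).IsGeneralizedModelCategory where
  hasInitial := by
    have := (cartAdjunction E).leftAdjoint_preservesColimits
    exact (initialIsInitial.isInitialObj (grothendieckFunctor E) _).hasInitial
  hasTerminal := by
    have := (locAdjunction E).rightAdjoint_preservesLimits
    exact (terminalIsTerminal.isTerminalObj (grothendieckFunctor E) _).hasTerminal
  hasPushout _ _ _ i g hi := hasPushout_of_cof i g hi
  hasPullback _ _ _ p g hp := hasPullback_of_fib g hp
  twoOutOfThree := inferInstance
  cof_trivialFib := cof_trivialFib
  trivialCof_fib := trivialCof_fib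

end FibCat

/-! ### Maps of presheaves of categories that are fully faithful -/

namespace PresheafCat

variable {E : Type u} [SmallCategory E]

theorem hom_ext_of_faithful {B X Y : Eᵒᵖ ⥤ Cat.{u, u}} {p : X ⟶ Y}
    (hp : ∀ S, (p.app S).toFunctor.Faithful) {l l' : B ⟶ X} (h : l ≫ p = l' ≫ p)
    (h' : ∀ S x, (l.app S).toFunctor.obj x = (l'.app S).toFunctor.obj x) : l = l' := by
  refine NatTrans.ext (funext fun S => Cat.ext ?_)
  have := hp S
  exact Functor.ext_of_faithful_comp (p.app S).toFunctor (h' S)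
    (congrArg (fun η : B ⟶ Y => (η.app S).toFunctor) h)

/-- A lift along a map that is fully faithful, with prescribed values on objects. -/
theorem exists_lift {B X Y : Eᵒᵖ ⥤ Cat.{u, u}} {p : X ⟶ Y}
    (hp : ∀ S, (p.app S).toFunctor.Full) (hp' : ∀ S, (p.app S).toFunctor.Faithful) (b : B ⟶ Y)
    (k : ∀ S, B.obj S → X.obj S)
    (hk : ∀ S x, (p.app S).toFunctor.obj (k S x) = (b.app S).toFunctor.obj x)
    (hk' : ∀ ⦃S T⦄ (f : S ⟶ T) x,
      k T ((B.map f).toFunctor.obj x) = (X.map f).toFunctor.obj (k S x)) :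
    ∃ l : B ⟶ X, l ≫ p = b ∧ ∀ S x, (l.app S).toFunctor.obj x = k S x := by
  let l (S : Eᵒᵖ) : B.obj S ⥤ X.obj S :=
    (p.app S).toFunctor.liftOfObj (b.app S).toFunctor (k S) (hk S)
  have hl : ∀ S, l S ⋙ (p.app S).toFunctor = (b.app S).toFunctor := fun S =>
    Functor.liftOfObj_comp _ _ _ _
  refine ⟨{
    app := fun S => Cat.Hom.ofFunctor (l S)
    naturality := fun S T f => Cat.ext (Functor.ext_of_faithful_comp (p.app T).toFunctor
      (fun x => hk' f x) ?_) }, NatTrans.ext (funext fun S => Cat.ext (hl S)), fun _ _ => rfl⟩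
  have h₁ : (X.map f).toFunctor ⋙ (p.app T).toFunctor = (p.app S).toFunctor ⋙ (Y.map f).toFunctor :=
    congrArg Cat.Hom.toFunctor (p.naturality f)
  have h₂ : (B.map f).toFunctor ⋙ (b.app T).toFunctor = (b.app S).toFunctor ⋙ (Y.map f).toFunctor :=
    congrArg Cat.Hom.toFunctor (b.naturality f)
  change (B.map f).toFunctor ⋙ l T ⋙ (p.app T).toFunctor =
    l S ⋙ (X.map f).toFunctor ⋙ (p.app T).toFunctor
  rw [hl, h₁, h₂, ← hl]
  rfl

/-- A presheaf of sets over the objects of a presheaf of categories. -/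
structure ObjOver (Y : Eᵒᵖ ⥤ Cat.{u, u}) where
  /-- the values of the presheaf -/
  obj : Eᵒᵖ → Type u
  /-- the restriction maps -/
  map : ∀ {S T : Eᵒᵖ}, (S ⟶ T) → obj S → obj T
  map_id : ∀ S x, map (𝟙 S) x = x
  map_comp : ∀ {S T U : Eᵒᵖ} (f : S ⟶ T) (g : T ⟶ U) x, map (f ≫ g) x = map g (map f x)
  /-- the projection -/
  proj : ∀ S, obj S → Y.obj S
  naturality : ∀ {S T : Eᵒᵖ} (f : S ⟶ T) x, proj T (map f x) = (Y.map f).toFunctor.obj (proj S x)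

namespace ObjOver

variable {Y : Eᵒᵖ ⥤ Cat.{u, u}} (Z : ObjOver Y)

/-- The restriction functors of the induced presheaf of categories. -/
noncomputable def res {S T : Eᵒᵖ} (f : S ⟶ T) :
    InducedCategory (Y.obj S) (Z.proj S) ⥤ InducedCategory (Y.obj T) (Z.proj T) :=
  (inducedFunctor (Z.proj T)).liftOfObj (inducedFunctor (Z.proj S) ⋙ (Y.map f).toFunctor)
    (Z.map f) (Z.naturality f)

theorem res_comp {S T : Eᵒᵖ} (f : S ⟶ T) : Z.res f ⋙ inducedFunctor (Z.proj T) =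
    inducedFunctor (Z.proj S) ⋙ (Y.map f).toFunctor :=
  Functor.liftOfObj_comp _ _ _ _

theorem res_id (S : Eᵒᵖ) : Z.res (𝟙 S) = 𝟭 (InducedCategory (Y.obj S) (Z.proj S)) :=
  Functor.ext_of_faithful_comp (inducedFunctor (Z.proj S)) (Z.map_id S) (by
    refine (Z.res_comp _).trans ?_
    rw [Y.map_id]
    rfl)

theorem res_comp_res {S T U : Eᵒᵖ} (f : S ⟶ T) (g : T ⟶ U) :
    Z.res (f ≫ g) = Z.res f ⋙ Z.res g :=
  Functor.ext_of_faithful_comp (inducedFunctor (Z.proj U)) (Z.map_comp f g) (by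
    refine (Z.res_comp _).trans ?_
    rw [Y.map_comp]
    refine Eq.trans ?_ (congrArg (fun X => Z.res f ⋙ X) (Z.res_comp g)).symm
    exact (congrArg (fun X => X ⋙ (Y.map g).toFunctor) (Z.res_comp f)).symm)

/-- The presheaf of categories with the objects of `Z` and the maps of `Y`. -/
noncomputable def presheaf : Eᵒᵖ ⥤ Cat.{u, u} where
  obj S := Cat.of (InducedCategory (Y.obj S) (Z.proj S))
  map f := Cat.Hom.ofFunctor (Z.res f)
  map_id S := Cat.ext (Z.res_id S)
  map_comp f g := Cat.ext (Z.res_comp_res f g)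

/-- The projection of the induced presheaf of categories. -/
noncomputable def toBase : Z.presheaf ⟶ Y where
  app S := Cat.Hom.ofFunctor (inducedFunctor (Z.proj S))
  naturality _ _ f := Cat.ext (Z.res_comp f)

theorem toBase_full (S : Eᵒᵖ) : (Z.toBase.app S).toFunctor.Full :=
  inferInstanceAs (inducedFunctor (Z.proj S)).Full

theorem toBase_faithful (S : Eᵒᵖ) : (Z.toBase.app S).toFunctor.Faithful :=
  inferInstanceAs (inducedFunctor (Z.proj S)).Faithful

theorem toBase_weq (h : ∀ S, Function.Surjective (Z.proj S)) :
    objectwiseEquivalences E Z.toBase := fun S =>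
  { faithful := Z.toBase_faithful S
    full := Z.toBase_full S
    essSurj := ⟨fun y => by
      obtain ⟨x, rfl⟩ := h S y
      exact ⟨x, ⟨Iso.refl _⟩⟩⟩ }

theorem toBase_isofibrations (h : ∀ S, Function.Surjective (Z.proj S)) :
    objectwiseIsofibrations E Z.toBase := fun S => by
  have := Z.toBase_full S
  have := Z.toBase_faithful S
  exact Functor.isIsofibration_of_surjective (h S)

end ObjOver

instance : (objectwiseEquivalences E).IsStableUnderRetracts :=
  inferInstanceAs (Cat.equivalences.functorCategory Eᵒᵖ).IsStableUnderRetracts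

instance : (objectwiseInjective E).IsStableUnderRetracts :=
  inferInstanceAs (Cat.injectives.functorCategory Eᵒᵖ).IsStableUnderRetracts

instance : (objectwiseIsofibrations E).IsStableUnderRetracts :=
  have : Cat.isofibrations.{u, u}.IsStableUnderRetracts := by
    rw [Cat.isofibrations_eq_rlp]
    infer_instance
  inferInstanceAs (Cat.isofibrations.functorCategory Eᵒᵖ).IsStableUnderRetracts

instance : (objectwiseEquivalences E).HasTwoOutOfThreeProperty where
  comp_mem _ _ hf hg S := Cat.equivalences.comp_mem _ _ (hf S) (hg S)
  of_postcomp f g hg h S :=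
    Cat.equivalences.of_postcomp (W' := Cat.equivalences) (f.app S) (g.app S) (hg S) (h S)
  of_precomp f g hf h S :=
    Cat.equivalences.of_precomp (W' := Cat.equivalences) (f.app S) (g.app S) (hf S) (h S)

/-! ### The projective structure -/

/-- The objects of `X` together with a free object for each object of `Y`. -/
abbrev freeObj {X Y : Eᵒᵖ ⥤ Cat.{u, u}} (η : X ⟶ Y) : ObjOver Y where
  obj S := X.obj S ⊕ Σ T : Eᵒᵖ, Y.obj T × (T ⟶ S)
  map f := Sum.map (X.map f).toFunctor.obj fun x => ⟨x.1, x.2.1, x.2.2 ≫ f⟩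
  map_id S x := by rcases x with x | ⟨T, y, f⟩ <;> simp
  map_comp f g x := by rcases x with x | ⟨T, y, f⟩ <;> simp
  proj S := Sum.elim (η.app S).toFunctor.obj fun x => (Y.map x.2.2).toFunctor.obj x.2.1
  naturality {S T} f x := by
    rcases x with x | ⟨T, y, f⟩
    · exact Functor.congr_obj (congrArg Cat.Hom.toFunctor (η.naturality f)) x
    · simp

theorem freeObj_surjective {X Y : Eᵒᵖ ⥤ Cat.{u, u}} (η : X ⟶ Y) (S : Eᵒᵖ) :
    Function.Surjective ((freeObj η).proj S) := fun y => ⟨Sum.inr ⟨S, y, 𝟙 S⟩, by simp⟩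

theorem exists_proj_factorization {X Y : Eᵒᵖ ⥤ Cat.{u, u}} (η : X ⟶ Y) :
    ∃ (Z : Eᵒᵖ ⥤ Cat.{u, u}) (i : X ⟶ Z) (p : Z ⟶ Y), i ≫ p = η ∧
      (objectwiseIsofibrations E ⊓ objectwiseEquivalences E).llp i ∧
        (objectwiseIsofibrations E ⊓ objectwiseEquivalences E) p := by
  obtain ⟨i, hi, hi'⟩ := exists_lift (freeObj η).toBase_full (freeObj η).toBase_faithful η
    (fun S x => Sum.inl x) (fun S x => rfl) (fun S T f x => rfl)
  refine ⟨_, i, (freeObj η).toBase, hi, fun A B q hq => ⟨fun {t b} sq => ?_⟩,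
    (freeObj η).toBase_isofibrations (freeObj_surjective η),
    (freeObj η).toBase_weq (freeObj_surjective η)⟩
  have hff : ∀ S, (q.app S).toFunctor.IsEquivalence := hq.2
  have hs : ∀ S, Function.Surjective (q.app S).toFunctor.obj := fun S =>
    (hq.1 S).surjective
  choose σ hσ using fun (T : Eᵒᵖ) (y : Y.obj T) =>
    hs T ((b.app T).toFunctor.obj (Sum.inr ⟨T, y, 𝟙 T⟩ : (freeObj η).obj T))
  have hsq : ∀ S x, (q.app S).toFunctor.obj ((t.app S).toFunctor.obj x) =
      (b.app S).toFunctor.obj (Sum.inl x : (freeObj η).obj S) := fun S x =>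
    (Functor.congr_obj (congrArg (fun ζ : X ⟶ B => (ζ.app S).toFunctor) sq.w) x).trans
      (congrArg (b.app S).toFunctor.obj (hi' S x))
  obtain ⟨l, hl, hl'⟩ := exists_lift (p := q) (fun S => (hff S).full) (fun S => (hff S).faithful) b
    (fun S => Sum.elim (t.app S).toFunctor.obj fun x => (A.map x.2.2).toFunctor.obj (σ x.1 x.2.1))
    (fun S x => by
      rcases x with x | ⟨T, y, f⟩
      · exact hsq S x
      · have h₁ := Functor.congr_obj (congrArg Cat.Hom.toFunctor (q.naturality f)) (σ T y)
        have h₂ := Functor.congr_obj (congrArg Cat.Hom.toFunctor (b.naturality f))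
          (Sum.inr ⟨T, y, 𝟙 T⟩ : (freeObj η).obj T)
        refine h₁.trans ((congrArg (B.map f).toFunctor.obj (hσ T y)).trans (h₂.symm.trans ?_))
        refine congrArg (b.app S).toFunctor.obj ?_
        change (Sum.inr ⟨T, y, 𝟙 T ≫ f⟩ : (freeObj η).obj S) = Sum.inr ⟨T, y, f⟩
        rw [Category.id_comp])
    (fun S T f x => by
      rcases x with x | ⟨U, y, g⟩
      · exact Functor.congr_obj (congrArg Cat.Hom.toFunctor (t.naturality f)) x
      · change (A.map (g ≫ f)).toFunctor.obj _ = _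
        rw [A.map_comp]
        rfl)
  refine ⟨⟨⟨l, hom_ext_of_faithful (p := q) (fun S => (hff S).faithful) ?_ fun S x => ?_, hl⟩⟩⟩
  · rw [Category.assoc, hl, sq.w]
  · refine Eq.trans (congrArg (l.app S).toFunctor.obj (hi' S x)) (hl' S _)

end PresheafCat

namespace CategoryTheory.PathCat

variable {A B : Type*} [Category* A] [Category* B] {F : A ⥤ B}

theorem map_eq_id {a : A ⥤ A} {b : B ⥤ B} (ha : a = 𝟭 A) (hb : b = 𝟭 B)
    (h : a ⋙ F = F ⋙ b) : map a b h = 𝟭 (PathCat F) := by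
  subst ha hb
  exact Functor.ext_of_faithful_comp (fst F) (fun x => PathObj.ext' rfl rfl (by
    change (𝟙 _ ≫ x.iso.hom) ≫ 𝟙 _ = 𝟙 _ ≫ x.iso.hom
    simp)) rfl

variable {A' B' A'' B'' : Type*} [Category* A'] [Category* B'] [Category* A''] [Category* B'']
  {F' : A' ⥤ B'} {F'' : A'' ⥤ B''}

theorem map_eq_comp {a : A ⥤ A'} {b : B ⥤ B'} (h : a ⋙ F' = F ⋙ b) {a' : A' ⥤ A''}
    {b' : B' ⥤ B''} (h' : a' ⋙ F'' = F' ⋙ b') {a'' : A ⥤ A''} {b'' : B ⥤ B''}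
    (ha : a'' = a ⋙ a') (hb : b'' = b ⋙ b') (h'' : a'' ⋙ F'' = F ⋙ b'') :
    map a'' b'' h'' = map a b h ⋙ map a' b' h' := by
  subst ha hb
  exact Functor.ext_of_faithful_comp (fst F'')
    (fun x => PathObj.ext' rfl rfl (by
      change (eqToHom (Functor.congr_obj h'' x.left) ≫ b'.map (b.map x.iso.hom)) ≫ 𝟙 _ =
        𝟙 _ ≫ eqToHom (Functor.congr_obj h' (a.obj x.left)) ≫
          b'.map (eqToHom (Functor.congr_obj h x.left) ≫ b.map x.iso.hom)
      simp [eqToHom_map])) rfl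

theorem comp_incl {a : A ⥤ A'} {b : B ⥤ B'} (h : a ⋙ F' = F ⋙ b) :
    a ⋙ incl F' = incl F ⋙ map a b h :=
  Functor.ext_of_faithful_comp (fst F')
    (fun x => PathObj.ext' rfl (Functor.congr_obj h x) (by
      change 𝟙 (F'.obj (a.obj x)) ≫ eqToHom (Functor.congr_obj h x) =
        𝟙 _ ≫ eqToHom (Functor.congr_obj h x) ≫ b.map (𝟙 (F.obj x))
      simp)) rfl

end CategoryTheory.PathCat

namespace PresheafCat

variable {E : Type u} [SmallCategory E]

section Path

variable {X Y : Eᵒᵖ ⥤ Cat.{u, u}} (η : X ⟶ Y)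

theorem naturality_toFunctor {S T : Eᵒᵖ} (f : S ⟶ T) :
    (X.map f).toFunctor ⋙ (η.app T).toFunctor = (η.app S).toFunctor ⋙ (Y.map f).toFunctor :=
  congrArg Cat.Hom.toFunctor (η.naturality f)

/-- The objectwise path object of a map of presheaves of categories. -/
def path : Eᵒᵖ ⥤ Cat.{u, u} where
  obj S := Cat.of (PathCat (η.app S).toFunctor)
  map f := Cat.Hom.ofFunctor (PathCat.map _ _ (naturality_toFunctor η f))
  map_id S := Cat.ext (PathCat.map_eq_id (congrArg Cat.Hom.toFunctor (X.map_id S))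
    (congrArg Cat.Hom.toFunctor (Y.map_id S))
    (naturality_toFunctor η (𝟙 S)))
  map_comp f g := Cat.ext (PathCat.map_eq_comp (naturality_toFunctor η f)
    (naturality_toFunctor η g) (congrArg Cat.Hom.toFunctor (X.map_comp f g))
    (congrArg Cat.Hom.toFunctor (Y.map_comp f g))
    (naturality_toFunctor η (f ≫ g)))

/-- The inclusion in the path object. -/
def pathIncl : X ⟶ path η where
  app S := Cat.Hom.ofFunctor (PathCat.incl (η.app S).toFunctor)
  naturality _ _ f := Cat.ext (PathCat.comp_incl (naturality_toFunctor η f))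

/-- The projection of the path object. -/
def pathSnd : path η ⟶ Y where
  app S := Cat.Hom.ofFunctor (PathCat.snd (η.app S).toFunctor)
  naturality _ _ f := Cat.ext (PathCat.map_snd _ _ (naturality_toFunctor η f))

theorem pathIncl_pathSnd : pathIncl η ≫ pathSnd η = η :=
  NatTrans.ext (funext fun S => Cat.ext (PathCat.incl_snd (η.app S).toFunctor))

theorem pathIncl_weq : objectwiseEquivalences E (pathIncl η) := fun S =>
  inferInstanceAs (PathCat.incl (η.app S).toFunctor).IsEquivalence

theorem pathSnd_isofibrations : objectwiseIsofibrations E (pathSnd η) := fun S =>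
  PathCat.snd_isIsofibration (η.app S).toFunctor

end Path

theorem isPullback_app {P X Y Z : Eᵒᵖ ⥤ Cat.{u, u}} {fst : P ⟶ X} {snd : P ⟶ Y} {f : X ⟶ Z}
    {g : Y ⟶ Z} (h : IsPullback fst snd f g) (S : Eᵒᵖ) :
    IsPullback (fst.app S) (snd.app S) (f.app S) (g.app S) :=
  h.map ((evaluation Eᵒᵖ Cat.{u, u}).obj S)

theorem isofibrations_of_isPullback {P X Y Z : Eᵒᵖ ⥤ Cat.{u, u}} {fst : P ⟶ X} {snd : P ⟶ Y}
    {f : X ⟶ Z} {g : Y ⟶ Z} (h : IsPullback fst snd f g) (hg : objectwiseIsofibrations E g) :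
    objectwiseIsofibrations E fst := fun S => by
  have h' : Cat.isofibrations (g.app S) := hg S
  change Cat.isofibrations (fst.app S)
  rw [Cat.isofibrations_eq_rlp] at h' ⊢
  exact MorphismProperty.of_isPullback (isPullback_app h S).flip h'

theorem isofibrations_comp {X Y Z : Eᵒᵖ ⥤ Cat.{u, u}} {f : X ⟶ Y} {g : Y ⟶ Z}
    (hf : objectwiseIsofibrations E f) (hg : objectwiseIsofibrations E g) :
    objectwiseIsofibrations E (f ≫ g) := fun S => by
  have h : Cat.isofibrations (f.app S) := hf S
  have h' : Cat.isofibrations (g.app S) := hg S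
  change Cat.isofibrations (f.app S ≫ g.app S)
  rw [Cat.isofibrations_eq_rlp] at h h' ⊢
  exact MorphismProperty.comp_mem _ _ _ h h'

theorem proj_hasLiftingProperty {A B X Y : Eᵒᵖ ⥤ Cat.{u, u}} {j : A ⟶ B} {p : X ⟶ Y}
    (hj : (objectwiseIsofibrations E ⊓ objectwiseEquivalences E).llp j)
    (hj' : objectwiseEquivalences E j) (hp : objectwiseIsofibrations E p) :
    HasLiftingProperty j p where
  sq_hasLift {t b} sq := by
    let s : A ⟶ pullback b p := pullback.lift j t sq.w.symm
    have hs : s ≫ pullback.fst b p = j := pullback.lift_fst _ _ _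
    have hs' : s ≫ pullback.snd b p = t := pullback.lift_snd _ _ _
    let q : path s ⟶ B := pathSnd s ≫ pullback.fst b p
    have hq : pathIncl s ≫ q = j := by rw [← Category.assoc, pathIncl_pathSnd, hs]
    have hq' : (objectwiseIsofibrations E ⊓ objectwiseEquivalences E) q :=
      ⟨isofibrations_comp (pathSnd_isofibrations s)
        (isofibrations_of_isPullback (IsPullback.of_hasPullback b p) hp),
        (objectwiseEquivalences E).of_precomp (W' := objectwiseEquivalences E) (pathIncl s) q
          (pathIncl_weq s) (hq ▸ hj')⟩
    have := hj q hq'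
    have sq' : CommSq (pathIncl s) j q (𝟙 B) := ⟨by rw [hq, Category.comp_id]⟩
    refine ⟨⟨⟨sq'.lift ≫ pathSnd s ≫ pullback.snd b p, ?_, ?_⟩⟩⟩
    · rw [sq'.fac_left_assoc, ← Category.assoc, pathIncl_pathSnd, hs']
    · rw [Category.assoc, Category.assoc, ← pullback.condition]
      exact (sq'.fac_right_assoc b).trans (Category.id_comp b)

variable (E)

theorem proj_cof_trivialFib : MorphismProperty.IsWeakFactorizationSystem
    (projectiveModelData E).cof ((projectiveModelData E).fib ⊓ (projectiveModelData E).weq) := by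
  have : (objectwiseIsofibrations E ⊓ objectwiseEquivalences E).llp.HasFactorization
      (objectwiseIsofibrations E ⊓ objectwiseEquivalences E) := ⟨fun f => by
    obtain ⟨Z, i, p, h, hi, hp⟩ := exists_proj_factorization f
    exact ⟨{ Z := Z, i := i, p := p, fac := h, hi := hi, hp := hp }⟩⟩
  exact .mk' (objectwiseIsofibrations E ⊓ objectwiseEquivalences E).llp
    (objectwiseIsofibrations E ⊓ objectwiseEquivalences E) fun i p hi hp => hi p hp

theorem proj_trivialCof_fib : MorphismProperty.IsWeakFactorizationSystem
    ((projectiveModelData E).cof ⊓ (projectiveModelData E).weq) (projectiveModelData E).fib := by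
  have : ((objectwiseIsofibrations E ⊓ objectwiseEquivalences E).llp ⊓
      objectwiseEquivalences E).HasFactorization (objectwiseIsofibrations E) := ⟨fun f => by
    obtain ⟨Z, i, p, h, hi, hp⟩ := exists_proj_factorization (pathIncl f)
    exact ⟨{
      Z := Z
      i := i
      p := p ≫ pathSnd f
      fac := by rw [← Category.assoc, h, pathIncl_pathSnd]
      hi := ⟨hi, (objectwiseEquivalences E).of_postcomp (W' := objectwiseEquivalences E) i p hp.2
        (h ▸ pathIncl_weq f)⟩
      hp := isofibrations_comp hp.1 (pathSnd_isofibrations f) }⟩⟩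
  exact .mk' ((objectwiseIsofibrations E ⊓ objectwiseEquivalences E).llp ⊓
      objectwiseEquivalences E) (objectwiseIsofibrations E)
    fun i p hi hp => proj_hasLiftingProperty hi.1 hi.2 hp

theorem projectiveModelData_isModelCategory : (projectiveModelData E).IsModelCategory where
  hasInitial := inferInstance
  hasTerminal := inferInstance
  hasPushout _ _ _ _ _ _ := inferInstance
  hasPullback _ _ _ _ _ _ := inferInstance
  twoOutOfThree := inferInstanceAs (objectwiseEquivalences E).HasTwoOutOfThreeProperty
  cof_trivialFib := proj_cof_trivialFib E
  trivialCof_fib := proj_trivialCof_fib E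
  hasLimits := inferInstance
  hasColimits := inferInstance

end PresheafCat

namespace PresheafCat

variable {E : Type u} [SmallCategory E]

/-! ### The injective structure -/

/-- The objects of `Y` together with a partial object of `X` on each restriction. -/
abbrev cofreeObj (X Y : Eᵒᵖ ⥤ Cat.{u, u}) : ObjOver Y where
  obj S := Y.obj S × ∀ T : Eᵒᵖ, (S ⟶ T) → Option (X.obj T)
  map f x := ⟨(Y.map f).toFunctor.obj x.1, fun T g => x.2 T (f ≫ g)⟩
  map_id S x := by simp
  map_comp f g x := by simp
  proj _ := Prod.fst
  naturality _ _ := rfl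

theorem exists_inj_factorization {X Y : Eᵒᵖ ⥤ Cat.{u, u}} (η : X ⟶ Y) :
    ∃ (Z : Eᵒᵖ ⥤ Cat.{u, u}) (i : X ⟶ Z) (p : Z ⟶ Y), i ≫ p = η ∧ objectwiseInjective E i ∧
      (objectwiseInjective E).rlp p ∧ objectwiseIsofibrations E p ∧
        objectwiseEquivalences E p := by
  let Z := cofreeObj X Y
  have hZ : ∀ S, Function.Surjective (Z.proj S) := fun S y => ⟨⟨y, fun _ _ => none⟩, rfl⟩
  obtain ⟨i, hi, hi'⟩ := exists_lift Z.toBase_full Z.toBase_faithful η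
    (fun S x => ((η.app S).toFunctor.obj x, fun T f => some ((X.map f).toFunctor.obj x)))
    (fun S x => rfl) (fun S T f x => Prod.ext
      (Functor.congr_obj (naturality_toFunctor η f) x) (by
        funext U g
        change some ((X.map g).toFunctor.obj ((X.map f).toFunctor.obj x)) =
          some ((X.map (f ≫ g)).toFunctor.obj x)
        rw [X.map_comp]
        rfl))
  refine ⟨_, i, Z.toBase, hi, fun S x y h => ?_, fun A B j hj => ⟨fun {t b} sq => ?_⟩,
    Z.toBase_isofibrations hZ, Z.toBase_weq hZ⟩
  · have h' := congrArg (fun z : Z.obj S => z.2 S (𝟙 S)) ((hi' S x).symm.trans (h.trans (hi' S y)))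
    have h'' : (X.map (𝟙 S)).toFunctor.obj x = (X.map (𝟙 S)).toFunctor.obj y := Option.some.inj h'
    rw [X.map_id] at h''
    exact h''
  · let κ (T : Eᵒᵖ) : B.obj T → Option (X.obj T) :=
      Function.extend (j.app T).toFunctor.obj
        (fun a => ((t.app T).toFunctor.obj a : Z.obj T).2 T (𝟙 T)) fun _ => none
    obtain ⟨l, hl, hl'⟩ := exists_lift Z.toBase_full Z.toBase_faithful b
      (fun S x => ((b.app S).toFunctor.obj x, fun T f => κ T ((B.map f).toFunctor.obj x)))
      (fun S x => rfl) (fun S T f x => Prod.ext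
        (Functor.congr_obj (naturality_toFunctor b f) x) (by
          funext U g
          change κ U ((B.map g).toFunctor.obj ((B.map f).toFunctor.obj x)) =
            κ U ((B.map (f ≫ g)).toFunctor.obj x)
          rw [B.map_comp]
          rfl))
    refine ⟨⟨⟨l, hom_ext_of_faithful (p := Z.toBase) Z.toBase_faithful ?_ fun S x => ?_, hl⟩⟩⟩
    · rw [Category.assoc, hl, sq.w]
    · refine (hl' S _).trans (Prod.ext ?_ ?_)
      · exact (Functor.congr_obj
          (congrArg (fun ζ : A ⟶ Y => (ζ.app S).toFunctor) sq.w) x).symm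
      · funext T f
        have h₁ : (B.map f).toFunctor.obj ((j.app S).toFunctor.obj x) =
            (j.app T).toFunctor.obj ((A.map f).toFunctor.obj x) :=
          (Functor.congr_obj (naturality_toFunctor j f) x).symm
        have h₂ : (t.app T).toFunctor.obj ((A.map f).toFunctor.obj x) =
            Z.map f ((t.app S).toFunctor.obj x : Z.obj S) :=
          Functor.congr_obj (naturality_toFunctor t f) x
        refine (congrArg (κ T) h₁).trans ((Function.Injective.extend_apply (hj T) _ _ _).trans ?_)
        refine (congrArg (fun z : Z.obj T => z.2 T (𝟙 T)) h₂).trans ?_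
        exact congrArg (((t.app S).toFunctor.obj x : Z.obj S).2 T) (Category.comp_id f)

theorem objectwiseInjective_of_proj_cof {X Y : Eᵒᵖ ⥤ Cat.{u, u}} {i : X ⟶ Y}
    (hi : (objectwiseIsofibrations E ⊓ objectwiseEquivalences E).llp i) :
    objectwiseInjective E i := by
  obtain ⟨Z, j, p, h, hj, -, hp⟩ := exists_inj_factorization i
  have := hi p hp
  exact MorphismProperty.of_retract (RetractArrow.ofLeftLiftingProperty h) hj

theorem objectwiseIsofibrations_of_inj_fib {X Y : Eᵒᵖ ⥤ Cat.{u, u}} {p : X ⟶ Y}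
    (hp : (objectwiseInjective E ⊓ objectwiseEquivalences E).rlp p) :
    objectwiseIsofibrations E p := by
  have h := (proj_trivialCof_fib E).rlp
  change ((objectwiseIsofibrations E ⊓ objectwiseEquivalences E).llp ⊓
    objectwiseEquivalences E).rlp = objectwiseIsofibrations E at h
  rw [← h]
  exact fun _ _ i hi => hp i ⟨objectwiseInjective_of_proj_cof hi.1, hi.2⟩

theorem rlp_of_inj_trivialFib {X Y : Eᵒᵖ ⥤ Cat.{u, u}} {p : X ⟶ Y}
    (hp : (objectwiseInjective E ⊓ objectwiseEquivalences E).rlp p)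
    (hp' : objectwiseEquivalences E p) : (objectwiseInjective E).rlp p := by
  obtain ⟨Z, j, q, h, hj, hq, -, hq'⟩ := exists_inj_factorization p
  have hj' : objectwiseEquivalences E j :=
    (objectwiseEquivalences E).of_postcomp (W' := objectwiseEquivalences E) j q hq' (h ▸ hp')
  have := hp j ⟨hj, hj'⟩
  exact MorphismProperty.of_retract (RetractArrow.ofRightLiftingProperty h) hq

theorem objectwiseInjective_of_groth_map {X Y : Eᵒᵖ ⥤ Cat.{u, u}} {η : X ⟶ Y}
    (h : Function.Injective (Groth.map η).obj) : objectwiseInjective E η := fun S x y hxy => by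
  have h' : (⟨S.unop, x⟩ : Groth X) = ⟨S.unop, y⟩ := h (congrArg (Groth.mk S.unop) hxy)
  injection h'

theorem objectwiseInjective_of_comp {X Y Z : Eᵒᵖ ⥤ Cat.{u, u}} {f : X ⟶ Y} {g : Y ⟶ Z}
    (h : objectwiseInjective E (f ≫ g)) : objectwiseInjective E f := fun S _ _ hxy =>
  h S (congrArg (g.app S).toFunctor.obj hxy)

theorem objectwiseInjective_homEquiv (adj : grothendieckFunctor E ⊣ cartFunctor E)
    {X : Eᵒᵖ ⥤ Cat.{u, u}} {M : FibCat E} (f : (grothendieckFunctor E).obj X ⟶ M)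
    (hf : (FibCat.modelData E).cof f) : objectwiseInjective E (adj.homEquiv X M f) := by
  have h := adj.homEquiv_counit (g := adj.homEquiv X M f)
  rw [Equiv.symm_apply_apply] at h
  rw [h] at hf
  exact objectwiseInjective_of_groth_map (Function.Injective.of_comp hf)

theorem cartFunctor_map_fib (adj : grothendieckFunctor E ⊣ cartFunctor E) {M N : FibCat E}
    {q : M ⟶ N} (hq : (FibCat.modelData E).fib q) :
    (objectwiseInjective E ⊓ objectwiseEquivalences E).rlp ((cartFunctor E).map q) :=
  fun _ _ i hi => (adj.hasLiftingProperty_iff i q).1 (by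
    have := FibCat.trivialCof_fib (E := E)
    have hi' := (FibCat.isQuillenEquivalence_cart adj).map_trivialCof i hi
    exact MorphismProperty.hasLiftingProperty_of_wfs _ _ hi' hq)

theorem unit_weq (adj : grothendieckFunctor E ⊣ cartFunctor E) (X : Eᵒᵖ ⥤ Cat.{u, u}) :
    objectwiseEquivalences E (adj.unit.app X) := by
  rw [← adj.homEquiv_id]
  exact (FibCat.weq_iff_of_adj adj (𝟙 _)).1
    (inferInstanceAs (𝟭 (Groth X)).IsEquivalence)

theorem exists_inj_trivialCof_factorization {X Y : Eᵒᵖ ⥤ Cat.{u, u}} (η : X ⟶ Y) :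
    ∃ (Z : Eᵒᵖ ⥤ Cat.{u, u}) (i : X ⟶ Z) (p : Z ⟶ Y), i ≫ p = η ∧
      (objectwiseInjective E ⊓ objectwiseEquivalences E) i ∧
        (objectwiseInjective E ⊓ objectwiseEquivalences E).rlp p := by
  let adj := FibCat.cartAdjunction E
  have := FibCat.trivialCof_fib (E := E)
  let d := MorphismProperty.factorizationData ((FibCat.modelData E).cof ⊓ (FibCat.modelData E).weq)
    (FibCat.modelData E).fib ((grothendieckFunctor E).map η)
  let k : X ⟶ (cartFunctor E).obj d.Z := adj.homEquiv X d.Z d.i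
  let q := (cartFunctor E).map d.p
  have hq := cartFunctor_map_fib adj d.hp
  have hk : η ≫ adj.unit.app Y = k ≫ q := by
    rw [← adj.homEquiv_naturality_right, d.fac, ← adj.homEquiv_id, ← adj.homEquiv_naturality_left,
      Category.comp_id]
  let ι := pullback.lift η k hk
  have h₁ : ι ≫ pullback.fst (adj.unit.app Y) q = η := pullback.lift_fst _ _ _
  have h₂ : ι ≫ pullback.snd (adj.unit.app Y) q = k := pullback.lift_snd _ _ _
  have sq := IsPullback.of_hasPullback (adj.unit.app Y) q
  have hs : objectwiseEquivalences E (pullback.snd (adj.unit.app Y) q) := fun S =>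
    Cat.equivalences_of_isPullback (isPullback_app sq.flip S)
      (objectwiseIsofibrations_of_inj_fib hq S) (unit_weq adj Y S)
  have hk' : objectwiseEquivalences E k := (FibCat.weq_iff_of_adj adj d.i).1 d.hi.2
  refine ⟨_, ι, pullback.fst _ _, h₁, ⟨objectwiseInjective_of_comp
    (g := pullback.snd (adj.unit.app Y) q) ?_, ?_⟩, ?_⟩
  · rw [h₂]
    exact objectwiseInjective_homEquiv adj d.i d.hi.1
  · exact (objectwiseEquivalences E).of_postcomp (W' := objectwiseEquivalences E) ι _ hs
      (h₂ ▸ hk')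
  · exact MorphismProperty.of_isPullback sq.flip hq

variable (E)

theorem inj_cof_trivialFib : MorphismProperty.IsWeakFactorizationSystem
    (injectiveModelData E).cof ((injectiveModelData E).fib ⊓ (injectiveModelData E).weq) := by
  have : (objectwiseInjective E).HasFactorization
      ((objectwiseInjective E ⊓ objectwiseEquivalences E).rlp ⊓ objectwiseEquivalences E) :=
    ⟨fun f => by
      obtain ⟨Z, i, p, h, hi, hp, -, hp'⟩ := exists_inj_factorization f
      exact ⟨{
        Z := Z
        i := i
        p := p
        fac := h
        hi := hi
        hp := ⟨fun _ _ j hj => hp j hj.1, hp'⟩ }⟩⟩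
  exact .mk' (objectwiseInjective E)
    ((objectwiseInjective E ⊓ objectwiseEquivalences E).rlp ⊓ objectwiseEquivalences E)
    fun i p hi hp => rlp_of_inj_trivialFib hp.1 hp.2 i hi

theorem inj_trivialCof_fib : MorphismProperty.IsWeakFactorizationSystem
    ((injectiveModelData E).cof ⊓ (injectiveModelData E).weq) (injectiveModelData E).fib := by
  have : (objectwiseInjective E ⊓ objectwiseEquivalences E).HasFactorization
      (objectwiseInjective E ⊓ objectwiseEquivalences E).rlp := ⟨fun f => by
    obtain ⟨Z, i, p, h, hi, hp⟩ := exists_inj_trivialCof_factorization f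
    exact ⟨{ Z := Z, i := i, p := p, fac := h, hi := hi, hp := hp }⟩⟩
  exact .mk' (objectwiseInjective E ⊓ objectwiseEquivalences E)
    (objectwiseInjective E ⊓ objectwiseEquivalences E).rlp fun i p hi hp => hp i hi

theorem injectiveModelData_isModelCategory : (injectiveModelData E).IsModelCategory where
  hasInitial := inferInstance
  hasTerminal := inferInstance
  hasPushout _ _ _ _ _ _ := inferInstance
  hasPullback _ _ _ _ _ _ := inferInstance
  twoOutOfThree := inferInstanceAs (objectwiseEquivalences E).HasTwoOutOfThreeProperty
  cof_trivialFib := inj_cof_trivialFib E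
  trivialCof_fib := inj_trivialCof_fib E
  hasLimits := inferInstance
  hasColimits := inferInstance

end PresheafCat

theorem proposition24 (E : Type u) [SmallCategory E] :
    (FibCat.modelData E).IsGeneralizedModelCategory ∧
    (injectiveModelData E).IsModelCategory ∧
    (projectiveModelData E).IsModelCategory ∧
    (Nonempty (grothendieckFunctor E ⊣ cartFunctor E) ∧
      ∀ adj : grothendieckFunctor E ⊣ cartFunctor E,
        IsQuillenEquivalence (injectiveModelData E) (FibCat.modelData E) adj) ∧
    (Nonempty (locFunctor E ⊣ grothendieckFunctor E) ∧
      ∀ adj : locFunctor E ⊣ grothendieckFunctor E,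
        IsQuillenEquivalence (FibCat.modelData E) (projectiveModelData E) adj) :=
  ⟨FibCat.isGeneralizedModelCategory, PresheafCat.injectiveModelData_isModelCategory E,
    PresheafCat.projectiveModelData_isModelCategory E,
    ⟨⟨FibCat.cartAdjunction E⟩, FibCat.isQuillenEquivalence_cart⟩,
    ⟨⟨FibCat.locAdjunction E⟩, FibCat.isQuillenEquivalence_loc⟩⟩
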